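/- **Setting.** Participants $(X_i,B_i(0),B_i(1),W_i)$, $i=1,\dots,n$, are i.i.d. draws from a law $Q$ on $\mathcal X\times\mathcal B^2\times\{0,1\}$ ($\mathcal X,\mathcal B$ standard Borel); $B_i=B_i(W_i)$ is observed. $J$ is fixed, $\|\cdot\|$ is the Euclidean norm, $d:\mathcal B\times\mathbb R^J\to\mathbb R^J$, $y:\mathcal B\times\mathbb R^J\to\mathbb R$, $s^*\in[0,1]^J$, and $m(\boldsymbol b,\boldsymbol\gamma,s)\in\mathcal S\subset\mathbb R^J$ is the cutoff vector computed by the mechanism from submissions $\boldsymbol b$, weights $\boldsymbol\gamma$ and capacities $s$. Put $P_n(\boldsymbol w)=m((B_i(w_i))_i,\frac1n\boldsymbol 1,s^*)$, $Y_i(\boldsymbol w)=y(B_i(w_i),P_n(\boldsymbol w))$. $\Pi$ is a class of rules $\pi:\mathcal X\to\{0,1\}$; $\mathbb E_\pi$ is the expectation over independent $W_i\sim\mathrm{Bernoulli}(\pi(X_i))$ with all $(X_i,B_i(0),B_i(1))$ fixed. Let $$\bar V_n(\pi)=\mathbb E_\pi\Big[\tfrac1n\sum_{i}Y_i(\boldsymbol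 W)\Big],\quad y_\pi(p)=\mathbb E[\pi(X)y(B(1),p)+(1-\pi(X))y(B(0),p)],$$ $$z_\pi(p)=\mathbb E[\pi(X)d(B(1),p)+(1-\pi(X))d(B(0),p)]-s^*,\qquad z_\pi(p^*_\pi)=0,\qquad V^*(\pi)=y_\pi(p^*_\pi).$$ **Estimator.** Independently of the data, split the sample into 3 folds ($k(i)$ is the fold of $i$), and for each $k$ split the data outside fold $k$ into $\mathcal H_{-k}$ and $\mathcal G_{-k}$. With $\tilde e^k$ estimated from $(X_i,W_i)$ on $\mathcal H_{-k}$, run $m$ on the $B_i$ of $\mathcal H_{-k}$, with capacities $s^*$ and weights $|\mathcal H_{-k}|^{-1}\big[\pi(X_i)\frac{W_i}{\tilde e^k(X_i)}+(1-\pi(X_i))\frac{1-W_i}{1-\tilde e^k(X_i)}\big]$, to get $\tilde P^k_\pi$. On $\mathcal G_{-k}$ estimate $\hat e^k$ from $(X_i,W_i)$, and let $\hat\mu^{y,k}_w(x,p)$, $\hat\mu^{d,k}_w(x,p)$ be regressions of $y(B_i,p)$, $d(B_i,p)$ on $(X_i,W_i)$. Write $\hat e_i=\hat e^{k(i)}(X_i)$,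 $\hat\mu^{\cdot}_{wi}=\hat\mu^{\cdot,k(i)}_w(X_i,\tilde P^{k(i)}_\pi)$, $r_{1i}=W_i/\hat e_i$, $r_{0i}=(1-W_i)/(1-\hat e_i)$, $\hat\Gamma^y_{wi}(p)=\hat\mu^y_{wi}+r_{wi}(y(B_i,p)-\hat\mu^y_{wi})$, $\hat\Gamma^d_{wi}(p)=\hat\mu^d_{wi}+r_{wi}(d(B_i,p)-\hat\mu^d_{wi})$. Let $\hat P_\pi=m\big((B_i)_i,(\tfrac1n[\pi(X_i)r_{1i}+(1-\pi(X_i))r_{0i}])_i,\hat s_\pi\big)$ with $\hat s_\pi=s^*+\frac1n\sum_i[(r_{1i}-1)\pi(X_i)\hat\mu^d_{1i}+(r_{0i}-1)(1-\pi(X_i))\hat\mu^d_{0i}]$, and $$\hat V_n(\pi)=\tfrac1n\sum_i\big[\pi(X_i)\hat\Gamma^y_{1i}(\hat P_\pi)+(1-\pi(X_i))\hat\Gamma^y_{0i}(\hat P_\pi)\big].$$ **Assumptions.** All functions and estimation methods are measurable. The classes $\Pi$, $\{y(\cdot,p)\}_{p\in\mathcal S}$, $\{d_j(\cdot,p)\}_{p\in\mathcal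 S}$, and almost surely $\{\hat\mu^{y,k}_w(\cdot,p)\}_{p\in\mathcal S}$, $\{\hat\mu^{d,k}_{w,j}(\cdot,p)\}_{p\in\mathcal S}$, are pointwise measurable: each member is a pointwise limit of a sequence from a fixed countable subclass, indexed, for the last four, by a common countable subset of $\mathcal S$. 1. *(Identification)* $(B(0),B(1))\perp W\mid X$, and $0<e(x)=P(W=1\mid X=x)<1$ for all $x$. 2. *(Cutoff mechanism)* There is $a_n=o(n^{-1/2})$ such that, with $\mathcal C_{\boldsymbol w}=\{p:\|\frac1n\sum_i d(B_i(w_i),p)-s^*\|\le a_n\}$, we have $P_n(\boldsymbol w)\in\mathcal C_{\boldsymbol w}$ whenever $\mathcal C_{\boldsymbol w}\neq\emptyset$; and with probability $1-o(1)$, $\mathcal C_{\boldsymbol w}\ne\emptyset$ for all $\boldsymbol w=(\pi(X_i))_i$, $\pi\in\Pi$, simultaneously. 3. *(Regular outcomes)* For constants $h_d,h_y,C,L,c',c_3,c_4>0$: the classes $\{d_j(\cdot,p)\}_{p\in\mathcal S}$ and $\{y(\cdot,p)\}_{p\in\mathcal S}$ have uniform $L_2$ covering numbers at most $C\epsilon^{-h_d}$,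 $C\epsilon^{-h_y}$ for $0<\epsilon<1$; $y$ and $d$ are bounded on $\mathcal B\times\mathcal S$; $\mathbb E[(d_j(B(w),p)-d_j(B(w),p'))^2]$ and $\mathbb E[(y(B(w),p)-y(B(w),p'))^2]$ are at most $L\|p-p'\|$ for $p,p'\in\mathcal S$; for all $w,x$ the functions $\mu^y_w(x,p)=\mathbb E[y(B(w),p)\mid X=x]$ and $\mu^d_{w,j}(x,p)=\mathbb E[d_j(B(w),p)\mid X=x]$ of $p\in\mathcal S$ are (or extend to) $C^2$ functions of $p$ on an open neighbourhood (the same for all $w,x,j$) of the convex hull of $\mathcal S$, with first and second derivatives bounded by $c'$ in operator norm; the singular values of $\nabla_p z_\pi(p^*_\pi)$ lie in $[c_3,c_4]$ for all $\pi\in\Pi$. 4. *(Regular equilibrium)* $\mathcal S$ is compact; for constants $c_1,c_2>0$ and all $\pi\in\Pi$: $\mathcal S$ contains the ball of radius $c_1$ about $p^*_\pi$, $p^*_\pi$ is the unique zero of $z_\pi$ in $\mathcal S$, and $2\|z_\pi(p)\|\ge c_2$ for all $p\in\mathcal S$ with $\|p-p^*_\pi\|\ge c_3/(2Jc')$. 5.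 *(Nuisance estimates)* For some $\kappa>0$, $\hat e^k(X)\in(\kappa,1-\kappa)$ almost surely for a fresh $X$; $\hat\mu^{y,k}_w(x,p)$ and $\hat\mu^{d,k}_w(x,p)$ are almost surely bounded in absolute value by a constant, uniformly in $x\in\mathcal X$ and $p\in\mathcal S$; there are non-negative $\rho_{e,n}=o(1)$, $\rho_{\mu,n}+\rho_{\theta,n}=o(1)$ with $\rho_{e,n}\rho_{\mu,n}=o(n^{-1/2})$, $\rho_{e,n}\rho_{\theta,n}=o(n^{-1/2})$ such that with probability $1-o(1)$, for all $k,w$ and all $\pi\in\Pi$, the $L_2(Q)$ errors of $\hat\mu^k_w(X,\tilde P^k_\pi)$ (for $\mu_w(X,\tilde P^k_\pi)$, both means stacked) and of $\hat e^k(X)$ are at most $\rho_{\mu,n}$ and $\rho_{e,n}$, and $\|\tilde P^k_\pi-p^*_\pi\|\le\rho_{\theta,n}$; and there is $\rho_{g,n}=o(n^{-1/2})$ such that with probability $1-o(1)$, for all $\pi\in\Pi$, $\|\frac1n\sum_i[\pi(X_i)\hat\Gamma^d_{1i}(\hat P_\pi)+(1-\pi(X_i))\hat\Gamma^d_{0i}(\hat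 P_\pi)]-s^*\|\le\rho_{g,n}$. 6. *(Complexity of the estimates)* With probability $1-o(1)$, for all $k,w,j$ the classes $\{\hat\mu^{y,k}_w(\cdot,p)\}_{p\in\mathcal S}$ and $\{\hat\mu^{d,k}_{w,j}(\cdot,p)\}_{p\in\mathcal S}$ have uniform $L_2$ covering numbers at most $C\epsilon^{-h_y}$ and $C\epsilon^{-h_d}$ for $0<\epsilon<1$. 7. $\Pi$ is a VC class of (finite) dimension $v$. **Theorem.** Let $\hat\pi\in\arg\max_{\pi\in\Pi}\hat V_n(\pi)$. Then $$V^*(\hat\pi)-\sup_{\pi\in\Pi}V^*(\pi)=O_p(n^{-1/2}),\qquad \bar V_n(\hat\pi)-\sup_{\pi\in\Pi}\bar V_n(\pi)=O_p(n^{-1/2}).$$ Moreover $\sup_{\pi\in\Pi}\|\hat P_\pi-p^*_\pi\|=O_p(n^{-1/2})$ and $\sup_{\pi\in\Pi}\mathbb E_\pi\|P_n(\boldsymbol W)-p^*_\pi\|=O_p(n^{-1/2})$. (Probabilities of possibly non-measurable events are outer probabilities.) -/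

import Mathlib

open MeasureTheory ProbabilityTheory Filter
open scoped Topology ENNReal

noncomputable section

namespace CutoffMarket

/-- Cutoffs, capacities and allocations: the space `ℝ^J` with its Euclidean norm. -/
abbrev Vec (J : ℕ) := EuclideanSpace ℝ (Fin J)

/-- A market participant `(X, (B(w))_{w ∈ {0,1}}, W)`: covariates, potential submissions to the
mechanism, and the treatment received in the observed market. -/
abbrev Agent (𝒳 𝓑 : Type*) := 𝒳 × (Bool → 𝓑) × Bool

/-- A deterministic treatment rule `π : 𝒳 → {0,1}`. -/
abbrev Policy (𝒳 : Type*) := 𝒳 → Bool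

section Basics

variable {𝒳 𝓑 : Type*}

/-- The covariates of a participant. -/
def cov (z : Agent 𝒳 𝓑) : 𝒳 := z.1

/-- The potential submission `B(w)`. -/
def bid (z : Agent 𝒳 𝓑) (w : Bool) : 𝓑 := z.2.1 w

/-- The treatment received in the observed market. -/
def treat (z : Agent 𝒳 𝓑) : Bool := z.2.2

/-- The observed submission `B = B(W)`. -/
def obsBid (z : Agent 𝒳 𝓑) : 𝓑 := bid z (treat z)

/-- `{0,1}` as real numbers. -/
def ind (b : Bool) : ℝ := if b then 1 else 0

/-- The Bernoulli(`q`) probability of the outcome `w`. -/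
def bern (q : ℝ) (w : Bool) : ℝ := if w then q else 1 - q

/-- The part of a sample with indices in `s`, listed in increasing order of the index. -/
def subsample {n : ℕ} {α : Type*} (s : Finset (Fin n)) (f : Fin n → α) : Fin s.card → α :=
  fun a => f (s.orderEmbOfFin rfl a)

end Basics

/-! ### Stochastic order and high probability (probabilities are outer probabilities) -/

/-- `R n = O_p(r n)`. -/
def IsBigOP {Ω : Type*} [MeasurableSpace Ω] (P : Measure Ω) (R : ℕ → Ω → ℝ) (r : ℕ → ℝ) : Prop :=
  ∀ ε : ℝ, 0 < ε → ∃ K : ℝ, 0 < K ∧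
    ∀ᶠ n in atTop, P {ω | K * r n < |R n ω|} ≤ ENNReal.ofReal ε

/-- The events `E n` hold with probability `1 - o(1)`. -/
def WithHighProb {Ω : Type*} [MeasurableSpace Ω] (P : Measure Ω) (E : ℕ → Ω → Prop) : Prop :=
  Tendsto (fun n => P {ω | ¬ E n ω}) atTop (𝓝 0)

/-! ### Complexity of function classes -/

/-- Uniform covering numbers: for every finitely supported probability `Q` and `0 < ε < 1`, the
class is covered by at most `C (1/ε)^h` balls of radius `ε` in `L₂(Q)`. -/
def UniformCovering {α : Type*} (F : Set (α → ℝ)) (C h : ℝ) : Prop :=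
  ∀ ε : ℝ, 0 < ε → ε < 1 → ∀ (T : Finset α) (q : α → ℝ),
    (∀ a ∈ T, 0 ≤ q a) → ∑ a ∈ T, q a = 1 →
    ∃ G : Finset (α → ℝ), (G.card : ℝ) ≤ C * (1 / ε) ^ h ∧
      ∀ f ∈ F, ∃ g ∈ G, Real.sqrt (∑ a ∈ T, q a * (f a - g a) ^ 2) ≤ ε

/-- The finite set `s` is shattered by the class of rules. -/
def Shatters {𝒳 : Type*} (Rules : Set (Policy 𝒳)) (s : Finset 𝒳) : Prop :=
  ∀ t ⊆ s, ∃ π ∈ Rules, ∀ x ∈ s, (π x = true ↔ x ∈ t)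

/-- The class of rules is a VC class of dimension `v`: `v` is the largest cardinality of a
shattered finite set. -/
def HasVCDim {𝒳 : Type*} (Rules : Set (Policy 𝒳)) (v : ℕ) : Prop :=
  IsGreatest {k | ∃ s : Finset 𝒳, s.card = k ∧ Shatters Rules s} v

/-- The class `{f p : p ∈ S}` is pointwise measurable through the countable index set `S₀`: each
member is a pointwise limit of a sequence of members with indices in `S₀`. -/
def PointwiseSeparable {I α V : Type*} [TopologicalSpace V] (S₀ S : Set I) (f : I → α → V) : Prop :=
  ∀ p ∈ S, ∃ u : ℕ → I, (∀ m, u m ∈ S₀) ∧ ∀ a, Tendsto (fun m => f (u m) a) atTop (𝓝 (f p a))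

/-! ### The mechanism, and the finite market -/

/-- The primitives of a cutoff mechanism. `clear l b γ s` is the cutoff vector that the mechanism
computes from `l` submissions `b`, weights `γ` and capacities `s`. -/
structure Mechanism (J : ℕ) (𝓑 : Type*) where
  /-- allocation given own submission and cutoffs -/
  d : 𝓑 → Vec J → Vec J
  /-- outcome given own submission and cutoffs -/
  y : 𝓑 → Vec J → ℝ
  /-- fractional capacities -/
  capacity : Vec J
  /-- the set of possible cutoffs -/
  S : Set (Vec J)
  /-- the market-clearing algorithm -/
  clear : (l : ℕ) → (Fin l → 𝓑) → (Fin l → ℝ) → Vec J → Vec J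

section Market

variable {J : ℕ} {𝒳 𝓑 : Type*} (M : Mechanism J 𝓑)

/-- The cutoffs `P_n(w)` of the finite market under the treatment vector `w`. -/
def finiteCutoff {n : ℕ} (z : Fin n → Agent 𝒳 𝓑) (w : Fin n → Bool) : Vec J :=
  M.clear n (fun i => bid (z i) (w i)) (fun _ => 1 / (n : ℝ)) M.capacity

/-- The outcome `Y_i(w) = y(B_i(w_i), P_n(w))`. -/
def outcome {n : ℕ} (z : Fin n → Agent 𝒳 𝓑) (w : Fin n → Bool) (i : Fin n) : ℝ :=
  M.y (bid (z i) (w i)) (finiteCutoff M z w)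

/-- The set `𝒞_w` of cutoffs that clear the finite market up to the error `a`. -/
def clearingSet (a : ℝ) {n : ℕ} (z : Fin n → Agent 𝒳 𝓑) (w : Fin n → Bool) : Set (Vec J) :=
  {p | ‖(1 / (n : ℝ)) • ∑ i, M.d (bid (z i) (w i)) p - M.capacity‖ ≤ a}

/-- `𝔼_π`: the expectation over independent treatments `W_i ~ Bernoulli(π(X_i))`, holding the
potential submissions and the covariates fixed. -/
def policyExpectation (π : Policy 𝒳) {n : ℕ} (z : Fin n → Agent 𝒳 𝓑)
    (f : (Fin n → Bool) → ℝ) : ℝ :=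
  ∑ w : Fin n → Bool, (∏ i, bern (ind (π (cov (z i)))) (w i)) * f w

/-- The finite-market value of a rule. -/
def finiteValue {n : ℕ} (z : Fin n → Agent 𝒳 𝓑) (π : Policy 𝒳) : ℝ :=
  policyExpectation π z (fun w => (1 / (n : ℝ)) * ∑ i, outcome M z w i)

/-! ### The continuum market -/

variable [MeasurableSpace 𝒳] [MeasurableSpace 𝓑]

/-- `y_π(p) = 𝔼[π(X) y(B(1), p) + (1 - π(X)) y(B(0), p)]`. -/
def meanOutcome (Q : Measure (Agent 𝒳 𝓑)) (π : Policy 𝒳) (p : Vec J) : ℝ :=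
  ∫ a, (ind (π (cov a)) * M.y (bid a true) p + (1 - ind (π (cov a))) * M.y (bid a false) p) ∂Q

/-- `z_π(p) = 𝔼[π(X) d(B(1), p) + (1 - π(X)) d(B(0), p)] - s*`. -/
def excessDemand (Q : Measure (Agent 𝒳 𝓑)) (π : Policy 𝒳) (p : Vec J) : Vec J :=
  (∫ a, (ind (π (cov a)) • M.d (bid a true) p + (1 - ind (π (cov a))) • M.d (bid a false) p) ∂Q)
    - M.capacity

/-- The continuum-market value `V*(π) = y_π(p*_π)`, where `pstar π` is the continuum cutoff. -/
def contValue (Q : Measure (Agent 𝒳 𝓑)) (pstar : Policy 𝒳 → Vec J) (π : Policy 𝒳) : ℝ :=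
  meanOutcome M Q π (pstar π)

end Market

/-! ### The localized doubly-robust estimator -/

/-- A split of `n` observations: the fold of each observation and, for each fold `k`, a label that
divides the observations outside fold `k` into `ℋ₋ₖ` (label true) and `𝒢₋ₖ` (label false). -/
abbrev Split (n : ℕ) := (Fin n → Fin 3) × (Fin 3 → Fin n → Bool)

/-- The half `ℋ₋ₖ` of the data outside fold `k`. -/
def halfH {n : ℕ} (σ : Split n) (k : Fin 3) : Finset (Fin n) :=
  Finset.univ.filter (fun i => σ.1 i ≠ k ∧ σ.2 k i = true)

/-- The half `𝒢₋ₖ` of the data outside fold `k`. -/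
def halfG {n : ℕ} (σ : Split n) (k : Fin 3) : Finset (Fin n) :=
  Finset.univ.filter (fun i => σ.1 i ≠ k ∧ σ.2 k i = false)

/-- The estimation methods: each maps a sample of any size `l` to an estimated function. -/
structure Estimators (J : ℕ) (𝒳 : Type*) where
  /-- first-step propensity score, from `(X_i, W_i)` -/
  propFirst : (l : ℕ) → (Fin l → 𝒳 × Bool) → 𝒳 → ℝ
  /-- second-step propensity score, from `(X_i, W_i)` -/
  prop : (l : ℕ) → (Fin l → 𝒳 × Bool) → 𝒳 → ℝ
  /-- regression of a scalar outcome on `(X_i, W_i)`, evaluated at `(w, x)` -/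
  regY : (l : ℕ) → (Fin l → (𝒳 × Bool) × ℝ) → Bool → 𝒳 → ℝ
  /-- regression of an allocation vector on `(X_i, W_i)`, evaluated at `(w, x)` -/
  regD : (l : ℕ) → (Fin l → (𝒳 × Bool) × Vec J) → Bool → 𝒳 → Vec J

section Estimation

variable {J : ℕ} {𝒳 𝓑 : Type*} (M : Mechanism J 𝓑) (A : Estimators J 𝒳)
  {n : ℕ} (σ : Split n) (z : Fin n → Agent 𝒳 𝓑)

/-- The probability of treatment `w` under the propensity `e`. -/
def armProb (e : ℝ) (w : Bool) : ℝ := bern e w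

/-- The inverse-propensity factor `1(W = w) / P(W = w | X)` at propensity `e`. -/
def ipw (w W : Bool) (e : ℝ) : ℝ := (if W = w then 1 else 0) / armProb e w

/-- `π(X) W / e + (1 - π(X)) (1 - W) / (1 - e)`. -/
def policyIpw (b W : Bool) (e : ℝ) : ℝ := ind b * ipw true W e + (1 - ind b) * ipw false W e

/-- The first-step propensity estimate `ẽ`, computed on `ℋ₋ₖ`. -/
def propTilde (k : Fin 3) : 𝒳 → ℝ :=
  A.propFirst _ (subsample (halfH σ k) (fun i => (cov (z i), treat (z i))))

/-- The first-step cutoffs `P̃_π`, computed on `ℋ₋ₖ`. -/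
def cutoffTilde (k : Fin 3) (π : Policy 𝒳) : Vec J :=
  M.clear _ (subsample (halfH σ k) (fun i => obsBid (z i)))
    (subsample (halfH σ k) (fun i =>
      policyIpw (π (cov (z i))) (treat (z i)) (propTilde A σ z k (cov (z i)))
        / ((halfH σ k).card : ℝ)))
    M.capacity

/-- The propensity estimate `ê^k`, computed on `𝒢₋ₖ`. -/
def propHat (k : Fin 3) : 𝒳 → ℝ :=
  A.prop _ (subsample (halfG σ k) (fun i => (cov (z i), treat (z i))))

/-- `μ̂^{y,k}_w(x, p)`: regression of `y(B_i, p)` on `(X_i, W_i)` over `𝒢₋ₖ`. -/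
def muYHat (k : Fin 3) (w : Bool) (p : Vec J) : 𝒳 → ℝ :=
  A.regY _ (subsample (halfG σ k)
    (fun i => ((cov (z i), treat (z i)), M.y (obsBid (z i)) p))) w

/-- `μ̂^{d,k}_w(x, p)`: regression of `d(B_i, p)` on `(X_i, W_i)` over `𝒢₋ₖ`. -/
def muDHat (k : Fin 3) (w : Bool) (p : Vec J) : 𝒳 → Vec J :=
  A.regD _ (subsample (halfG σ k)
    (fun i => ((cov (z i), treat (z i)), M.d (obsBid (z i)) p))) w

/-- The cross-fitted propensity `ê^{k(i)}(X_i)`. -/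
def propAt (i : Fin n) : ℝ := propHat A σ z (σ.1 i) (cov (z i))

/-- `μ̂^{y,k(i)}_w(X_i)`, with the regression localized at `P̃_π`. -/
def muYAt (π : Policy 𝒳) (w : Bool) (i : Fin n) : ℝ :=
  muYHat M A σ z (σ.1 i) w (cutoffTilde M A σ z (σ.1 i) π) (cov (z i))

/-- `μ̂^{d,k(i)}_w(X_i)`, with the regression localized at `P̃_π`. -/
def muDAt (π : Policy 𝒳) (w : Bool) (i : Fin n) : Vec J :=
  muDHat M A σ z (σ.1 i) w (cutoffTilde M A σ z (σ.1 i) π) (cov (z i))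

/-- The perturbed capacities `ŝ_π`. -/
def capacityHat (π : Policy 𝒳) : Vec J :=
  M.capacity + (1 / (n : ℝ)) • ∑ i,
    ((ipw true (treat (z i)) (propAt A σ z i) - 1) • ind (π (cov (z i))) • muDAt M A σ z π true i
      + (1 - ind (π (cov (z i)))) • (ipw false (treat (z i)) (propAt A σ z i) - 1) •
          muDAt M A σ z π false i)

/-- The second-step cutoffs `P̂_π`: the mechanism is run on the observed submissions with the
weights `γ̂_π` and the capacities `ŝ_π`. -/
def cutoffHat (π : Policy 𝒳) : Vec J :=
  M.clear n (fun i => obsBid (z i))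
    (fun i => policyIpw (π (cov (z i))) (treat (z i)) (propAt A σ z i) / (n : ℝ))
    (capacityHat M A σ z π)

/-- The doubly-robust score for outcomes, `Γ̂^y_{wi}(p)`. -/
def scoreY (π : Policy 𝒳) (w : Bool) (i : Fin n) (p : Vec J) : ℝ :=
  muYAt M A σ z π w i + ipw w (treat (z i)) (propAt A σ z i) *
    (M.y (obsBid (z i)) p - muYAt M A σ z π w i)

/-- The doubly-robust score for allocations, `Γ̂^d_{wi}(p)`. -/
def scoreD (π : Policy 𝒳) (w : Bool) (i : Fin n) (p : Vec J) : Vec J :=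
  muDAt M A σ z π w i + ipw w (treat (z i)) (propAt A σ z i) •
    (M.d (obsBid (z i)) p - muDAt M A σ z π w i)

/-- The estimated excess demand: the average doubly-robust score for allocations, minus `s*`. -/
def excessDemandHat (π : Policy 𝒳) (p : Vec J) : Vec J :=
  (1 / (n : ℝ)) • ∑ i, (ind (π (cov (z i))) • scoreD M A σ z π true i p
      + (1 - ind (π (cov (z i)))) • scoreD M A σ z π false i p) - M.capacity

/-- The estimated value `V̂_n(π)`. -/
def valueHat (π : Policy 𝒳) : ℝ :=
  (1 / (n : ℝ)) * ∑ i,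
    (ind (π (cov (z i))) * scoreY M A σ z π true i (cutoffHat M A σ z π)
      + (1 - ind (π (cov (z i)))) * scoreY M A σ z π false i (cutoffHat M A σ z π))

end Estimation

/-! ### Assumptions -/

/-- True propensity score and conditional means `μ^y_w(x, p)`, `μ^d_w(x, p)`. -/
structure Nuisance (J : ℕ) (𝒳 : Type*) where
  e : 𝒳 → ℝ
  muY : Bool → 𝒳 → Vec J → ℝ
  muD : Bool → 𝒳 → Vec J → Vec J

/-- The constants of the regularity assumptions. -/
structure Constants where
  hd : ℝ
  hy : ℝ
  C : ℝ
  L : ℝ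
  cDeriv : ℝ
  c1 : ℝ
  c2 : ℝ
  c3 : ℝ
  c4 : ℝ

/-- All constants are positive. -/
structure Constants.Positive (c : Constants) : Prop where
  hd : 0 < c.hd
  hy : 0 < c.hy
  C : 0 < c.C
  L : 0 < c.L
  cDeriv : 0 < c.cDeriv
  c1 : 0 < c.c1
  c2 : 0 < c.c2
  c3 : 0 < c.c3
  c4 : 0 < c.c4

section Assumptions

variable {J : ℕ} {𝒳 𝓑 Ω : Type*} [MeasurableSpace 𝒳] [MeasurableSpace 𝓑] [MeasurableSpace Ω]

/-- The sigma-algebra on participants generated by the covariates. -/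
abbrev covSigma (𝒳 𝓑 : Type*) [MeasurableSpace 𝒳] : MeasurableSpace (Agent 𝒳 𝓑) :=
  MeasurableSpace.comap (Prod.fst : Agent 𝒳 𝓑 → 𝒳) inferInstance

/-- The covariates generate a sub-sigma-algebra. -/
theorem covSigma_le (𝒳 𝓑 : Type*) [MeasurableSpace 𝒳] [MeasurableSpace 𝓑] :
    covSigma 𝒳 𝓑 ≤ (inferInstance : MeasurableSpace (Agent 𝒳 𝓑)) :=
  measurable_fst.comap_le

/-- The data: participants are drawn i.i.d. from `Q`, and for each `n` the random split is
independent of the data. -/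
structure Sampling (P : Measure Ω) (Q : Measure (Agent 𝒳 𝓑)) (Z : ℕ → Ω → Agent 𝒳 𝓑)
    (split : (n : ℕ) → Ω → Split n) : Prop where
  meas : ∀ i, Measurable (Z i)
  indep : iIndepFun Z P
  law : ∀ i, P.map (Z i) = Q
  split_meas : ∀ n, Measurable (split n)
  split_indep : ∀ n, IndepFun (split n) (fun ω (i : Fin n) => Z i ω) P

/-- Unconfoundedness and overlap, with `e` the propensity score. -/
structure Identification [StandardBorelSpace 𝒳] [StandardBorelSpace 𝓑]
    (Q : Measure (Agent 𝒳 𝓑)) [IsFiniteMeasure Q] (e : 𝒳 → ℝ) : Prop where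
  unconfounded : CondIndepFun (covSigma 𝒳 𝓑) (covSigma_le 𝒳 𝓑)
    (fun a : Agent 𝒳 𝓑 => a.2.1) (fun a : Agent 𝒳 𝓑 => treat a) Q
  propensity_meas : Measurable e
  propensity : Q[fun a : Agent 𝒳 𝓑 => ind (treat a) | covSigma 𝒳 𝓑] =ᵐ[Q] fun a => e (cov a)
  overlap : ∀ x, 0 < e x ∧ e x < 1

/-- The cutoffs of the finite market approximately clear it, with error `a n = o(n^{-1/2})`: the set
of approximately clearing cutoffs is non-empty with probability `1 - o(1)`, simultaneously for all
treatment vectors that rules of the class generate, and the mechanism selects from it when it is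
non-empty. -/
structure ClearsFiniteMarkets (P : Measure Ω) (Z : ℕ → Ω → Agent 𝒳 𝓑) (M : Mechanism J 𝓑)
    (Rules : Set (Policy 𝒳)) : Prop where
  capacity_mem : ∀ j, M.capacity j ∈ Set.Icc (0 : ℝ) 1
  cutoff_mem : ∀ l b γ s, M.clear l b γ s ∈ M.S
  clears : ∃ a : ℕ → ℝ, Tendsto (fun n : ℕ => a n * Real.sqrt n) atTop (𝓝 0) ∧
    WithHighProb P (fun n ω => ∀ π ∈ Rules,
      (clearingSet M (a n) (fun i : Fin n => Z i ω) (fun i => π (cov (Z i ω)))).Nonempty) ∧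
    ∀ (n : ℕ) (ω : Ω) (w : Fin n → Bool),
      (clearingSet M (a n) (fun i : Fin n => Z i ω) w).Nonempty →
      finiteCutoff M (fun i : Fin n => Z i ω) w ∈ clearingSet M (a n) (fun i : Fin n => Z i ω) w

/-- Regularity of outcomes and allocations. -/
structure RegularOutcomes (Q : Measure (Agent 𝒳 𝓑)) (M : Mechanism J 𝓑) (η : Nuisance J 𝒳)
    (c : Constants) (pstar : Policy 𝒳 → Vec J) (Rules : Set (Policy 𝒳)) : Prop where
  covering_d : ∀ j, UniformCovering {f | ∃ p ∈ M.S, f = fun b => M.d b p j} c.C c.hd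
  covering_y : UniformCovering {f | ∃ p ∈ M.S, f = fun b => M.y b p} c.C c.hy
  bounded : ∃ K : ℝ, ∀ b, ∀ p ∈ M.S, |M.y b p| ≤ K ∧ ‖M.d b p‖ ≤ K
  weak_cont_d : ∀ w j, ∀ p ∈ M.S, ∀ p₂ ∈ M.S,
    ∫ a, (M.d (bid a w) p j - M.d (bid a w) p₂ j) ^ 2 ∂Q ≤ c.L * ‖p - p₂‖
  weak_cont_y : ∀ w, ∀ p ∈ M.S, ∀ p₂ ∈ M.S,
    ∫ a, (M.y (bid a w) p - M.y (bid a w) p₂) ^ 2 ∂Q ≤ c.L * ‖p - p₂‖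
  condMean_y : ∀ w, ∀ p ∈ M.S,
    Q[fun a => M.y (bid a w) p | covSigma 𝒳 𝓑] =ᵐ[Q] fun a => η.muY w (cov a) p
  condMean_d : ∀ w, ∀ p ∈ M.S,
    Q[fun a => M.d (bid a w) p | covSigma 𝒳 𝓑] =ᵐ[Q] fun a => η.muD w (cov a) p
  /-- twice continuous differentiability in `p`, near the convex hull of the set of cutoffs, with
  first and second derivatives bounded by `cDeriv` -/
  smooth : ∃ U : Set (Vec J), IsOpen U ∧ convexHull ℝ M.S ⊆ U ∧ ∀ w x,
    (ContDiffOn ℝ 2 (η.muY w x) U ∧ ∀ p ∈ U,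
      ‖iteratedFDeriv ℝ 1 (η.muY w x) p‖ ≤ c.cDeriv ∧
      ‖iteratedFDeriv ℝ 2 (η.muY w x) p‖ ≤ c.cDeriv) ∧
    ∀ j, ContDiffOn ℝ 2 (fun p => η.muD w x p j) U ∧ ∀ p ∈ U,
      ‖iteratedFDeriv ℝ 1 (fun p => η.muD w x p j) p‖ ≤ c.cDeriv ∧
      ‖iteratedFDeriv ℝ 2 (fun p => η.muD w x p j) p‖ ≤ c.cDeriv
  /-- the singular values of the Jacobian of excess demand at the continuum cutoffs -/
  jacobian : ∀ π ∈ Rules, ∀ i < J,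
    (fderiv ℝ (excessDemand M Q π) (pstar π)).toLinearMap.singularValues i ∈ Set.Icc c.c3 c.c4

/-- `pstar π` is the unique, well-separated cutoff vector that clears the continuum market under
`π`. -/
structure RegularEquilibrium (Q : Measure (Agent 𝒳 𝓑)) (M : Mechanism J 𝓑)
    (c : Constants) (pstar : Policy 𝒳 → Vec J) (Rules : Set (Policy 𝒳)) : Prop where
  compact : IsCompact M.S
  ball_subset : ∀ π ∈ Rules, Metric.ball (pstar π) c.c1 ⊆ M.S
  clears : ∀ π ∈ Rules, excessDemand M Q π (pstar π) = 0
  unique : ∀ π ∈ Rules, ∀ p ∈ M.S, excessDemand M Q π p = 0 → p = pstar π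
  separated : ∀ π ∈ Rules, ∀ p ∈ M.S, c.c3 / (2 * J * c.cDeriv) ≤ ‖p - pstar π‖ →
    c.c2 ≤ 2 * ‖excessDemand M Q π p‖

/-- The conditions on the nuisance estimates. Expectations over a fresh test observation, given the
training data, are integrals over `Q`. -/
structure NuisanceRates (P : Measure Ω) (Q : Measure (Agent 𝒳 𝓑)) (Z : ℕ → Ω → Agent 𝒳 𝓑)
    (split : (n : ℕ) → Ω → Split n) (M : Mechanism J 𝓑) (A : Estimators J 𝒳) (η : Nuisance J 𝒳)
    (pstar : Policy 𝒳 → Vec J) (Rules : Set (Policy 𝒳)) : Prop where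
  overlap : ∃ κ : ℝ, 0 < κ ∧ ∀ n k, ∀ᵐ ω ∂P, ∀ᵐ a ∂Q,
    propHat A (split n ω) (fun i => Z i ω) k (cov a) ∈ Set.Ioo κ (1 - κ)
  bounded : ∃ K : ℝ, ∀ n k, ∀ᵐ ω ∂P, ∀ w x, ∀ p ∈ M.S,
    |muYHat M A (split n ω) (fun i => Z i ω) k w p x| ≤ K ∧
    ∀ j, |muDHat M A (split n ω) (fun i => Z i ω) k w p x j| ≤ K
  rates : ∃ ρμ ρe ρθ : ℕ → ℝ,
    Tendsto ρe atTop (𝓝 0) ∧ Tendsto (fun n => ρμ n + ρθ n) atTop (𝓝 0) ∧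
    (∀ n, 0 ≤ ρμ n ∧ 0 ≤ ρe n ∧ 0 ≤ ρθ n) ∧
    Tendsto (fun n : ℕ => Real.sqrt n * (ρe n * ρμ n)) atTop (𝓝 0) ∧
    Tendsto (fun n : ℕ => Real.sqrt n * (ρe n * ρθ n)) atTop (𝓝 0) ∧
    WithHighProb P (fun n ω => ∀ k, ∀ π ∈ Rules,
      (∀ w, Real.sqrt (∫ a,
          ((muYHat M A (split n ω) (fun i => Z i ω) k w
              (cutoffTilde M A (split n ω) (fun i => Z i ω) k π) (cov a)
            - η.muY w (cov a) (cutoffTilde M A (split n ω) (fun i => Z i ω) k π)) ^ 2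
          + ‖muDHat M A (split n ω) (fun i => Z i ω) k w
              (cutoffTilde M A (split n ω) (fun i => Z i ω) k π) (cov a)
            - η.muD w (cov a) (cutoffTilde M A (split n ω) (fun i => Z i ω) k π)‖ ^ 2) ∂Q)
          ≤ ρμ n) ∧
      Real.sqrt (∫ a, (propHat A (split n ω) (fun i => Z i ω) k (cov a) - η.e (cov a)) ^ 2 ∂Q)
          ≤ ρe n ∧
      ‖cutoffTilde M A (split n ω) (fun i => Z i ω) k π - pstar π‖ ≤ ρθ n)
  clearing : ∃ ρg : ℕ → ℝ, Tendsto (fun n : ℕ => Real.sqrt n * ρg n) atTop (𝓝 0) ∧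
    WithHighProb P (fun n ω => ∀ π ∈ Rules,
      ‖excessDemandHat M A (split n ω) (fun i => Z i ω) π
        (cutoffHat M A (split n ω) (fun i => Z i ω) π)‖ ≤ ρg n)

/-- With probability `1 - o(1)`, the estimated conditional means, as classes indexed by `p`, have
polynomial uniform covering numbers. -/
def NuisanceComplexity (P : Measure Ω) (Z : ℕ → Ω → Agent 𝒳 𝓑)
    (split : (n : ℕ) → Ω → Split n) (M : Mechanism J 𝓑) (A : Estimators J 𝒳)
    (c : Constants) : Prop :=
  WithHighProb P (fun n ω => ∀ k w,
    UniformCovering {f | ∃ p ∈ M.S, f = muYHat M A (split n ω) (fun i => Z i ω) k w p} c.C c.hy ∧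
    ∀ j, UniformCovering
      {f | ∃ p ∈ M.S, f = fun x => muDHat M A (split n ω) (fun i => Z i ω) k w p x j} c.C c.hd)

/-- Measurability: all functions and estimation methods are measurable, and the function classes
over which suprema are taken are pointwise measurable. -/
structure Measurability (P : Measure Ω) (Z : ℕ → Ω → Agent 𝒳 𝓑)
    (split : (n : ℕ) → Ω → Split n) (M : Mechanism J 𝓑) (A : Estimators J 𝒳)
    (η : Nuisance J 𝒳) (Rules : Set (Policy 𝒳)) : Prop where
  meas_y : ∀ p ∈ M.S, Measurable (fun b => M.y b p)
  meas_d : ∀ p ∈ M.S, Measurable (fun b => M.d b p)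
  meas_muY : ∀ w, ∀ p ∈ M.S, Measurable (fun x => η.muY w x p)
  meas_muD : ∀ w, ∀ p ∈ M.S, Measurable (fun x => η.muD w x p)
  meas_rule : ∀ π ∈ Rules, Measurable π
  meas_prop : ∀ l, Measurable (fun q : (Fin l → 𝒳 × Bool) × 𝒳 => A.prop l q.1 q.2)
  meas_regY : ∀ l w,
    Measurable (fun q : (Fin l → (𝒳 × Bool) × ℝ) × 𝒳 => A.regY l q.1 w q.2)
  meas_regD : ∀ l w,
    Measurable (fun q : (Fin l → (𝒳 × Bool) × Vec J) × 𝒳 => A.regD l q.1 w q.2)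
  separable_rules : ∃ R₀ : Set (Policy 𝒳), R₀.Countable ∧ R₀ ⊆ Rules ∧
    PointwiseSeparable R₀ Rules (fun π x => π x)
  separable_cutoffs : ∃ S₀ : Set (Vec J), S₀.Countable ∧ S₀ ⊆ M.S ∧
    PointwiseSeparable S₀ M.S (fun p b => M.y b p) ∧
    (∀ j, PointwiseSeparable S₀ M.S (fun p b => M.d b p j)) ∧
    ∀ n k w, ∀ᵐ ω ∂P,
      PointwiseSeparable S₀ M.S (fun p x => muYHat M A (split n ω) (fun i => Z i ω) k w p x) ∧
      ∀ j, PointwiseSeparable S₀ M.S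
        (fun p x => muDHat M A (split n ω) (fun i => Z i ω) k w p x j)

end Assumptions

end CutoffMarket

end

/-! All four claims follow from two bounds of order 1/√n that are uniform over the class of rules:
one for the estimated value and cutoffs against V*(π) and p*_π (`boundedInProb_estimators`), one for
the finite-market value and cutoffs against the same limits (`boundedInProb_finiteMarket`). A
maximizer of the estimated value then loses at most a fixed multiple of these errors. Rules are
deterministic, so the expectation over treatments is evaluation at the single vector (π(X_i))
(`policyExpectation_eq`), and the finite market is an empirical version of the continuum market.

Both kinds of cutoffs are random, but each approximately solves an empirical market-clearing
equation. Empirical excess demand is within O(1/√n) of z_π uniformly over rules and over all p in S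
(up to bias for the estimator), so z_π is small at the random cutoffs themselves. Separation of the
zero of z_π then places them near p*_π, and the lower bound on the singular values of the Jacobian
turns the size of z_π into a distance (`norm_sub_le_excessDemand`). Values follow because y_π is
Lipschitz in p. Uniformity over all of S makes any equicontinuity argument at p*_π unnecessary.

For the estimators, averaged doubly-robust scores replace sample means. Their bias in each arm is at
most κ⁻¹ρ_e(Δ + ρ_μ), a product of the two nuisance errors (`doublyRobust_bias`). Here Δ ≤ c'‖p -
P̃‖ is the price of regressions localized at P̃ instead of p. At p = P̂ the bias involves ρ_e‖P̂ -
p*‖, which is not yet known to be O(1/√n); its coefficient tends to zero, so it is absorbed into the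
left side of the Jacobian bound. The remaining terms ρ_eρ_θ and ρ_eρ_μ are o(1/√n) by assumption.

The uniform deviations come from `boundedInProb_deviation`. Every function involved is an indicator
1(π(X) = w) times a bounded weight times a member of a class with polynomial covering numbers.
Sauer–Shelah bounds the packing numbers of the rules (`vc_packing`), these combine with the covering
numbers (`smallPacking_product`), chaining controls the signed sums (`chaining_tail`), and
`symmetrization` passes to centred sums. Nuisance estimates used in a fold depend only on data
outside it, and symmetrization exchanges only coordinates inside it, so these random functions
behave like fixed ones. -/

open MeasureTheory ProbabilityTheory Filter
open scoped Topology ENNReal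

noncomputable section

namespace CutoffMarket

/-! ### Rademacher sums -/

section Rademacher

/-- A Boolean as a sign. -/
def sgn (b : Bool) : ℝ := if b then 1 else -1

theorem abs_sgn (b : Bool) : |sgn b| = 1 := by cases b <;> simp [sgn]

variable {ι : Type*} [Fintype ι]

/-- The signed sum `∑ k, ± v k`. -/
def radSum (τ : ι → Bool) (v : ι → ℝ) : ℝ := ∑ k, sgn (τ k) * v k

theorem radSum_sub (τ : ι → Bool) (v w : ι → ℝ) :
    radSum τ v - radSum τ w = radSum τ (fun k => v k - w k) := by
  simp only [radSum, ← Finset.sum_sub_distrib]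
  exact Finset.sum_congr rfl fun k _ => by ring

/-- The sum over sign patterns factorizes over coordinates into factors 2 cosh(l v_k), and cosh x ≤
exp(x²/2). Signs are handled by counting patterns, so 2 to the number of coordinates plays the part
of total mass. -/
theorem rademacher_mgf [DecidableEq ι] (v : ι → ℝ) (l : ℝ) :
    ∑ τ : ι → Bool, Real.exp (l * radSum τ v)
      ≤ 2 ^ Fintype.card ι * Real.exp (l ^ 2 / 2 * ∑ k, v k ^ 2) := by
  have h1 : ∀ τ : ι → Bool, Real.exp (l * radSum τ v)
      = ∏ k, Real.exp (l * (sgn (τ k) * v k)) := by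
    intro τ
    rw [radSum, Finset.mul_sum, Real.exp_sum]
  simp_rw [h1]
  rw [← Fintype.prod_sum (fun (k : ι) (b : Bool) => Real.exp (l * (sgn b * v k)))]
  have h2 : ∀ k : ι, ∑ b : Bool, Real.exp (l * (sgn b * v k))
      ≤ 2 * Real.exp (l ^ 2 / 2 * v k ^ 2) := by
    intro k
    have := Real.cosh_le_exp_half_sq (l * v k)
    rw [Real.cosh_eq] at this
    have e : (l * v k) ^ 2 / 2 = l ^ 2 / 2 * v k ^ 2 := by ring
    rw [e] at this
    simp only [Fintype.sum_bool, sgn]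
    simp only [if_true, Bool.false_eq_true, if_false, one_mul, neg_mul, mul_neg]
    linarith
  calc ∏ k, ∑ b : Bool, Real.exp (l * (sgn b * v k))
      ≤ ∏ k, 2 * Real.exp (l ^ 2 / 2 * v k ^ 2) :=
        Finset.prod_le_prod (fun k _ => Finset.sum_nonneg fun b _ => (Real.exp_pos _).le)
          (fun k _ => h2 k)
    _ = _ := by
        rw [Finset.prod_mul_distrib, Finset.prod_const, Finset.card_univ, Finset.mul_sum,
          Real.exp_sum]

theorem rademacher_tail_one_sided [DecidableEq ι] (v : ι → ℝ) {t V : ℝ} (ht : 0 ≤ t) (hV : 0 < V)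
    (hv : ∑ k, v k ^ 2 ≤ V) :
    ((Finset.univ.filter (fun τ : ι → Bool => t < radSum τ v)).card : ℝ)
      ≤ 2 ^ Fintype.card ι * Real.exp (-(t ^ 2 / (2 * V))) := by
  -- This value minimizes the Chernoff exponent l²V/2 - lt.
  set l := t / V with hl
  have hl0 : 0 ≤ l := div_nonneg ht hV.le
  have h1 : ((Finset.univ.filter (fun τ : ι → Bool => t < radSum τ v)).card : ℝ)
      * Real.exp (l * t) ≤ ∑ τ : ι → Bool, Real.exp (l * radSum τ v) := by
    rw [← nsmul_eq_mul]
    refine le_trans (Finset.card_nsmul_le_sum _ (fun τ => Real.exp (l * radSum τ v)) _ ?_)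
      (Finset.sum_le_sum_of_subset_of_nonneg (Finset.filter_subset _ _)
        fun τ _ _ => (Real.exp_pos _).le)
    intro τ hτ
    exact Real.exp_le_exp.2 (mul_le_mul_of_nonneg_left (Finset.mem_filter.1 hτ).2.le hl0)
  have h2 := h1.trans (rademacher_mgf v l)
  have h3 : (2 : ℝ) ^ Fintype.card ι * Real.exp (l ^ 2 / 2 * ∑ k, v k ^ 2)
      ≤ 2 ^ Fintype.card ι * Real.exp (l ^ 2 / 2 * V) := by gcongr
  have h4 := h2.trans h3
  rw [← le_div_iff₀ (Real.exp_pos _), mul_div_assoc, ← Real.exp_sub] at h4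
  have e : l ^ 2 / 2 * V - l * t = -(t ^ 2 / (2 * V)) := by
    rw [hl]; field_simp; ring
  rwa [e] at h4

theorem rademacher_tail [DecidableEq ι] (v : ι → ℝ) {t V : ℝ} (ht : 0 ≤ t) (hV : 0 < V)
    (hv : ∑ k, v k ^ 2 ≤ V) :
    ((Finset.univ.filter (fun τ : ι → Bool => t < |radSum τ v|)).card : ℝ)
      ≤ 2 ^ Fintype.card ι * (2 * Real.exp (-(t ^ 2 / (2 * V)))) := by
  have h1 := rademacher_tail_one_sided v ht hV hv
  have h2 := rademacher_tail_one_sided (fun k => -v k) ht hV (by simpa using hv)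
  have hs : Finset.univ.filter (fun τ : ι → Bool => t < |radSum τ v|) ⊆
      Finset.univ.filter (fun τ : ι → Bool => t < radSum τ v) ∪
      Finset.univ.filter (fun τ : ι → Bool => t < radSum τ (fun k => -v k)) := by
    intro τ hτ
    have hτ' := (Finset.mem_filter.1 hτ).2
    have e : radSum τ (fun k => -v k) = - radSum τ v := by simp [radSum]
    simp only [Finset.mem_union, Finset.mem_filter, Finset.mem_univ, true_and, e]
    exact lt_abs.1 hτ'
  have h3 : ((Finset.univ.filter (fun τ : ι → Bool => t < |radSum τ v|)).card : ℝ) ≤ _ :=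
    Nat.cast_le.2 ((Finset.card_le_card hs).trans (Finset.card_union_le _ _))
  push_cast at h3
  linarith

end Rademacher

/-! ### Chaining -/

section Chaining

variable {I ι : Type*} [Fintype ι]

/-- Packing numbers of a family of vectors: at the scale `2⁻ʲ √N`, at most `exp (D 2ʲ)`. -/
def SmallPacking (v : I → ι → ℝ) (N D : ℝ) : Prop :=
  ∀ (j : ℕ) (F : Finset I),
    (∀ i ∈ F, ∀ i' ∈ F, i ≠ i' → (1 / 4) ^ j * N < ∑ k, (v i k - v i' k) ^ 2) →
    (F.card : ℝ) ≤ Real.exp (D * 2 ^ j)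

/-- A maximal separated set is a net. -/
theorem exists_net_of_packing (dist : I → I → ℝ) (hsymm : ∀ i i', dist i i' = dist i' i)
    {ε B : ℝ} (hself : ∀ i, dist i i ≤ ε)
    (h : ∀ F : Finset I, (∀ i ∈ F, ∀ i' ∈ F, i ≠ i' → ε < dist i i') → (F.card : ℝ) ≤ B) :
    ∃ F : Finset I, (F.card : ℝ) ≤ B ∧ ∀ i, ∃ i' ∈ F, dist i i' ≤ ε := by
  classical
  let sep : Finset I → Prop := fun F => ∀ i ∈ F, ∀ i' ∈ F, i ≠ i' → ε < dist i i'
  let A : Set ℕ := {m | ∃ F : Finset I, sep F ∧ F.card = m}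
  have hA : A.Nonempty := ⟨0, ∅, fun i hi => absurd hi (Finset.notMem_empty i), rfl⟩
  have hB : BddAbove A := by
    refine ⟨⌊B⌋₊, ?_⟩
    rintro m ⟨F, hF, rfl⟩
    exact Nat.le_floor (h F hF)
  -- A separated set of largest cardinality exists because cardinalities are bounded by B; a point
  -- farther than ε from all its members could be added to it.
  obtain ⟨F, hF, hc⟩ := Nat.sSup_mem hA hB
  refine ⟨F, h F hF, fun i => ?_⟩
  by_contra! hcon
  have hi : i ∉ F := fun hi => absurd (hcon i hi) (not_lt.2 (hself i))
  have hs : sep (insert i F) := by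
    intro a ha a' ha' hne
    rcases Finset.mem_insert.1 ha with h1 | h1 <;> rcases Finset.mem_insert.1 ha' with h2 | h2
    · exact absurd (h1.trans h2.symm) hne
    · exact h1 ▸ hcon a' h2
    · subst h2
      exact hsymm _ _ ▸ hcon a h1
    · exact hF a h1 a' h2 hne
  have := le_csSup hB ⟨insert i F, hs, rfl⟩
  rw [Finset.card_insert_of_notMem hi, hc] at this
  omega

theorem SmallPacking.exists_centers {v : I → ι → ℝ} {N D : ℝ} (h : SmallPacking v N D)
    (hN : 0 ≤ N) (j : ℕ) :
    ∃ F : Finset I, (F.card : ℝ) ≤ Real.exp (D * 2 ^ j) ∧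
      ∀ i, ∃ i' ∈ F, ∑ k, (v i k - v i' k) ^ 2 ≤ (1 / 4) ^ j * N :=
  exists_net_of_packing (fun i i' => ∑ k, (v i k - v i' k) ^ 2)
    (fun i i' => Finset.sum_congr rfl fun k _ => sub_sq_comm _ _)
    (fun i => by simpa using by positivity) (h j)

/-- Uses 2^j ≥ j + 1 and exp(-a) ≤ 1/2. It makes the failure probabilities of the chaining levels
summable with ratio 1/2. -/
theorem exp_neg_mul_two_pow_le {a : ℝ} (ha : 1 ≤ a) (j : ℕ) :
    Real.exp (-(a * 2 ^ j)) ≤ Real.exp (-a) * (1 / 2) ^ j := by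
  have h1 : ((j : ℝ) + 1) ≤ 2 ^ j := by exact_mod_cast Nat.lt_two_pow_self (n := j)
  have h2 : Real.exp (-a) ≤ 1 / 2 := by
    have := Real.add_one_le_exp a
    rw [Real.exp_neg, ← one_div]
    exact one_div_le_one_div_of_le (by norm_num) (by linarith)
  calc Real.exp (-(a * 2 ^ j)) ≤ Real.exp (-(a * (j + 1))) := by
        apply Real.exp_le_exp.2; nlinarith
    _ = Real.exp (-a) * Real.exp (-a) ^ j := by
        rw [← Real.exp_nat_mul, ← Real.exp_add]; congr 1; ring
    _ ≤ _ := by gcongr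

/-- Each vector is reached from a coarse net through nets at the scales 2⁻ʲ√N. The link at level j
may contribute K√N (3/4)^j: this is summable, yet decays slowly enough compared with the link length
2⁻ʲ√N that the sub-Gaussian exponent grows faster than the entropy 3D·2^j of the pairs. A union
bound over finitely many levels concludes. -/
theorem chaining_tail {v : I → ι → ℝ} {N D b K : ℝ} (h : SmallPacking v N D) (hN : 0 < N)
    (hcard : (Fintype.card ι : ℝ) ≤ N) (hb : 0 < b) (hv : ∀ i k, |v i k| ≤ b) (hK0 : 0 < K)
    (hK : 1 ≤ K ^ 2 / 8 - 3 * D) :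
    (Nat.card {τ : ι → Bool // ∃ i, 6 * K * Real.sqrt N < |radSum τ (v i)|} : ℝ)
      ≤ 2 ^ Fintype.card ι *
        (2 * Real.exp (D - K ^ 2 / (2 * b ^ 2)) + 4 * Real.exp (-(K ^ 2 / 8 - 3 * D))) := by
  classical
  set a := K ^ 2 / 8 - 3 * D with ha
  choose F hF c hcF hc using fun j => h.exists_centers hN.le j
  set R := Real.sqrt N with hR
  have hR0 : 0 < R := Real.sqrt_pos.2 hN
  have hRR : R ^ 2 = N := Real.sq_sqrt hN.le
  set m := Fintype.card ι
  let dist2 : I → I → ℝ := fun p q => ∑ k, (v p k - v q k) ^ 2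
  let B0 : Finset (ι → Bool) :=
    (F 0).biUnion fun i => Finset.univ.filter fun τ => K * R < |radSum τ (v i)|
  let pairs : ℕ → Finset (I × I) := fun j =>
    ((F (j + 1)) ×ˢ (F j)).filter fun p => dist2 p.1 p.2 ≤ 4 * ((1 / 4) ^ j * N)
  let B : ℕ → Finset (ι → Bool) := fun j =>
    (pairs j).biUnion fun p => Finset.univ.filter fun τ =>
      K * R * (3 / 4) ^ j < |radSum τ (fun k => v p.1 k - v p.2 k)|
  have hsq : ∀ i, ∑ k, v i k ^ 2 ≤ b ^ 2 * N := by
    intro i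
    calc ∑ k, v i k ^ 2 ≤ ∑ _k : ι, b ^ 2 := by
          refine Finset.sum_le_sum fun k _ => ?_
          rw [← sq_abs]; exact pow_le_pow_left₀ (abs_nonneg _) (hv i k) 2
      _ = b ^ 2 * m := by simp [m, mul_comm]
      _ ≤ _ := by gcongr
  have hB0 : (B0.card : ℝ) ≤ 2 ^ m * (2 * Real.exp (D - K ^ 2 / (2 * b ^ 2))) := by
    calc (B0.card : ℝ) ≤ ∑ i ∈ F 0,
          ((Finset.univ.filter fun τ : ι → Bool => K * R < |radSum τ (v i)|).card : ℝ) := by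
          exact_mod_cast Finset.card_biUnion_le
      _ ≤ ∑ i ∈ F 0, 2 ^ m * (2 * Real.exp (-((K * R) ^ 2 / (2 * (b ^ 2 * N))))) :=
          Finset.sum_le_sum fun i _ => rademacher_tail _ (by positivity) (by positivity) (hsq i)
      _ = (F 0).card * (2 ^ m * (2 * Real.exp (-(K ^ 2 / (2 * b ^ 2))))) := by
          rw [Finset.sum_const, nsmul_eq_mul, mul_pow, hRR]
          congr 5
          field_simp
      _ ≤ Real.exp (D * 2 ^ 0) * (2 ^ m * (2 * Real.exp (-(K ^ 2 / (2 * b ^ 2))))) := by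
          gcongr; exact hF 0
      _ = _ := by rw [sub_eq_add_neg, Real.exp_add]; simp; ring
  have hBj : ∀ j, ((B j).card : ℝ) ≤ 2 ^ m * (2 * Real.exp (-a)) * (1 / 2) ^ j := by
    intro j
    have hpc : ((pairs j).card : ℝ) ≤ Real.exp (3 * D * 2 ^ j) := by
      calc ((pairs j).card : ℝ) ≤ ((F (j + 1)).card * (F j).card : ℝ) := by
            rw [← Nat.cast_mul, ← Finset.card_product]
            exact Nat.cast_le.2 (Finset.card_filter_le _ _)
        _ ≤ Real.exp (D * 2 ^ (j + 1)) * Real.exp (D * 2 ^ j) := by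
            gcongr
            · exact hF _
            · exact hF _
        _ = _ := by rw [← Real.exp_add]; congr 1; ring
    -- The exponent is K²/8 · (9/4)^j, since (3/4)² divided by 1/4 is 9/4; it dominates 2^j, the
    -- growth rate of the entropy.
    have hex : K ^ 2 / 8 * 2 ^ j
        ≤ (K * R * (3 / 4) ^ j) ^ 2 / (2 * (4 * ((1 / 4) ^ j * N))) := by
      have e : (K * R * (3 / 4 : ℝ) ^ j) ^ 2 / (2 * (4 * ((1 / 4) ^ j * N)))
          = K ^ 2 / 8 * (9 / 4) ^ j := by
        rw [mul_pow, mul_pow, hRR, ← pow_mul, mul_comm j 2, pow_mul]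
        have : (9 / 4 : ℝ) ^ j = ((3 / 4 : ℝ) ^ 2) ^ j / (1 / 4) ^ j := by
          rw [← div_pow]; norm_num
        rw [this]; field_simp; norm_num
      rw [e]; gcongr; norm_num
    calc ((B j).card : ℝ) ≤ ∑ p ∈ pairs j, ((Finset.univ.filter fun τ : ι → Bool =>
          K * R * (3 / 4) ^ j < |radSum τ (fun k => v p.1 k - v p.2 k)|).card : ℝ) := by
          exact_mod_cast Finset.card_biUnion_le
      _ ≤ ∑ p ∈ pairs j, 2 ^ m *
            (2 * Real.exp (-((K * R * (3 / 4) ^ j) ^ 2 / (2 * (4 * ((1 / 4) ^ j * N)))))) :=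
          Finset.sum_le_sum fun p hp => rademacher_tail _ (by positivity) (by positivity)
            (Finset.mem_filter.1 hp).2
      _ ≤ Real.exp (3 * D * 2 ^ j) * (2 ^ m * (2 * Real.exp (-(K ^ 2 / 8 * 2 ^ j)))) := by
          rw [Finset.sum_const, nsmul_eq_mul]
          gcongr
      _ = 2 ^ m * 2 * Real.exp (-(a * 2 ^ j)) := by
          have : Real.exp (-(a * 2 ^ j))
              = Real.exp (3 * D * 2 ^ j) * Real.exp (-(K ^ 2 / 8 * 2 ^ j)) := by
            rw [← Real.exp_add]; congr 1; rw [ha]; ring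
          rw [this]; ring
      _ ≤ 2 ^ m * 2 * (Real.exp (-a) * (1 / 2) ^ j) := by
          gcongr; exact exp_neg_mul_two_pow_le hK j
      _ = _ := by ring
  -- the last level of the chain
  obtain ⟨J, hJ⟩ : ∃ J : ℕ, N * (1 / 2) ^ J ≤ K * R := by
    obtain ⟨J, hJ⟩ := exists_pow_lt_of_lt_one (show (0 : ℝ) < K * R / N by positivity)
      (show (1 / 2 : ℝ) < 1 by norm_num)
    refine ⟨J, ?_⟩
    rw [lt_div_iff₀ hN] at hJ
    linarith
  -- Beyond the last level Cauchy–Schwarz suffices for every sign pattern: the error is at most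
  -- N·2⁻ᴶ.
  have hrem : ∀ i τ, |radSum τ (v i) - radSum τ (v (c J i))| ≤ K * R := by
    intro i τ
    refine le_trans ?_ hJ
    rw [radSum_sub]
    have h1 : |radSum τ (fun k => v i k - v (c J i) k)| ^ 2
        ≤ (∑ k : ι, sgn (τ k) ^ 2) * ∑ k, (v i k - v (c J i) k) ^ 2 := by
      rw [sq_abs]
      exact Finset.sum_mul_sq_le_sq_mul_sq _ _ _
    have h2 : ∑ k : ι, sgn (τ k) ^ 2 = m := by
      simp [← sq_abs (sgn _), abs_sgn, m]
    rw [h2] at h1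
    have h3 : (m : ℝ) * ∑ k, (v i k - v (c J i) k) ^ 2 ≤ N * ((1 / 4) ^ J * N) :=
      mul_le_mul hcard (hc J i) (Finset.sum_nonneg fun _ _ => sq_nonneg _) hN.le
    have e : N * ((1 / 4) ^ J * N) = (N * (1 / 2) ^ J) ^ 2 := by
      rw [mul_pow, ← pow_mul, mul_comm J 2, pow_mul]; norm_num; ring
    rw [e] at h3
    simpa using abs_le_of_sq_le_sq (h1.trans h3) (by positivity)
  have hlink : ∀ i j, dist2 (c (j + 1) i) (c j i) ≤ 4 * ((1 / 4) ^ j * N) := by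
    intro i j
    have h1 := hc (j + 1) i
    have h2 := hc j i
    have h3 : dist2 (c (j + 1) i) (c j i) ≤ 2 * ∑ k, (v i k - v (c (j + 1) i) k) ^ 2
        + 2 * ∑ k, (v i k - v (c j i) k) ^ 2 := by
      rw [Finset.mul_sum, Finset.mul_sum, ← Finset.sum_add_distrib]
      refine Finset.sum_le_sum fun k _ => ?_
      nlinarith [sq_nonneg ((v i k - v (c (j + 1) i) k) + (v i k - v (c j i) k))]
    have h4 : (0 : ℝ) ≤ (1 / 4) ^ j * N := by positivity
    rw [pow_succ] at h1
    linarith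
  have hgeom : ∀ J : ℕ, ∑ j ∈ Finset.range J, (3 / 4 : ℝ) ^ j ≤ 4 := by
    intro J
    rw [geom_sum_eq (by norm_num)]
    have : (0 : ℝ) ≤ (3 / 4) ^ J := by positivity
    rw [div_le_iff_of_neg (by norm_num)]; linarith
  have hgeom2 : ∀ J : ℕ, ∑ j ∈ Finset.range J, (1 / 2 : ℝ) ^ j ≤ 2 := by
    intro J
    rw [geom_sum_eq (by norm_num)]
    have : (0 : ℝ) ≤ (1 / 2) ^ J := by positivity
    rw [div_le_iff_of_neg (by norm_num)]; linarith
  -- The 6 is a budget: one K√N for the coarsest centre, four for the links, since the powers of 3/4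
  -- sum to at most 4, and one for the remainder.
  have hsub : Finset.univ.filter (fun τ : ι → Bool => ∃ i, 6 * K * R < |radSum τ (v i)|)
      ⊆ B0 ∪ (Finset.range J).biUnion B := by
    intro τ hτ
    obtain ⟨i, hi⟩ := (Finset.mem_filter.1 hτ).2
    by_contra hcon
    rw [Finset.mem_union, not_or] at hcon
    have h0 : |radSum τ (v (c 0 i))| ≤ K * R := by
      by_contra! hlt
      exact hcon.1 (Finset.mem_biUnion.2 ⟨c 0 i, hcF 0 i, by simpa using hlt⟩)
    have hj : ∀ j ∈ Finset.range J,
        |radSum τ (v (c (j + 1) i)) - radSum τ (v (c j i))| ≤ K * R * (3 / 4) ^ j := by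
      intro j hj
      by_contra! hlt
      refine hcon.2 (Finset.mem_biUnion.2 ⟨j, hj, Finset.mem_biUnion.2
        ⟨(c (j + 1) i, c j i), Finset.mem_filter.2 ⟨Finset.mem_product.2 ⟨hcF _ i, hcF _ i⟩,
          hlink i j⟩, ?_⟩⟩)
      rw [radSum_sub] at hlt
      simpa using hlt
    have htel := Finset.sum_range_sub (fun j => radSum τ (v (c j i))) J
    have h1 : |∑ j ∈ Finset.range J, (radSum τ (v (c (j + 1) i)) - radSum τ (v (c j i)))|
        ≤ 4 * (K * R) := by
      refine (Finset.abs_sum_le_sum_abs _ _).trans ((Finset.sum_le_sum hj).trans ?_)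
      rw [← Finset.mul_sum]
      have := hgeom J
      nlinarith [mul_pos hK0 hR0]
    rw [htel] at h1
    have h2 := hrem i τ
    rw [abs_le] at h0 h1 h2
    rcases lt_abs.1 hi with hi | hi <;> linarith [h0.1, h0.2, h1.1, h1.2, h2.1, h2.2]
  rw [Nat.card_eq_fintype_card, Fintype.card_subtype]
  calc ((Finset.univ.filter (fun τ : ι → Bool =>
        ∃ i, 6 * K * R < |radSum τ (v i)|)).card : ℝ)
      ≤ B0.card + ∑ j ∈ Finset.range J, ((B j).card : ℝ) := by
        exact_mod_cast (Finset.card_le_card hsub).trans ((Finset.card_union_le _ _).trans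
          (Nat.add_le_add_left Finset.card_biUnion_le _))
    _ ≤ 2 ^ m * (2 * Real.exp (D - K ^ 2 / (2 * b ^ 2)))
        + ∑ j ∈ Finset.range J, 2 ^ m * (2 * Real.exp (-a)) * (1 / 2) ^ j :=
        add_le_add hB0 (Finset.sum_le_sum fun j _ => hBj j)
    _ ≤ 2 ^ m * (2 * Real.exp (D - K ^ 2 / (2 * b ^ 2))) + 2 ^ m * (2 * Real.exp (-a)) * 2 := by
        rw [← Finset.mul_sum]
        gcongr
        exact hgeom2 J
    _ = _ := by ring

end Chaining

/-! ### Symmetrization -/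

section Symmetrization

variable {I ι α : Type*} [Fintype ι] [MeasurableSpace α]

/-- Exchange the coordinates of two samples where `τ` is false. -/
def swapSample (τ : ι → Bool) (p : (ι → α) × (ι → α)) : (ι → α) × (ι → α) :=
  (fun k => if τ k then p.1 k else p.2 k, fun k => if τ k then p.2 k else p.1 k)

/-- Regrouped as a family of independent pairs, the two samples are acted on pair by pair, and
exchanging the members of a pair preserves Q × Q. -/
theorem measurePreserving_swapSample (Q : Measure α) [IsProbabilityMeasure Q] (τ : ι → Bool) :
    MeasurePreserving (swapSample τ)
      ((Measure.pi fun _ : ι => Q).prod (Measure.pi fun _ : ι => Q))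
      ((Measure.pi fun _ : ι => Q).prod (Measure.pi fun _ : ι => Q)) := by
  have h1 := measurePreserving_arrowProdEquivProdArrow α α ι (fun _ => Q) (fun _ => Q)
  have h2 : MeasurePreserving
      (fun (a : ι → α × α) k => (if τ k then id else Prod.swap) (a k))
      (Measure.pi fun _ : ι => Q.prod Q) (Measure.pi fun _ : ι => Q.prod Q) := by
    refine measurePreserving_pi _ _ fun k => ?_
    cases τ k
    · simpa using Measure.measurePreserving_swap
    · simpa using MeasurePreserving.id (Q.prod Q)
  have h3 := (h1.comp h2).comp (h1.symm _)
  convert h3 using 1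
  funext p
  refine Prod.ext ?_ ?_ <;> funext k <;>
    cases hτ : τ k <;> simp [swapSample, hτ, MeasurableEquiv.arrowProdEquivProdArrow,
      Equiv.arrowProdEquivProdArrow]

/-- Chebyshev's inequality with variance at most N b². The factor 2 in `hsN` yields the bound 1/2,
which is what the ghost sample of the symmetrization needs. -/
theorem integral_deviation_tail (Q : Measure α) [IsProbabilityMeasure Q] {f : α → ℝ}
    (hf : Measurable f) {b : ℝ} (hb : ∀ a, |f a| ≤ b) (T : Finset ι) {N s : ℝ}
    (hcard : (Fintype.card ι : ℝ) ≤ N) (hs : 0 < s) (hsN : 2 * N * b ^ 2 ≤ s ^ 2) :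
    (Measure.pi fun _ : ι => Q) {z | s < |∑ k ∈ T, (f (z k) - ∫ a, f a ∂Q)|}
      ≤ ENNReal.ofReal (1 / 2) := by
  classical
  set μ := Measure.pi fun _ : ι => Q
  -- Coordinates outside T carry the zero function, so the variance formula for sums over the full
  -- product applies.
  let X : ι → α → ℝ := fun k => if k ∈ T then f else 0
  have hX : ∀ k, MemLp (X k) 2 Q := by
    intro k
    by_cases hk : k ∈ T
    · simp only [X, hk, if_true]
      exact MemLp.of_bound hf.aestronglyMeasurable b (ae_of_all _ hb)
    · simp only [X, hk, if_false]
      exact MemLp.zero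
  have hXs : MemLp (∑ k, fun z : ι → α => X k (z k)) 2 μ :=
    memLp_finsetSum' _ fun k _ => (hX k).comp_measurePreserving (measurePreserving_eval _ k)
  have hvar : Var[∑ k, fun z : ι → α => X k (z k); μ] ≤ N * b ^ 2 := by
    rw [variance_sum_pi hX]
    calc ∑ k, Var[X k; Q] ≤ ∑ _k : ι, b ^ 2 := by
          refine Finset.sum_le_sum fun k _ => ?_
          have h0 : ∀ a, |X k a| ≤ b := by
            intro a
            by_cases hk : k ∈ T
            · simpa [X, hk] using hb a
            · simpa [X, hk] using (abs_nonneg _).trans (hb a)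
          have := variance_le_sq_of_bounded (μ := Q) (X := X k) (a := -b) (b := b)
            (ae_of_all _ fun a => abs_le.1 (h0 a)) (hX k).aestronglyMeasurable.aemeasurable
          rwa [sub_neg_eq_add, add_self_div_two] at this
      _ = Fintype.card ι * b ^ 2 := by simp
      _ ≤ _ := by gcongr
  have hmean : ∫ z, (∑ k, fun z : ι → α => X k (z k)) z ∂μ = ∑ k ∈ T, ∫ a, f a ∂Q := by
    simp only [Finset.sum_apply]
    rw [integral_finsetSum]
    · have : ∀ k, ∫ z : ι → α, X k (z k) ∂μ = ∫ a, X k a ∂Q := fun k =>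
        integral_comp_eval (μ := fun _ : ι => Q) (i := k) (f := X k)
          (hX k).aestronglyMeasurable
      simp only [this]
      rw [← Finset.sum_filter_add_sum_filter_not Finset.univ (· ∈ T)]
      rw [Finset.sum_eq_zero (s := Finset.univ.filter fun k => ¬ k ∈ T)]
      · rw [add_zero]
        have : Finset.univ.filter (fun k => k ∈ T) = T := by ext; simp
        rw [this]
        exact Finset.sum_congr rfl fun k hk => by simp [X, hk]
      · intro k hk
        simp [X, (Finset.mem_filter.1 hk).2]
    · intro k _
      exact ((hX k).comp_measurePreserving (measurePreserving_eval _ k)).integrable (by norm_num)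
  have hcheb := meas_ge_le_variance_div_sq hXs hs
  refine (measure_mono ?_).trans (hcheb.trans (ENNReal.ofReal_le_ofReal ?_))
  · intro z hz
    simp only [Set.mem_ofPred_eq] at hz ⊢
    rw [hmean]
    have : (∑ k, fun z : ι → α => X k (z k)) z = ∑ k ∈ T, f (z k) := by
      simp only [Finset.sum_apply, X]
      rw [← Finset.sum_filter_add_sum_filter_not Finset.univ (· ∈ T),
        Finset.sum_eq_zero (s := Finset.univ.filter fun k => ¬ k ∈ T)]
      · rw [add_zero]
        have : Finset.univ.filter (fun k => k ∈ T) = T := by ext; simp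
        rw [this]
        exact Finset.sum_congr rfl fun k hk => by simp [hk]
      · intro k hk
        simp [(Finset.mem_filter.1 hk).2]
    rw [this, ← Finset.sum_sub_distrib]
    exact hz.le
  · rw [div_le_div_iff₀ (by positivity) (by norm_num)]
    linarith

/-- The values of a family of data-dependent functions at the sample points with indices in `T`. -/
def sampleValues [DecidableEq ι] (T : Finset ι) (g : I → (ι → α) → α → ℝ) (z : ι → α) (i : I)
    (k : ι) : ℝ := if k ∈ T then g i z (z k) else 0

/-- The centred sum over the sample points with indices in `T`. -/
def centredSum (Q : Measure α) (T : Finset ι) (g : I → (ι → α) → α → ℝ) (z : ι → α) (i : I) : ℝ :=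
  ∑ k ∈ T, (g i z (z k) - ∫ a, g i z a ∂Q)

omit [Fintype ι] in
theorem measurable_sampleValues [DecidableEq ι] {T : Finset ι} {g : I → (ι → α) → α → ℝ}
    (hg : ∀ i, Measurable (Function.uncurry (g i))) (i : I) (k : ι) :
    Measurable fun z => sampleValues T g z i k := by
  unfold sampleValues
  split_ifs
  · exact (hg i).comp (measurable_id.prodMk (measurable_pi_apply k))
  · exact measurable_const

/-- A countable index set has countably many finite subsets, and for each of them separation is a
finite conjunction of measurable inequalities. -/
theorem measurableSet_smallPacking [Countable I] [DecidableEq ι] {T : Finset ι} {g : I → (ι → α) → α → ℝ}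
    (hg : ∀ i, Measurable (Function.uncurry (g i))) (N D : ℝ) :
    MeasurableSet {z : ι → α | SmallPacking (sampleValues T g z) N D} := by
  unfold SmallPacking
  simp only [Set.ofPred_forall]
  refine MeasurableSet.iInter fun j => MeasurableSet.iInter fun F => ?_
  by_cases hF : (F.card : ℝ) ≤ Real.exp (D * 2 ^ j)
  · simp [hF]
  simp only [hF, imp_false]
  refine MeasurableSet.compl (s := {z | ∀ i ∈ F, ∀ i' ∈ F, i ≠ i' →
    (1 / 4) ^ j * N < ∑ k, (sampleValues T g z i k - sampleValues T g z i' k) ^ 2}) ?_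
  simp only [Set.ofPred_forall]
  refine MeasurableSet.iInter fun i => MeasurableSet.iInter fun _ => MeasurableSet.iInter fun i' =>
    MeasurableSet.iInter fun _ => MeasurableSet.iInter fun _ => ?_
  exact measurableSet_lt measurable_const (Finset.measurable_sum _ fun k _ =>
    ((measurable_sampleValues hg i k).sub (measurable_sampleValues hg i' k)).pow_const 2)

omit [Fintype ι] in
theorem measurable_centredSum {Q : Measure α} [IsProbabilityMeasure Q] {T : Finset ι}
    {g : I → (ι → α) → α → ℝ}
    (hg : ∀ i, Measurable (Function.uncurry (g i))) (i : I) :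
    Measurable fun z => centredSum Q T g z i := by
  refine Finset.measurable_sum _ fun k _ => Measurable.sub ?_ ?_
  · exact (hg i).comp (measurable_id.prodMk (measurable_pi_apply k))
  · exact ((hg i).stronglyMeasurable.integral_prod_right' (ν := Q)).measurable

/-- Symmetrization in probability. -/
theorem symmetrization [Countable I] [DecidableEq ι] (Q : Measure α) [IsProbabilityMeasure Q]
    {g : I → (ι → α) → α → ℝ}
    (hg : ∀ i, Measurable (Function.uncurry (g i))) {b : ℝ} (hb : ∀ i z a, |g i z a| ≤ b)
    (T : Finset ι) (hdep : ∀ i z z', (∀ k ∉ T, z k = z' k) → g i z = g i z') {N s : ℝ}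
    (hcard : (Fintype.card ι : ℝ) ≤ N) (hs : 0 < s) (hsN : 2 * N * b ^ 2 ≤ s ^ 2)
    (τ : ι → Bool) :
    (Measure.pi fun _ : ι => Q) {z | ∃ i, 2 * s < |centredSum Q T g z i|}
      ≤ 4 * (Measure.pi fun _ : ι => Q)
        {z | ∃ i, s / 2 < |radSum τ (sampleValues T g z i)|} := by
  classical
  set μ := Measure.pi fun _ : ι => Q with hμ
  set A := {z | ∃ i, 2 * s < |centredSum Q T g z i|} with hA
  set C := {z | ∃ i, s / 2 < |radSum τ (sampleValues T g z i)|} with hC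
  let B : Set ((ι → α) × (ι → α)) := {p | ∃ i, s < |∑ k ∈ T, (g i p.1 (p.1 k) - g i p.1 (p.2 k))|}
  have hgk : ∀ i k, Measurable fun p : (ι → α) × (ι → α) => g i p.1 (p.1 k) := fun i k =>
    (hg i).comp (measurable_fst.prodMk ((measurable_pi_apply k).comp measurable_fst))
  have hgk' : ∀ i k, Measurable fun p : (ι → α) × (ι → α) => g i p.1 (p.2 k) := fun i k =>
    (hg i).comp (measurable_fst.prodMk ((measurable_pi_apply k).comp measurable_snd))
  have hBm : MeasurableSet B := by
    simp only [B, Set.ofPred_exists]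
    refine MeasurableSet.iUnion fun i => measurableSet_lt measurable_const ?_
    exact (Finset.measurable_sum _ fun k _ => (hgk i k).sub (hgk' i k)).abs
  have hAm : MeasurableSet A := by
    simp only [hA, Set.ofPred_exists]
    exact MeasurableSet.iUnion fun i => measurableSet_lt measurable_const
      (measurable_centredSum hg i).abs
  have hCm : MeasurableSet C := by
    simp only [hC, Set.ofPred_exists]
    refine MeasurableSet.iUnion fun i => measurableSet_lt measurable_const ?_
    unfold radSum
    exact (Finset.measurable_sum _ fun k _ =>
      (measurable_sampleValues hg i k).const_mul _).abs
  have h1 : μ A * (1 / 2) ≤ (μ.prod μ) B := by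
    rw [Measure.prod_apply hBm]
    calc μ A * (1 / 2) = ∫⁻ z in A, (1 / 2) ∂μ := by
          rw [setLIntegral_const, mul_comm]
      _ ≤ ∫⁻ z in A, μ (Prod.mk z ⁻¹' B) ∂μ := by
          refine setLIntegral_mono_ae' hAm (ae_of_all _ fun z hz => ?_)
          obtain ⟨i, hi⟩ := hz
          have h2 := integral_deviation_tail (ι := ι) Q
            ((hg i).comp (measurable_const.prodMk measurable_id) : Measurable (g i z))
            (hb i z) T hcard hs hsN
          set G := {z' : ι → α | s < |∑ k ∈ T, (g i z (z' k) - ∫ a, g i z a ∂Q)|} with hG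
          have hGm : MeasurableSet G := by
            refine measurableSet_lt measurable_const (Finset.measurable_sum _ fun k _ => ?_).abs
            exact ((hg i).comp (measurable_const.prodMk (measurable_pi_apply k))).sub_const _
          have h3 : Gᶜ ⊆ Prod.mk z ⁻¹' B := by
            intro z' hz'
            simp only [hG, Set.mem_compl_iff, Set.mem_ofPred_eq, not_lt] at hz'
            refine ⟨i, ?_⟩
            have e : ∑ k ∈ T, (g i z (z k) - g i z (z' k)) = centredSum Q T g z i
                - ∑ k ∈ T, (g i z (z' k) - ∫ a, g i z a ∂Q) := by
              rw [centredSum, ← Finset.sum_sub_distrib]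
              exact Finset.sum_congr rfl fun k _ => by ring
            simp only
            rw [e]
            have := abs_sub_abs_le_abs_sub (centredSum Q T g z i)
              (∑ k ∈ T, (g i z (z' k) - ∫ a, g i z a ∂Q))
            linarith
          have h4 : μ Gᶜ = 1 - μ G := prob_compl_eq_one_sub hGm
          refine le_trans ?_ (measure_mono h3)
          rw [h4]
          have h5 : μ G ≤ 1 / 2 := by
            refine h2.trans (le_of_eq ?_)
            rw [ENNReal.ofReal_div_of_pos (by norm_num)]; simp
          calc (1 / 2 : ℝ≥0∞) = 1 - 1 / 2 := by simp
            _ ≤ 1 - μ G := tsub_le_tsub_left h5 1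
      _ ≤ _ := setLIntegral_le_lintegral _ _
  -- `ρ` exchanges points according to the signs and `ρ'` exchanges all of them, both only inside T.
  -- The functions depend only on coordinates outside T, so neither exchange alters them. After `ρ`
  -- the difference of sums carries the signs τ, and `ρ'` turns its ghost half into the same
  -- expression as its first half; hence s/2 for each and the factor 2.
  let ρ : ι → Bool := fun k => if k ∈ T then τ k else true
  let ρ' : ι → Bool := fun k => if k ∈ T then false else true
  have hdep1 : ∀ i p, g i (swapSample ρ p).1 = g i p.1 := by
    intro i p
    refine hdep i _ _ fun k hk => ?_
    simp [swapSample, ρ, hk]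
  have hdep2 : ∀ i p, g i (swapSample ρ' p).1 = g i p.1 := by
    intro i p
    refine hdep i _ _ fun k hk => ?_
    simp [swapSample, ρ', hk]
  let C1 : Set ((ι → α) × (ι → α)) := {p | p.1 ∈ C}
  have hC1m : MeasurableSet C1 := measurable_fst hCm
  have h2 : swapSample ρ ⁻¹' B ⊆ C1 ∪ swapSample ρ' ⁻¹' C1 := by
    rintro p ⟨i, hi⟩
    rw [hdep1] at hi
    have e : ∑ k ∈ T, (g i p.1 ((swapSample ρ p).1 k) - g i p.1 ((swapSample ρ p).2 k))
        = radSum τ (sampleValues T g p.1 i) - radSum τ (sampleValues T g (swapSample ρ' p).1 i) := by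
      rw [radSum_sub]
      simp only [radSum, sampleValues, hdep2]
      rw [← Finset.sum_filter_add_sum_filter_not Finset.univ (· ∈ T),
        Finset.sum_eq_zero (s := Finset.univ.filter fun k => ¬ k ∈ T), add_zero]
      · have : Finset.univ.filter (fun k => k ∈ T) = T := by ext; simp
        rw [this]
        refine Finset.sum_congr rfl fun k hk => ?_
        cases hτ : τ k <;> simp [hk, swapSample, ρ, ρ', hτ, sgn]
      · intro k hk
        simp [(Finset.mem_filter.1 hk).2]
    rw [e] at hi
    by_contra hcon
    rw [Set.mem_union, not_or] at hcon
    have c1 : |radSum τ (sampleValues T g p.1 i)| ≤ s / 2 := by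
      by_contra! h; exact hcon.1 ⟨i, h⟩
    have c2 : |radSum τ (sampleValues T g (swapSample ρ' p).1 i)| ≤ s / 2 := by
      by_contra! h; exact hcon.2 ⟨i, h⟩
    have := abs_sub (radSum τ (sampleValues T g p.1 i))
      (radSum τ (sampleValues T g (swapSample ρ' p).1 i))
    linarith
  have h3 : (μ.prod μ) B ≤ 2 * μ C := by
    have hC1 : (μ.prod μ) C1 = μ C := by
      have : C1 = C ×ˢ Set.univ := by ext; simp [C1]
      rw [this, Measure.prod_prod, measure_univ, mul_one]
    rw [← (measurePreserving_swapSample Q ρ).measure_preimage hBm.nullMeasurableSet]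
    refine (measure_mono h2).trans ((measure_union_le _ _).trans ?_)
    rw [(measurePreserving_swapSample Q ρ').measure_preimage hC1m.nullMeasurableSet, hC1, two_mul]
  calc μ A = 2 * (μ A * (1 / 2)) := by
        rw [mul_comm (μ A), ← mul_assoc]; simp [ENNReal.mul_inv_cancel]
    _ ≤ 2 * (2 * μ C) := by exact mul_le_mul_right (h1.trans h3) 2
    _ = 4 * μ C := by rw [← mul_assoc]; norm_num

/-- Concentration of the centred sums of a family with small packing numbers. -/
theorem centredSum_tail [Countable I] [DecidableEq ι] (Q : Measure α) [IsProbabilityMeasure Q]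
    {g : I → (ι → α) → α → ℝ}
    (hg : ∀ i, Measurable (Function.uncurry (g i))) {b : ℝ} (hb0 : 0 < b)
    (hb : ∀ i z a, |g i z a| ≤ b)
    (T : Finset ι) (hdep : ∀ i z z', (∀ k ∉ T, z k = z' k) → g i z = g i z') {N D K : ℝ}
    (hN : 0 < N) (hcard : (Fintype.card ι : ℝ) ≤ N) (hK0 : 0 < K) (hKb : b ^ 2 ≤ K ^ 2)
    (hK : 1 ≤ K ^ 2 / 8 - 3 * D) :
    (Measure.pi fun _ : ι => Q) {z | ∃ i, 24 * K * Real.sqrt N < |centredSum Q T g z i|}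
      ≤ 4 * ((Measure.pi fun _ : ι => Q) {z | ¬ SmallPacking (sampleValues T g z) N D}
        + ENNReal.ofReal (2 * Real.exp (D - K ^ 2 / (2 * b ^ 2))
            + 4 * Real.exp (-(K ^ 2 / 8 - 3 * D)))) := by
  classical
  set μ := Measure.pi fun _ : ι => Q with hμ
  set δ := 2 * Real.exp (D - K ^ 2 / (2 * b ^ 2)) + 4 * Real.exp (-(K ^ 2 / 8 - 3 * D)) with hδ
  set E := {z : ι → α | ¬ SmallPacking (sampleValues T g z) N D} with hE
  have hEm : MeasurableSet E := (measurableSet_smallPacking hg N D).compl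
  set A := {z | ∃ i, 24 * K * Real.sqrt N < |centredSum Q T g z i|} with hA
  have hR : 0 < Real.sqrt N := Real.sqrt_pos.2 hN
  let C : (ι → Bool) → Set (ι → α) := fun τ =>
    {z | ∃ i, 6 * K * Real.sqrt N < |radSum τ (sampleValues T g z i)|}
  have hsym : ∀ τ, μ A ≤ 4 * μ (C τ) := by
    intro τ
    have h := symmetrization Q hg hb T hdep (s := 12 * K * Real.sqrt N) hcard (by positivity)
      (by rw [mul_pow, mul_pow, Real.sq_sqrt hN.le]; nlinarith) τ
    have e1 : 2 * (12 * K * Real.sqrt N) = 24 * K * Real.sqrt N := by ring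
    have e2 : 12 * K * Real.sqrt N / 2 = 6 * K * Real.sqrt N := by ring
    rwa [e1, e2] at h
  have hCm : ∀ τ, MeasurableSet (C τ) := by
    intro τ
    simp only [C, Set.ofPred_exists]
    refine MeasurableSet.iUnion fun i => measurableSet_lt measurable_const ?_
    unfold radSum
    exact (Finset.measurable_sum _ fun k _ =>
      (measurable_sampleValues hg i k).const_mul _).abs
  -- Symmetrization holds for each sign pattern, so the bounds may be averaged over all of them. At
  -- a sample with small packing numbers chaining counts the bad patterns; at any other sample all
  -- patterns are counted as bad.
  have hpt : ∀ z, ∑ τ : ι → Bool, (C τ).indicator (1 : (ι → α) → ℝ≥0∞) z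
      ≤ 2 ^ Fintype.card ι * (E.indicator 1 z + ENNReal.ofReal δ) := by
    intro z
    have hcount : ∑ τ : ι → Bool, (C τ).indicator (1 : (ι → α) → ℝ≥0∞) z
        = (Nat.card {τ : ι → Bool //
            ∃ i, 6 * K * Real.sqrt N < |radSum τ (sampleValues T g z i)|} : ℝ≥0∞) := by
      rw [Nat.card_eq_fintype_card, Fintype.card_subtype]
      simp only [Set.indicator_apply, Pi.one_apply, C, Set.mem_ofPred_eq]
      rw [Finset.sum_boole]
    by_cases hz : z ∈ E
    · have h1 : ∑ τ : ι → Bool, (C τ).indicator (1 : (ι → α) → ℝ≥0∞) z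
          ≤ ∑ _τ : ι → Bool, 1 :=
        Finset.sum_le_sum fun τ _ => Set.indicator_le_self' (by simp) _
      refine h1.trans ?_
      simp only [Finset.sum_const, Finset.card_univ, Fintype.card_fun, Fintype.card_bool, hz,
        Set.indicator_of_mem, Pi.one_apply, nsmul_eq_mul, mul_one]
      push_cast
      exact le_mul_of_one_le_right' (le_add_right le_rfl)
    · have hz' : SmallPacking (sampleValues T g z) N D := by simpa [hE] using hz
      have hbz : ∀ i k, |sampleValues T g z i k| ≤ b := by
        intro i k
        unfold sampleValues
        split_ifs
        · exact hb _ _ _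
        · simpa using hb0.le
      have h1 := chaining_tail hz' hN hcard hb0 hbz hK0 hK
      rw [hcount]
      simp only [hz, not_false_eq_true, Set.indicator_of_notMem, zero_add]
      rw [← hδ] at h1
      have h2 := ENNReal.ofReal_le_ofReal h1
      rw [ENNReal.ofReal_natCast, ENNReal.ofReal_mul (by positivity)] at h2
      refine h2.trans (le_of_eq ?_)
      rw [ENNReal.ofReal_pow (by norm_num)]; simp
  have hint : ∑ τ : ι → Bool, μ (C τ)
      ≤ 2 ^ Fintype.card ι * (μ E + ENNReal.ofReal δ) := by
    calc ∑ τ : ι → Bool, μ (C τ)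
        = ∫⁻ z, ∑ τ : ι → Bool, (C τ).indicator (1 : (ι → α) → ℝ≥0∞) z ∂μ := by
          rw [lintegral_finsetSum _ fun τ _ => measurable_one.indicator (hCm τ)]
          exact Finset.sum_congr rfl fun τ _ => (lintegral_indicator_one (hCm τ)).symm
      _ ≤ ∫⁻ z, 2 ^ Fintype.card ι * (E.indicator 1 z + ENNReal.ofReal δ) ∂μ :=
          lintegral_mono hpt
      _ = _ := by
          rw [lintegral_const_mul _ ((measurable_one.indicator hEm).add_const _),
            lintegral_add_right _ measurable_const, lintegral_indicator_one hEm, lintegral_const,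
            measure_univ, mul_one]
  have h2 : 2 ^ Fintype.card ι * μ A ≤ 4 * ∑ τ : ι → Bool, μ (C τ) := by
    rw [Finset.mul_sum]
    calc 2 ^ Fintype.card ι * μ A = ∑ _τ : ι → Bool, μ A := by simp
      _ ≤ _ := Finset.sum_le_sum fun τ _ => hsym τ
  have h3 : 2 ^ Fintype.card ι * μ A
      ≤ 2 ^ Fintype.card ι * (4 * (μ E + ENNReal.ofReal δ)) := by
    refine h2.trans ((mul_le_mul_right hint 4).trans (le_of_eq ?_))
    ring
  exact (ENNReal.mul_le_mul_iff_right (by positivity) (by finiteness)).1 h3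

end Symmetrization

/-! ### Packing numbers of classes of rules and of products -/

section Entropy

/-- Term by term against the binomial expansion of the right side. -/
theorem sum_choose_le_pow (q d : ℕ) : ∑ k ∈ Finset.Iic d, q.choose k ≤ (q + 1) ^ d := by
  rw [add_pow, ← Nat.range_succ_eq_Iic]
  refine Finset.sum_le_sum fun k hk => ?_
  rw [one_pow, mul_one]
  calc q.choose k ≤ q ^ k := Nat.choose_le_pow q k
    _ ≤ q ^ k * d.choose k := Nat.le_mul_of_pos_right _
        (Nat.choose_pos (Nat.lt_succ_iff.1 (Finset.mem_range.1 hk)))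

variable {𝒳 I ι : Type*}

/-- Sauer–Shelah: rules that differ on a list of points. -/
theorem card_le_of_separated_by_list {Rules : Set (Policy 𝒳)} {v : ℕ}
    (hVC : ∀ s : Finset 𝒳, Shatters Rules s → s.card ≤ v) {r : I → Policy 𝒳}
    (hr : ∀ i, r i ∈ Rules) {q : ℕ} (u : Fin q → 𝒳) (F : Finset I)
    (hF : ∀ i ∈ F, ∀ i' ∈ F, i ≠ i' → ∃ a, r i (u a) ≠ r i' (u a)) :
    F.card ≤ (q + 1) ^ v := by
  classical
  let tr : I → Finset (Fin q) := fun i => Finset.univ.filter fun a => r i (u a) = true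
  have hinj : Set.InjOn tr F := by
    intro i hi i' hi' h
    by_contra hne
    obtain ⟨a, ha⟩ := hF i hi i' hi' hne
    have := congrArg (fun s => a ∈ s) h
    simp only [tr, Finset.mem_filter, Finset.mem_univ, true_and, eq_iff_iff] at this
    exact ha (Bool.eq_iff_iff.2 this)
  have hdim : (F.image tr).vcDim ≤ v := by
    rw [Finset.vcDim]
    refine Finset.sup_le fun s hs => ?_
    rw [Finset.mem_shatterer] at hs
    -- Two positions that carry the same point receive the same value from every rule, so a
    -- shattered set of positions lists distinct points. Their set is then shattered by the class.
    have hsinj : Set.InjOn u s := by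
      intro a ha a' ha' h
      by_contra hne
      obtain ⟨t, ht, hst⟩ := hs (Finset.singleton_subset_iff.2 ha)
      obtain ⟨i, -, rfl⟩ := Finset.mem_image.1 ht
      have h1 : a ∈ tr i := (Finset.mem_inter.1 (hst ▸ Finset.mem_singleton_self a)).2
      have h2 : a' ∉ tr i := by
        intro h2
        have : a' ∈ ({a} : Finset (Fin q)) := hst ▸ Finset.mem_inter.2 ⟨ha', h2⟩
        exact hne (Finset.mem_singleton.1 this).symm
      simp only [tr, Finset.mem_filter, Finset.mem_univ, true_and] at h1 h2
      exact h2 (h ▸ h1)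
    rw [← Finset.card_image_of_injOn hsinj]
    refine hVC _ fun t ht => ?_
    obtain ⟨t', ht', hst⟩ := hs (Finset.filter_subset (fun a => u a ∈ t) s)
    obtain ⟨i, -, rfl⟩ := Finset.mem_image.1 ht'
    refine ⟨r i, hr i, fun x hx => ?_⟩
    obtain ⟨a, ha, rfl⟩ := Finset.mem_image.1 hx
    have := congrArg (fun s => a ∈ s) hst
    simpa [tr, ha] using this
  calc F.card = (F.image tr).card := (Finset.card_image_of_injOn hinj).symm
    _ ≤ (F.image tr).shatterer.card := Finset.card_le_card_shatterer _
    _ ≤ ∑ k ∈ Finset.Iic (F.image tr).vcDim, (Fintype.card (Fin q)).choose k :=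
        Finset.card_shatterer_le_sum_vcDim
    _ ≤ (q + 1) ^ (F.image tr).vcDim := by rw [Fintype.card_fin]; exact sum_choose_le_pow _ _
    _ ≤ _ := Nat.pow_le_pow_right (Nat.succ_pos _) hdim

/-- Random sampling: a list of points that separates all the rules of a separated set. -/
theorem exists_separating_list [DecidableEq ι] {r : I → Policy 𝒳} (x : ι → 𝒳) (T : Finset ι)
    (hT : T.Nonempty) {δ : ℝ} (hδ1 : δ ≤ 1) (F : Finset I)
    (hF : ∀ i ∈ F, ∀ i' ∈ F, i ≠ i' →
      δ * T.card ≤ ((T.filter fun k => r i (x k) ≠ r i' (x k)).card : ℝ)) {q : ℕ}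
    (hq : (F.card : ℝ) ^ 2 * (1 - δ) ^ q < 1) :
    ∃ u : Fin q → ι, ∀ i ∈ F, ∀ i' ∈ F, i ≠ i' → ∃ a, r i (x (u a)) ≠ r i' (x (u a)) := by
  classical
  by_contra! hcon
  let agree : I × I → Finset ι := fun p => T.filter fun k => r p.1 (x k) = r p.2 (x k)
  let P := (F ×ˢ F).filter fun p => p.1 ≠ p.2
  -- If no list separates the rules, every list lies in the agreement set of some pair. Each
  -- agreement set has at most (1 - δ)|T| points, so counting lists contradicts `hq`.
  have hsub : Fintype.piFinset (fun _ : Fin q => T)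
      ⊆ P.biUnion fun p => Fintype.piFinset (fun _ : Fin q => agree p) := by
    intro u hu
    obtain ⟨i, hi, i', hi', hne, h⟩ := hcon u
    refine Finset.mem_biUnion.2 ⟨(i, i'), Finset.mem_filter.2
      ⟨Finset.mem_product.2 ⟨hi, hi'⟩, hne⟩, Fintype.mem_piFinset.2 fun a => ?_⟩
    exact Finset.mem_filter.2 ⟨Fintype.mem_piFinset.1 hu a, h a⟩
  have h1 := (Finset.card_le_card hsub).trans Finset.card_biUnion_le
  simp only [Fintype.card_piFinset_const] at h1
  have hm : (0 : ℝ) < T.card := by exact_mod_cast hT.card_pos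
  have h2 : ∀ p ∈ P, ((agree p).card : ℝ) ^ q ≤ ((1 - δ) * T.card) ^ q := by
    intro p hp
    obtain ⟨hp1, hp2⟩ := Finset.mem_filter.1 hp
    obtain ⟨ha, hb⟩ := Finset.mem_product.1 hp1
    have h3 := hF p.1 ha p.2 hb hp2
    have h4 := Finset.card_filter_add_card_filter_not (s := T)
      (fun k => r p.1 (x k) = r p.2 (x k))
    have h5 : ((agree p).card : ℝ)
        + ((T.filter fun k => r p.1 (x k) ≠ r p.2 (x k)).card : ℝ) = T.card := by
      exact_mod_cast h4
    refine pow_le_pow_left₀ (Nat.cast_nonneg _) ?_ q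
    linarith
  have h3 : (T.card : ℝ) ^ q ≤ (F.card : ℝ) ^ 2 * ((1 - δ) * T.card) ^ q := by
    calc (T.card : ℝ) ^ q ≤ ∑ p ∈ P, ((agree p).card : ℝ) ^ q := by exact_mod_cast h1
      _ ≤ ∑ _p ∈ P, ((1 - δ) * T.card) ^ q := Finset.sum_le_sum h2
      _ = P.card * ((1 - δ) * T.card) ^ q := by rw [Finset.sum_const, nsmul_eq_mul]
      _ ≤ _ := by
          have h0 : (0 : ℝ) ≤ ((1 - δ) * T.card) ^ q :=
            pow_nonneg (mul_nonneg (by linarith) hm.le) q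
          refine mul_le_mul_of_nonneg_right ?_ h0
          rw [sq, ← Nat.cast_mul, ← Finset.card_product]
          exact Nat.cast_le.2 (Finset.card_filter_le _ _)
  rw [mul_pow, ← mul_assoc] at h3
  have h4 : (0 : ℝ) < (T.card : ℝ) ^ q := pow_pos hm q
  nlinarith

/-- Packing numbers of a VC class in the Hamming distance of a sample. -/
theorem vc_packing [DecidableEq ι] {Rules : Set (Policy 𝒳)} {v : ℕ}
    (hVC : ∀ s : Finset 𝒳, Shatters Rules s → s.card ≤ v) {r : I → Policy 𝒳}
    (hr : ∀ i, r i ∈ Rules) (x : ι → 𝒳) (T : Finset ι) {c : ℝ} (hc : 0 < c) (j : ℕ)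
    (F : Finset I)
    (hF : ∀ i ∈ F, ∀ i' ∈ F, i ≠ i' →
      c * (1 / 4) ^ j * T.card < ((T.filter fun k => r i (x k) ≠ r i' (x k)).card : ℝ)) :
    (F.card : ℝ) ≤ Real.exp ((1 + 4 * (4 * v) ^ 4 / c) * 2 ^ j) := by
  classical
  set δ := c * (1 / 4 : ℝ) ^ j with hδ
  have hδ0 : 0 < δ := by positivity
  have hD : (1 : ℝ) ≤ (1 + 4 * (4 * v) ^ 4 / c) * 2 ^ j := by
    have h1 : (1 : ℝ) ≤ 2 ^ j := one_le_pow₀ (by norm_num)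
    have h2 : (0 : ℝ) ≤ 4 * (4 * v) ^ 4 / c := by positivity
    nlinarith
  by_cases hcard : F.card ≤ 1
  · have : (F.card : ℝ) ≤ 1 := by exact_mod_cast hcard
    exact this.trans (Real.one_le_exp (by linarith))
  push Not at hcard
  set L := Real.log F.card with hL
  have hFpos : (0 : ℝ) < F.card := by exact_mod_cast (by omega : 0 < F.card)
  have hL0 : 0 < L := Real.log_pos (by exact_mod_cast hcard)
  suffices h : L ≤ (1 + 4 * (4 * v) ^ 4 / c) * 2 ^ j by
    rw [← Real.exp_log hFpos]; exact Real.exp_le_exp.2 h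
  by_cases hL1 : L ≤ 1
  · linarith
  push Not at hL1
  obtain ⟨i, hi, i', hi', hne⟩ := Finset.one_lt_card.1 hcard
  have hTF : ∀ i i', ((T.filter fun k => r i (x k) ≠ r i' (x k)).card : ℝ) ≤ T.card :=
    fun i i' => Nat.cast_le.2 (Finset.card_filter_le _ _)
  have h0 := (hF i hi i' hi' hne).trans_le (hTF i i')
  have hT : T.Nonempty := by
    by_contra hT
    rw [Finset.not_nonempty_iff_eq_empty] at hT
    simp [hT] at h0
  have hTpos : (0 : ℝ) < T.card := by exact_mod_cast hT.card_pos
  have hδ1 : δ ≤ 1 := by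
    by_contra! h
    nlinarith
  -- This length makes |F|²(1 - δ)^q ≤ exp(2L - δq) less than one.
  set q := ⌊2 * L / δ⌋₊ + 1 with hq
  have hqgt : 2 * L / δ < q := by rw [hq]; push_cast; exact Nat.lt_floor_add_one _
  have hqle : (q : ℝ) ≤ 2 * L / δ + 1 := by
    rw [hq]; push_cast; linarith [Nat.floor_le (show 0 ≤ 2 * L / δ by positivity)]
  have hq1 : (F.card : ℝ) ^ 2 * (1 - δ) ^ q < 1 := by
    have h1 : (1 - δ) ^ q ≤ Real.exp (-(δ * q)) := by
      calc (1 - δ) ^ q ≤ Real.exp (-δ) ^ q :=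
            pow_le_pow_left₀ (by linarith) (by linarith [Real.add_one_le_exp (-δ)]) q
        _ = _ := by rw [← Real.exp_nat_mul]; congr 1; ring
    have h2 : Real.exp (-(δ * q)) < Real.exp (-(2 * L)) := by
      apply Real.exp_lt_exp.2
      rw [div_lt_iff₀ hδ0] at hqgt
      linarith
    have h3 : (F.card : ℝ) ^ 2 = Real.exp (2 * L) := by
      rw [two_mul, Real.exp_add, hL, Real.exp_log hFpos, sq]
    rw [h3]
    calc Real.exp (2 * L) * (1 - δ) ^ q < Real.exp (2 * L) * Real.exp (-(2 * L)) :=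
          mul_lt_mul_of_pos_left (h1.trans_lt h2) (Real.exp_pos _)
      _ = 1 := by rw [← Real.exp_add]; simp
  obtain ⟨u, hu⟩ := exists_separating_list x T hT hδ1 F
    (fun i hi i' hi' hne => (hF i hi i' hi' hne).le) hq1
  have hS := card_le_of_separated_by_list hVC hr (fun a => x (u a)) F hu
  have hS' : (F.card : ℝ) ≤ ((q : ℝ) + 1) ^ v := by exact_mod_cast hS
  have hLv : L ≤ v * Real.log (q + 1) := by
    rw [← Real.log_pow]; exact Real.log_le_log hFpos hS'
  -- Chaining needs log |F| of order 2^j only. Bounding the logarithm by a fourth root gives L⁴ ≤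
  -- (4v)⁴(q + 1), hence L³ ≤ A·4^j, which is below ((1 + A)·2^j)³. A square root would leave L of
  -- order 4^j.
  set y : ℝ := (q + 1 : ℝ) ^ (1 / 4 : ℝ) with hy
  have hq0 : (0 : ℝ) ≤ q + 1 := by positivity
  have hy4 : y ^ 4 = q + 1 := by
    rw [hy, ← Real.rpow_natCast, ← Real.rpow_mul hq0]; norm_num
  have hlog : Real.log (q + 1) ≤ 4 * y := by
    have := Real.log_le_rpow_div hq0 (show (0 : ℝ) < 1 / 4 by norm_num)
    rw [← hy] at this
    linarith
  have h4 : L ≤ 4 * v * y := by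
    calc L ≤ v * Real.log (q + 1) := hLv
      _ ≤ v * (4 * y) := by gcongr
      _ = _ := by ring
  have h5 : L ^ 4 ≤ (4 * v) ^ 4 * (4 * L / δ) := by
    calc L ^ 4 ≤ (4 * v * y) ^ 4 := pow_le_pow_left₀ hL0.le h4 4
      _ = (4 * v) ^ 4 * (q + 1) := by rw [mul_pow, hy4]
      _ ≤ (4 * v) ^ 4 * (4 * L / δ) := by
          have : (1 : ℝ) ≤ L / δ := by rw [le_div_iff₀ hδ0]; linarith
          have e1 : 2 * L / δ = 2 * (L / δ) := by ring
          have e2 : 4 * L / δ = 4 * (L / δ) := by ring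
          gcongr
          linarith
  set A : ℝ := 4 * (4 * v) ^ 4 / c with hA
  have hA0 : 0 ≤ A := by positivity
  have h6 : L ^ 3 ≤ A * 4 ^ j := by
    have e : (4 * v : ℝ) ^ 4 * (4 * L / δ) = L * (A * 4 ^ j) := by
      have : (1 / 4 : ℝ) ^ j * 4 ^ j = 1 := by rw [← mul_pow]; norm_num
      rw [hA, hδ]
      field_simp
      rw [mul_assoc, this, mul_one]
    rw [e] at h5
    have : L * L ^ 3 ≤ L * (A * 4 ^ j) := by linarith [pow_succ' L 3]
    exact le_of_mul_le_mul_left this hL0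
  by_contra! hlt
  have h7 : ((1 + A) * 2 ^ j) ^ 3 < L ^ 3 := pow_lt_pow_left₀ hlt (by positivity) (by norm_num)
  have h8 : A * 4 ^ j ≤ ((1 + A) * 2 ^ j) ^ 3 := by
    rw [mul_pow, ← pow_mul, mul_comm j 3, pow_mul]
    have h9 : (4 : ℝ) ^ j ≤ (2 ^ 3) ^ j := pow_le_pow_left₀ (by norm_num) (by norm_num) j
    have h10 : A ≤ (1 + A) ^ 3 := by nlinarith [mul_nonneg hA0 hA0, mul_nonneg hA0 (mul_nonneg hA0 hA0)]
    calc A * 4 ^ j ≤ (1 + A) ^ 3 * (2 ^ 3) ^ j := by gcongr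
      _ = _ := by norm_num
  linarith

variable {β : Type*}

/-- A contraction applied to the centres gives a cover of the composed class. This allows the
regression estimates to be truncated without loss of complexity. -/
theorem UniformCovering.comp_lipschitz {F : Set (β → ℝ)} {C h : ℝ} (hF : UniformCovering F C h)
    {φ : ℝ → ℝ} (hφ : ∀ s t, |φ s - φ t| ≤ |s - t|) :
    UniformCovering {f | ∃ g ∈ F, f = fun b => φ (g b)} C h := by
  classical
  intro ε h0 h1 T q hq hs
  obtain ⟨G, hG, hc⟩ := hF ε h0 h1 T q hq hs
  refine ⟨G.image fun g b => φ (g b), le_trans (Nat.cast_le.2 Finset.card_image_le) hG, ?_⟩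
  rintro _ ⟨f, hf, rfl⟩
  obtain ⟨g, hg, hfg⟩ := hc f hf
  refine ⟨_, Finset.mem_image_of_mem _ hg, le_trans (Real.sqrt_le_sqrt ?_) hfg⟩
  exact Finset.sum_le_sum fun a ha => mul_le_mul_of_nonneg_left (sq_le_sq.2 (hφ _ _)) (hq a ha)

/-- Uniform covering numbers bound the number of cells that a sample distinguishes. -/
theorem UniformCovering.exists_cells {F : Set (β → ℝ)} {C h : ℝ} (hF : UniformCovering F C h)
    {ε : ℝ} (h0 : 0 < ε) (h1 : ε < 1) (hC : 1 ≤ C * (1 / ε) ^ h) (T : Finset ι) (b : ι → β) :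
    ∃ (G : Finset (β → ℝ)) (cell : (β → ℝ) → (β → ℝ)), (G.card : ℝ) ≤ C * (1 / ε) ^ h ∧
      (∀ f ∈ F, cell f ∈ G) ∧ ∀ f ∈ F, ∑ k ∈ T, (f (b k) - cell f (b k)) ^ 2 ≤ ε ^ 2 * T.card := by
  classical
  rcases T.eq_empty_or_nonempty with rfl | hT
  -- With no sample points there is no empirical measure; `hC` leaves room for a single cell.
  · refine ⟨{0}, fun _ => 0, by simpa using hC, by simp, by simp⟩
  have hm : (0 : ℝ) < T.card := by exact_mod_cast hT.card_pos
  -- The empirical measure of the points b_k, k in T, with repeated points weighted by their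
  -- multiplicity.
  let q : β → ℝ := fun a => ((T.filter fun k => b k = a).card : ℝ) / T.card
  have hsum : ∀ φ : β → ℝ, ∑ a ∈ T.image b, q a * φ a = (∑ k ∈ T, φ (b k)) / T.card := by
    intro φ
    rw [Finset.sum_div, ← Finset.sum_fiberwise_of_maps_to (s := T) (t := T.image b) (g := b)
      (fun k hk => Finset.mem_image_of_mem b hk)]
    refine Finset.sum_congr rfl fun a _ => ?_
    rw [Finset.sum_congr rfl (g := fun _ => φ a / T.card) (fun k hk => by
      rw [(Finset.mem_filter.1 hk).2])]
    rw [Finset.sum_const, nsmul_eq_mul]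
    simp only [q]
    ring
  have hq1 : ∑ a ∈ T.image b, q a = 1 := by
    have := hsum fun _ => 1
    simp only [mul_one, Finset.sum_const, nsmul_eq_mul] at this
    rw [this, div_self hm.ne']
  obtain ⟨G, hG, hc⟩ := hF ε h0 h1 (T.image b) q (fun a _ => by positivity) hq1
  choose! cell hcell hd using hc
  refine ⟨G, cell, hG, hcell, fun f hf => ?_⟩
  have h2 := hd f hf
  rw [hsum fun a => (f a - cell f a) ^ 2] at h2
  have h3 := (Real.sqrt_le_left h0.le).1 h2
  rwa [div_le_iff₀ hm] at h3

/-- The entropy constant of a product class. -/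
def productEntropy (v : ℕ) (C h H K : ℝ) : ℝ :=
  (1 + 4 * (4 * v) ^ 4 * (8 * (H ^ 2 * K ^ 2 + 1))) + (|Real.log C| + h * (1 + Real.log (4 * H + 2)))

/-- Where the rules disagree exactly one mask equals one, so a single product bounded by HK remains.
Where they agree the difference is zero or t(f - f'). -/
theorem masked_product_sub_sq_le (a a' w : Bool) {t f f' H K : ℝ} (ht : |t| ≤ H) (hf : |f| ≤ K)
    (hf' : |f'| ≤ K) :
    ((if a = w then 1 else 0) * (t * f) - (if a' = w then 1 else 0) * (t * f')) ^ 2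
      ≤ 2 * (H ^ 2 * K ^ 2) * (if a ≠ a' then 1 else 0) + 2 * H ^ 2 * (f - f') ^ 2 := by
  have hw2 : t ^ 2 ≤ H ^ 2 := by
    rw [← sq_abs]; exact pow_le_pow_left₀ (abs_nonneg _) ht 2
  have hp : ∀ g : ℝ, |g| ≤ K → (t * g) ^ 2 ≤ H ^ 2 * K ^ 2 := fun g hg => by
    rw [mul_pow]
    have : g ^ 2 ≤ K ^ 2 := by
      rw [← sq_abs]; exact pow_le_pow_left₀ (abs_nonneg _) hg 2
    exact mul_le_mul hw2 this (sq_nonneg _) (sq_nonneg _)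
  have hHK : 0 ≤ H ^ 2 * K ^ 2 := by positivity
  have hd : 0 ≤ H ^ 2 * (f - f') ^ 2 := by positivity
  have hd2 : (t * f - t * f') ^ 2 ≤ H ^ 2 * (f - f') ^ 2 := by
    rw [← mul_sub, mul_pow]; gcongr
  have h1 := hp f hf
  have h2 := hp f' hf'
  cases a <;> cases a' <;> cases w <;> simp <;> linarith

/-- The scales c and 1/(4H + 2) of the two nets are chosen so that rules and functions each use at
most half of the squared separation X. -/
theorem product_scale_le {H K c X d S : ℝ} (hH0 : 0 ≤ H) (hX : 0 ≤ X)
    (hc : c = 1 / (8 * (H ^ 2 * K ^ 2 + 1))) (hd : d ≤ 2 * (c * X))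
    (hS : S ≤ 4 * ((1 / (4 * H + 2)) ^ 2 * X)) :
    2 * (H ^ 2 * K ^ 2) * d + 2 * H ^ 2 * S ≤ X := by
  have a1 : 2 * (H ^ 2 * K ^ 2) * d ≤ 2 * (H ^ 2 * K ^ 2) * (2 * (c * X)) := by gcongr
  have a2 : 4 * (H ^ 2 * K ^ 2) * c ≤ 1 / 2 := by
    rw [hc, mul_one_div, div_le_div_iff₀ (by positivity) (by norm_num)]
    nlinarith
  have a3 : 2 * H ^ 2 * S ≤ 2 * H ^ 2 * (4 * ((1 / (4 * H + 2)) ^ 2 * X)) := by gcongr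
  have a4 : 8 * H ^ 2 * (1 / (4 * H + 2)) ^ 2 ≤ 1 / 2 := by
    rw [one_div_pow, mul_one_div, div_le_div_iff₀ (by positivity) (by norm_num)]
    nlinarith
  have a5 := mul_le_mul_of_nonneg_right a2 hX
  have a6 := mul_le_mul_of_nonneg_right a4 hX
  linarith

/-- Each index is sent to the nearby centre of its rule in a Hamming net together with the cell of
its function. Two members with the same image are closer than the separation allows, so the map is
injective on a separated family and the two entropies add. -/
theorem smallPacking_product [Fintype ι] [DecidableEq ι] {Rules : Set (Policy 𝒳)} {v : ℕ}
    (hVC : ∀ s : Finset 𝒳, Shatters Rules s → s.card ≤ v) {Fc : Set (β → ℝ)} {C h : ℝ}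
    (hF : UniformCovering Fc C h) (hC : 1 ≤ C) (hh : 0 < h) {I₁ I₂ : Type*}
    {r : I₁ → Policy 𝒳} (hr : ∀ i, r i ∈ Rules) {f : I₂ → β → ℝ} (hf : ∀ i, f i ∈ Fc)
    {H K : ℝ} (hH0 : 0 ≤ H) {w : Bool} (T : Finset ι) (x : ι → 𝒳) (b : ι → β) {wt : ι → ℝ}
    (hwt : ∀ k ∈ T, |wt k| ≤ H) (hK : ∀ i, ∀ k ∈ T, |f i (b k)| ≤ K) {N : ℝ}
    (hTN : (T.card : ℝ) ≤ N) :
    SmallPacking (fun (i : I₁ × I₂) k => if k ∈ T then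
        (if r i.1 (x k) = w then 1 else 0) * (wt k * f i.2 (b k)) else 0) N
      (productEntropy v C h H K) := by
  classical
  have hN : 0 ≤ N := (Nat.cast_nonneg _).trans hTN
  intro j F hsep
  set c : ℝ := 1 / (8 * (H ^ 2 * K ^ 2 + 1)) with hc
  have hc0 : 0 < c := by positivity
  set ε : ℝ := (1 / 2) ^ j * (1 / (4 * H + 2)) with hε
  have hε0 : 0 < ε := by positivity
  have hp1 : (1 / 2 : ℝ) ^ j ≤ 1 := pow_le_one₀ (by norm_num) (by norm_num)
  have hH2 : 1 / (4 * H + 2) ≤ 1 / 2 := one_div_le_one_div_of_le (by norm_num) (by linarith)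
  have hε1 : ε < 1 := by
    calc ε ≤ 1 * (1 / 2) := mul_le_mul hp1 hH2 (by positivity) (by norm_num)
      _ < 1 := by norm_num
  have hCε : 1 ≤ C * (1 / ε) ^ h := by
    have : 1 ≤ (1 / ε) ^ h := Real.one_le_rpow (by rw [le_div_iff₀ hε0]; linarith) hh.le
    nlinarith
  obtain ⟨G, cell, hG, hcellG, hcell⟩ := hF.exists_cells hε0 hε1 hCε T b
  let hd : I₁ → I₁ → ℝ := fun i i' => ((T.filter fun k => r i (x k) ≠ r i' (x k)).card : ℝ)
  have hdsymm : ∀ i i', hd i i' = hd i' i := by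
    intro i i'
    simp only [hd, ne_comm]
  have hdtri : ∀ i i' i'', hd i i'' ≤ hd i i' + hd i'' i' := by
    intro i i' i''
    simp only [hd]
    rw [← Nat.cast_add]
    refine Nat.cast_le.2 ((Finset.card_le_card ?_).trans (Finset.card_union_le _ _))
    intro k hk
    simp only [Finset.mem_union, Finset.mem_filter] at hk ⊢
    by_cases h1 : r i (x k) = r i' (x k)
    · exact Or.inr ⟨hk.1, fun h2 => hk.2 (h1.trans h2.symm)⟩
    · exact Or.inl ⟨hk.1, h1⟩
  obtain ⟨F₁, hF₁, hnet⟩ := exists_net_of_packing hd hdsymm (ε := c * (1 / 4) ^ j * N)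
    (B := Real.exp ((1 + 4 * (4 * v) ^ 4 / c) * 2 ^ j))
    (fun i => by simp only [hd, ne_eq, not_true_eq_false, Finset.filter_false,
      Finset.card_empty, Nat.cast_zero]; positivity)
    (fun F hF => vc_packing hVC hr x T hc0 j F fun i hi i' hi' hne =>
      lt_of_le_of_lt (by gcongr) (hF i hi i' hi' hne))
  choose ctr hctr hctrd using hnet
  have hcardF : F.card ≤ (F₁ ×ˢ G).card := by
    refine Finset.card_le_card_of_injOn (fun i => (ctr i.1, cell (f i.2))) ?_ ?_
    · intro i _
      exact Finset.mem_coe.2 (Finset.mem_product.2 ⟨hctr _, hcellG _ (hf _)⟩)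
    · intro i hi i' hi' heq
      by_contra hne
      have hlt := hsep i hi i' hi' hne
      obtain ⟨he1, he2⟩ := Prod.mk.inj heq
      have hham : hd i.1 i'.1 ≤ 2 * (c * (1 / 4) ^ j * N) := by
        have h1 := hctrd i.1
        have h2 := hctrd i'.1
        rw [← he1] at h2
        linarith [hdtri i.1 (ctr i.1) i'.1]
      have hff : ∑ k ∈ T, (f i.2 (b k) - f i'.2 (b k)) ^ 2 ≤ 4 * (ε ^ 2 * N) := by
        have h1 := hcell _ (hf i.2)
        have h2 := hcell _ (hf i'.2)
        rw [← he2] at h2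
        have h3 : ∑ k ∈ T, (f i.2 (b k) - f i'.2 (b k)) ^ 2
            ≤ 2 * ∑ k ∈ T, (f i.2 (b k) - cell (f i.2) (b k)) ^ 2
              + 2 * ∑ k ∈ T, (f i'.2 (b k) - cell (f i.2) (b k)) ^ 2 := by
          rw [Finset.mul_sum, Finset.mul_sum, ← Finset.sum_add_distrib]
          refine Finset.sum_le_sum fun k _ => ?_
          nlinarith [sq_nonneg ((f i.2 (b k) - cell (f i.2) (b k))
            + (f i'.2 (b k) - cell (f i.2) (b k)))]
        have h4 : ε ^ 2 * T.card ≤ ε ^ 2 * N := by gcongr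
        linarith
      have hbound : ∑ k, ((if k ∈ T then
          (if r i.1 (x k) = w then 1 else 0) * (wt k * f i.2 (b k)) else 0)
          - (if k ∈ T then (if r i'.1 (x k) = w then 1 else 0) * (wt k * f i'.2 (b k)) else 0)) ^ 2
          ≤ 2 * (H ^ 2 * K ^ 2) * hd i.1 i'.1
            + 2 * H ^ 2 * ∑ k ∈ T, (f i.2 (b k) - f i'.2 (b k)) ^ 2 := by
        have e1 : hd i.1 i'.1 = ∑ k ∈ T, (if r i.1 (x k) ≠ r i'.1 (x k) then 1 else 0 : ℝ) := by
          simp only [hd]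
          rw [Finset.sum_boole]
        rw [e1, Finset.mul_sum, Finset.mul_sum, ← Finset.sum_add_distrib,
          ← Finset.sum_filter_add_sum_filter_not Finset.univ (· ∈ T),
          Finset.sum_eq_zero (s := Finset.univ.filter fun k => ¬ k ∈ T), add_zero]
        · have : Finset.univ.filter (fun k => k ∈ T) = T := by ext; simp
          rw [this]
          refine Finset.sum_le_sum fun k hk => ?_
          simp only [hk, if_true]
          exact masked_product_sub_sq_le _ _ w (hwt k hk) (hK _ k hk) (hK _ k hk)
        · intro k hk
          simp [(Finset.mem_filter.1 hk).2]
      have hfin : 2 * (H ^ 2 * K ^ 2) * hd i.1 i'.1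
            + 2 * H ^ 2 * ∑ k ∈ T, (f i.2 (b k) - f i'.2 (b k)) ^ 2 ≤ (1 / 4) ^ j * N := by
        refine product_scale_le hH0 (by positivity) hc (hham.trans_eq (by ring)) (hff.trans (le_of_eq ?_))
        rw [hε, mul_pow, ← pow_mul, mul_comm j 2, pow_mul]
        norm_num
        ring
      linarith
  have hlog2 : Real.log (1 / ε) ≤ (1 + Real.log (4 * H + 2)) * 2 ^ j := by
    have e : 1 / ε = 2 ^ j * (4 * H + 2) := by
      rw [hε, one_div_pow]; field_simp
    rw [e, Real.log_mul (by positivity) (by positivity), Real.log_pow]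
    have h1 : (j : ℝ) ≤ 2 ^ j := by exact_mod_cast Nat.lt_two_pow_self.le
    have h2 : Real.log 2 ≤ 1 := by linarith [Real.log_two_lt_d9]
    have h3 : 0 ≤ Real.log (4 * H + 2) := Real.log_nonneg (by linarith)
    have h4 : (1 : ℝ) ≤ 2 ^ j := one_le_pow₀ (by norm_num)
    have h5 : 0 ≤ Real.log 2 := Real.log_nonneg (by norm_num)
    nlinarith [Nat.cast_nonneg (α := ℝ) j]
  have hGexp : C * (1 / ε) ^ h
      ≤ Real.exp ((|Real.log C| + h * (1 + Real.log (4 * H + 2))) * 2 ^ j) := by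
    have hCpos : 0 < C := by linarith
    rw [Real.rpow_def_of_pos (by positivity)]
    nth_rw 1 [← Real.exp_log hCpos]
    rw [← Real.exp_add]
    apply Real.exp_le_exp.2
    have h4 : (1 : ℝ) ≤ 2 ^ j := one_le_pow₀ (by norm_num)
    have h5 : Real.log C ≤ |Real.log C| * 2 ^ j :=
      (le_abs_self _).trans (le_mul_of_one_le_right (abs_nonneg _) h4)
    have h6 := mul_le_mul_of_nonneg_right hlog2 hh.le
    linarith
  calc (F.card : ℝ) ≤ F₁.card * G.card := by
        rw [← Nat.cast_mul, ← Finset.card_product]; exact Nat.cast_le.2 hcardF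
    _ ≤ Real.exp ((1 + 4 * (4 * v) ^ 4 / c) * 2 ^ j)
        * Real.exp ((|Real.log C| + h * (1 + Real.log (4 * H + 2))) * 2 ^ j) := by
        gcongr
        exact hG.trans hGexp
    _ = _ := by
        rw [← Real.exp_add]
        congr 1
        rw [productEntropy, hc]
        field_simp

end Entropy

/-! ### Events with high probability -/

section HighProb

variable {Ω : Type*} [MeasurableSpace Ω] {P : Measure Ω}

theorem WithHighProb.mono {E F : ℕ → Ω → Prop} (h : WithHighProb P E)
    (hEF : ∀ n ω, E n ω → F n ω) : WithHighProb P F :=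
  tendsto_of_tendsto_of_tendsto_of_le_of_le tendsto_const_nhds h (fun _ => zero_le)
    fun n => measure_mono fun ω hω hE => hω (hEF n ω hE)

theorem WithHighProb.and {E F : ℕ → Ω → Prop} (hE : WithHighProb P E) (hF : WithHighProb P F) :
    WithHighProb P fun n ω => E n ω ∧ F n ω := by
  have h := Tendsto.add hE hF
  rw [add_zero] at h
  refine tendsto_of_tendsto_of_tendsto_of_le_of_le tendsto_const_nhds h (fun _ => zero_le)
    fun n => le_trans (measure_mono ?_) (measure_union_le _ _)
  intro ω hω
  by_cases hE : E n ω
  · exact Or.inr fun hF => hω ⟨hE, hF⟩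
  · exact Or.inl hE

theorem WithHighProb.of_ae {E : ℕ → Ω → Prop} (h : ∀ n, ∀ᵐ ω ∂P, E n ω) : WithHighProb P E := by
  have : (fun n => P {ω | ¬ E n ω}) = fun _ => 0 := funext fun n => ae_iff.1 (h n)
  rw [WithHighProb, this]
  exact tendsto_const_nhds

/-- The events `E n K`, monotone in `K`, have probability close to one for large `K`, uniformly in
large `n`. -/
def BoundedInProb (P : Measure Ω) (E : ℕ → ℝ → Ω → Prop) : Prop :=
  (∀ n ω K K', K ≤ K' → E n K ω → E n K' ω) ∧
  ∀ ε : ℝ, 0 < ε → ∃ K : ℝ, 0 < K ∧ ∀ᶠ n in atTop, P {ω | ¬ E n K ω} ≤ ENNReal.ofReal ε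

theorem BoundedInProb.and {E F : ℕ → ℝ → Ω → Prop} (hE : BoundedInProb P E)
    (hF : BoundedInProb P F) : BoundedInProb P fun n K ω => E n K ω ∧ F n K ω := by
  refine ⟨fun n ω K K' hK h => ⟨hE.1 n ω K K' hK h.1, hF.1 n ω K K' hK h.2⟩, fun ε hε => ?_⟩
  obtain ⟨K₁, hK₁, h₁⟩ := hE.2 (ε / 2) (by positivity)
  obtain ⟨K₂, hK₂, h₂⟩ := hF.2 (ε / 2) (by positivity)
  refine ⟨max K₁ K₂, lt_max_of_lt_left hK₁, ?_⟩
  filter_upwards [h₁, h₂] with n h₁ h₂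
  calc P {ω | ¬ (E n (max K₁ K₂) ω ∧ F n (max K₁ K₂) ω)}
      ≤ P ({ω | ¬ E n K₁ ω} ∪ {ω | ¬ F n K₂ ω}) := by
        refine measure_mono fun ω hω => ?_
        by_cases hE' : E n K₁ ω
        · exact Or.inr fun hF' =>
            hω ⟨hE.1 n ω _ _ (le_max_left _ _) hE', hF.1 n ω _ _ (le_max_right _ _) hF'⟩
        · exact Or.inl hE'
    _ ≤ ENNReal.ofReal (ε / 2) + ENNReal.ofReal (ε / 2) :=
        (measure_union_le _ _).trans (add_le_add h₁ h₂)
    _ = ENNReal.ofReal ε := by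
        rw [← ENNReal.ofReal_add (by positivity) (by positivity), add_halves]

theorem BoundedInProb.forall_finite {ι : Type*} [Finite ι] {E : ι → ℕ → ℝ → Ω → Prop}
    (hE : ∀ i, BoundedInProb P (E i)) : BoundedInProb P fun n K ω => ∀ i, E i n K ω := by
  classical
  cases nonempty_fintype ι
  have : ∀ s : Finset ι, BoundedInProb P fun n K ω => ∀ i ∈ s, E i n K ω := by
    intro s
    induction s using Finset.induction_on with
    | empty => exact ⟨fun _ _ _ _ _ _ i hi => absurd hi (Finset.notMem_empty i),
        fun ε _ => ⟨1, one_pos, Eventually.of_forall fun n => by simp⟩⟩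
    | insert i s _ ih =>
      have := (hE i).and ih
      simpa only [Finset.forall_mem_insert] using this
  simpa using this Finset.univ

/-- Reduces asymptotic claims to deterministic ones: on the events E and G the conclusion has to
hold for all large n, with a constant depending on K alone. -/
theorem BoundedInProb.mono_high {E F : ℕ → ℝ → Ω → Prop} {G : ℕ → Ω → Prop}
    (hE : BoundedInProb P E) (hG : WithHighProb P G)
    (hF : ∀ n ω K K', K ≤ K' → F n K ω → F n K' ω)
    (h : ∀ K, 0 < K → ∃ K', 0 < K' ∧ ∀ᶠ n in atTop, ∀ ω, E n K ω → G n ω → F n K' ω) :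
    BoundedInProb P F := by
  refine ⟨hF, fun ε hε => ?_⟩
  obtain ⟨K, hK, h₁⟩ := hE.2 (ε / 2) (by positivity)
  obtain ⟨K', hK', h₂⟩ := h K hK
  have h₃ : ∀ᶠ n in atTop, P {ω | ¬ G n ω} ≤ ENNReal.ofReal (ε / 2) :=
    (hG.eventually_lt_const (by positivity)).mono fun n hn => hn.le
  refine ⟨K', hK', ?_⟩
  filter_upwards [h₁, h₂, h₃] with n h₁ h₂ h₃
  calc P {ω | ¬ F n K' ω} ≤ P ({ω | ¬ E n K ω} ∪ {ω | ¬ G n ω}) := by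
        refine measure_mono fun ω hω => ?_
        by_cases hE' : E n K ω
        · exact Or.inr fun hG' => hω (h₂ ω hE' hG')
        · exact Or.inl hE'
    _ ≤ ENNReal.ofReal (ε / 2) + ENNReal.ofReal (ε / 2) :=
        (measure_union_le _ _).trans (add_le_add h₁ h₃)
    _ = ENNReal.ofReal ε := by
        rw [← ENNReal.ofReal_add (by positivity) (by positivity), add_halves]

end HighProb

/-! ### Sampling -/

section SamplingLaw

variable {𝒳 𝓑 Ω : Type*} [MeasurableSpace 𝒳] [MeasurableSpace 𝓑] [MeasurableSpace Ω]
  {P : Measure Ω} {Q : Measure (Agent 𝒳 𝓑)} {Z : ℕ → Ω → Agent 𝒳 𝓑}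
  {split : (n : ℕ) → Ω → Split n}

theorem Sampling.map_sample [IsProbabilityMeasure P] (h : Sampling P Q Z split) (n : ℕ) :
    P.map (fun ω (i : Fin n) => Z i ω) = Measure.pi fun _ : Fin n => Q := by
  have h1 : iIndepFun (fun (i : Fin n) => Z i) P := h.indep.precomp Fin.val_injective
  rw [iIndepFun_iff_map_fun_eq_pi_map fun i : Fin n => (h.meas i).aemeasurable] at h1
  rw [h1]
  congr 1
  funext i
  exact h.law i

theorem Sampling.measurable_sample (h : Sampling P Q Z split) (n : ℕ) :
    Measurable fun ω (i : Fin n) => Z i ω :=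
  measurable_pi_iff.2 fun i => h.meas i

/-- A split takes finitely many values and is independent of the data, so probabilities are mixtures
of product-measure probabilities. Estimates can therefore be proved with the split held fixed. -/
theorem Sampling.measure_split_sample [IsProbabilityMeasure P] (h : Sampling P Q Z split) (n : ℕ)
    {B : Split n → Set (Fin n → Agent 𝒳 𝓑)} (hB : ∀ σ, MeasurableSet (B σ)) :
    P {ω | (fun i : Fin n => Z i ω) ∈ B (split n ω)}
      = ∑ σ, P (split n ⁻¹' {σ}) * (Measure.pi fun _ : Fin n => Q) (B σ) := by
  have h1 : {ω | (fun i : Fin n => Z i ω) ∈ B (split n ω)}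
      = ⋃ σ ∈ (Finset.univ : Finset (Split n)),
        (split n ⁻¹' {σ} ∩ (fun ω (i : Fin n) => Z i ω) ⁻¹' B σ) := by
    ext ω; simp
  rw [h1, measure_biUnion_finset]
  · refine Finset.sum_congr rfl fun σ _ => ?_
    rw [(h.split_indep n).measure_inter_preimage_eq_mul _ _ (measurableSet_singleton σ) (hB σ),
      ← Measure.map_apply (h.measurable_sample n) (hB σ), h.map_sample n]
  · intro σ _ σ' _ hne
    refine Set.disjoint_left.2 fun ω hω hω' => hne ?_
    exact (hω.1 : split n ω = σ).symm.trans hω'.1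
  · intro σ _
    exact (h.split_meas n (measurableSet_singleton σ)).inter (h.measurable_sample n (hB σ))

theorem Sampling.measure_le_of_pi [IsProbabilityMeasure P] (h : Sampling P Q Z split) (n : ℕ)
    {A E : Split n → Set (Fin n → Agent 𝒳 𝓑)} (hA : ∀ σ, MeasurableSet (A σ))
    (hE : ∀ σ, MeasurableSet (E σ)) {δ : ℝ≥0∞}
    (hle : ∀ σ, (Measure.pi fun _ : Fin n => Q) (A σ)
      ≤ 4 * ((Measure.pi fun _ : Fin n => Q) (E σ) + δ)) :
    P {ω | (fun i : Fin n => Z i ω) ∈ A (split n ω)}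
      ≤ 4 * (P {ω | (fun i : Fin n => Z i ω) ∈ E (split n ω)} + δ) := by
  have h1 : ∑ σ, P (split n ⁻¹' {σ}) = 1 := by
    have := h.measure_split_sample n (B := fun _ => Set.univ) fun _ => MeasurableSet.univ
    have hpi : IsProbabilityMeasure (Measure.pi fun _ : Fin n => Q) := by
      rw [← h.map_sample n]
      exact Measure.isProbabilityMeasure_map (h.measurable_sample n).aemeasurable
    simp only [Set.mem_univ, measure_univ, mul_one] at this
    rw [← this]
    exact measure_univ
  rw [h.measure_split_sample n hA, h.measure_split_sample n hE]
  calc ∑ σ, P (split n ⁻¹' {σ}) * (Measure.pi fun _ : Fin n => Q) (A σ)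
      ≤ ∑ σ, P (split n ⁻¹' {σ}) * (4 * ((Measure.pi fun _ : Fin n => Q) (E σ) + δ)) :=
        Finset.sum_le_sum fun σ _ => mul_le_mul_right (hle σ) _
    _ = 4 * (∑ σ, P (split n ⁻¹' {σ}) * (Measure.pi fun _ : Fin n => Q) (E σ)
        + (∑ σ, P (split n ⁻¹' {σ})) * δ) := by
        rw [Finset.sum_mul, ← Finset.sum_add_distrib, Finset.mul_sum]
        exact Finset.sum_congr rfl fun σ _ => by ring
    _ = _ := by rw [h1, one_mul]

end SamplingLaw

/-! ### Uniform deviations over rules and cutoffs -/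

section GatedDeviation

variable {J : ℕ} {𝒳 𝓑 Ω β : Type*} [MeasurableSpace 𝒳] [MeasurableSpace 𝓑] [MeasurableSpace Ω]
  [MeasurableSpace β]

/-- The centred sum of a function over the sample points with indices in `T`. -/
def deviation {n : ℕ} (Q : Measure (Agent 𝒳 𝓑)) (T : Finset (Fin n)) (z : Fin n → Agent 𝒳 𝓑)
    (g : Agent 𝒳 𝓑 → ℝ) : ℝ := ∑ k ∈ T, (g (z k) - ∫ a, g a ∂Q)

/-- `1(π(X) = w) h f(φ)`. -/
def gated (w : Bool) (φ : Agent 𝒳 𝓑 → β) (π : Policy 𝒳) (h : Agent 𝒳 𝓑 → ℝ) (f : β → ℝ)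
    (a : Agent 𝒳 𝓑) : ℝ := (if π (cov a) = w then 1 else 0) * (h a * f (φ a))

omit [MeasurableSpace 𝒳] [MeasurableSpace 𝓑] [MeasurableSpace β] in
theorem abs_gated_le {w : Bool} {φ : Agent 𝒳 𝓑 → β} {π : Policy 𝒳} {h : Agent 𝒳 𝓑 → ℝ} {f : β → ℝ}
    {H K : ℝ} (hH : ∀ a, |h a| ≤ H) (hK : ∀ b, |f b| ≤ K) (a : Agent 𝒳 𝓑) :
    |gated w φ π h f a| ≤ H * K := by
  have h1 : |h a * f (φ a)| ≤ H * K := by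
    rw [abs_mul]
    exact mul_le_mul (hH a) (hK _) (abs_nonneg _) ((abs_nonneg _).trans (hH a))
  unfold gated
  split_ifs
  · rwa [one_mul]
  · rw [zero_mul, abs_zero]; exact (abs_nonneg _).trans h1

theorem measurable_gated {w : Bool} {φ : Agent 𝒳 𝓑 → β} (hφ : Measurable φ) {π : Policy 𝒳}
    (hπ : Measurable π) {h : Agent 𝒳 𝓑 → ℝ} (hh : Measurable h) {f : β → ℝ} (hf : Measurable f) :
    Measurable (gated w φ π h f) := by
  refine Measurable.mul (Measurable.ite ?_ measurable_const measurable_const)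
    (hh.mul (hf.comp hφ))
  exact (hπ.comp measurable_fst) (measurableSet_singleton w)

/-- Bounds on centred sums extend from a pointwise dense subclass. -/
theorem deviation_le_of_separable {n : ℕ} {Q : Measure (Agent 𝒳 𝓑)} [IsProbabilityMeasure Q]
    {w : Bool} {φ : Agent 𝒳 𝓑 → β} (hφ : Measurable φ) {R₀ Rules : Set (Policy 𝒳)}
    (hRmeas : ∀ π ∈ R₀, Measurable π) (hR : PointwiseSeparable R₀ Rules (fun π x => π x))
    {S₀ S : Set (Vec J)} {h : Agent 𝒳 𝓑 → ℝ} (hh : Measurable h) {f : Vec J → β → ℝ}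
    (hf : ∀ p ∈ S₀, Measurable (f p)) (hS : PointwiseSeparable S₀ S f) {H K : ℝ}
    (hH : ∀ a, |h a| ≤ H) (hK : ∀ p ∈ S₀, ∀ b, |f p b| ≤ K) {T : Finset (Fin n)}
    {z : Fin n → Agent 𝒳 𝓑} {B : ℝ}
    (hB : ∀ π ∈ R₀, ∀ p ∈ S₀, |deviation Q T z (gated w φ π h (f p))| ≤ B) :
    ∀ π ∈ Rules, ∀ p ∈ S, |deviation Q T z (gated w φ π h (f p))| ≤ B := by
  intro π hπ p hp
  obtain ⟨u, hu, hlu⟩ := hR π hπ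
  obtain ⟨s, hs, hls⟩ := hS p hp
  have hlim : ∀ a, Tendsto (fun m => gated w φ (u m) h (f (s m)) a) atTop
      (𝓝 (gated w φ π h (f p) a)) := by
    intro a
    refine Tendsto.mul ?_ ((hls (φ a)).const_mul (h a))
    -- Rules take values in a discrete space, so pointwise convergence is eventual equality and the
    -- indicators converge.
    have := (hlu (cov a))
    rw [nhds_discrete, tendsto_pure] at this
    refine Tendsto.congr' ?_ tendsto_const_nhds
    filter_upwards [this] with m hm
    rw [hm]
  have hint : Tendsto (fun m => ∫ a, gated w φ (u m) h (f (s m)) a ∂Q) atTop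
      (𝓝 (∫ a, gated w φ π h (f p) a ∂Q)) := by
    refine tendsto_integral_of_dominated_convergence (fun _ => H * K) ?_ (integrable_const _) ?_
      (ae_of_all _ hlim)
    · exact fun m => (measurable_gated hφ (hRmeas _ (hu m)) hh (hf _ (hs m))).aestronglyMeasurable
    · exact fun m => ae_of_all _ fun a => abs_gated_le hH (hK _ (hs m)) a
  have hdev : Tendsto (fun m => |deviation Q T z (gated w φ (u m) h (f (s m)))|) atTop
      (𝓝 |deviation Q T z (gated w φ π h (f p))|) :=
    (tendsto_finsetSum _ fun k _ => (hlim (z k)).sub hint).abs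
  exact le_of_tendsto hdev (Eventually.of_forall fun m => hB _ (hu m) _ (hs m))

/-- With D and b fixed every requirement holds as K tends to infinity; no dependence on n enters. -/
theorem exists_tail_constant (D b : ℝ) (hb : 0 < b) {ε : ℝ} (hε : 0 < ε) :
    ∃ K : ℝ, 0 < K ∧ b ^ 2 ≤ K ^ 2 ∧ 1 ≤ K ^ 2 / 8 - 3 * D ∧
      2 * Real.exp (D - K ^ 2 / (2 * b ^ 2)) + 4 * Real.exp (-(K ^ 2 / 8 - 3 * D)) ≤ ε := by
  have hsq : Tendsto (fun K : ℝ => K ^ 2) atTop atTop := tendsto_pow_atTop (by norm_num)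
  have h8 : Tendsto (fun K : ℝ => K ^ 2 / 8 - 3 * D) atTop atTop :=
    tendsto_atTop_add_const_right _ _ (hsq.atTop_div_const (by norm_num))
  have h1 : Tendsto (fun K : ℝ => Real.exp (-(K ^ 2 / 8 - 3 * D))) atTop (𝓝 0) :=
    Real.tendsto_exp_neg_atTop_nhds_zero.comp h8
  have h2 : Tendsto (fun K : ℝ => Real.exp (D - K ^ 2 / (2 * b ^ 2))) atTop (𝓝 0) := by
    have : Tendsto (fun K : ℝ => K ^ 2 / (2 * b ^ 2) - D) atTop atTop :=
      tendsto_atTop_add_const_right _ _ (hsq.atTop_div_const (by positivity))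
    refine (Real.tendsto_exp_neg_atTop_nhds_zero.comp this).congr fun K => ?_
    simp
  have h3 := (h2.const_mul 2).add (h1.const_mul 4)
  simp only [mul_zero, add_zero] at h3
  obtain ⟨K, hK1, hK2, hK3, hK4⟩ := ((eventually_ge_atTop b).and
    ((h8.eventually_ge_atTop 1).and ((h3.eventually_lt_const hε).and (eventually_gt_atTop 0)))).exists
  exact ⟨K, hK4, pow_le_pow_left₀ hb.le hK1 2, hK2, hK3.le⟩

omit [MeasurableSpace β] in
theorem UniformCovering.mono {F F' : Set (β → ℝ)} {C C' h : ℝ} (hF : UniformCovering F C h)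
    (hFF : F' ⊆ F) (hC : C ≤ C') : UniformCovering F' C' h := by
  intro ε h0 h1 T q hq hs
  obtain ⟨G, hG, hc⟩ := hF ε h0 h1 T q hq hs
  exact ⟨G, hG.trans (by gcongr), fun f hf => hc f (hFF hf)⟩

/-- Uniform deviations of order `√n` over a VC class of rules and a class of functions with
polynomial uniform covering numbers, where the functions may depend on the split and on the data
that are not summed over. -/
theorem boundedInProb_deviation {P : Measure Ω} [IsProbabilityMeasure P]
    {Q : Measure (Agent 𝒳 𝓑)} [IsProbabilityMeasure Q] {Z : ℕ → Ω → Agent 𝒳 𝓑}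
    {split : (n : ℕ) → Ω → Split n} (hsample : Sampling P Q Z split)
    {Rules R₀ : Set (Policy 𝒳)} {v : ℕ} (hVC : ∀ s : Finset 𝒳, Shatters Rules s → s.card ≤ v)
    (hR₀ : R₀.Countable) (hR₀R : R₀ ⊆ Rules) (hRmeas : ∀ π ∈ R₀, Measurable π)
    (hR : PointwiseSeparable R₀ Rules (fun π x => π x))
    {S₀ S : Set (Vec J)} (hS₀ : S₀.Countable) (w : Bool)
    {φ : Agent 𝒳 𝓑 → β} (hφ : Measurable φ) (T : (n : ℕ) → Split n → Finset (Fin n))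
    {h : (n : ℕ) → Split n → (Fin n → Agent 𝒳 𝓑) → Agent 𝒳 𝓑 → ℝ}
    (hh : ∀ n σ, Measurable (Function.uncurry (h n σ))) {H : ℝ} (hH0 : 0 ≤ H)
    (hH : ∀ n σ z a, |h n σ z a| ≤ H)
    (hhT : ∀ n σ z z', (∀ k ∉ T n σ, z k = z' k) → h n σ z = h n σ z')
    {f : (n : ℕ) → Split n → (Fin n → Agent 𝒳 𝓑) → Vec J → β → ℝ}
    (hf : ∀ n σ, ∀ p ∈ S₀, Measurable fun q : (Fin n → Agent 𝒳 𝓑) × β => f n σ q.1 p q.2)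
    {K : ℝ} (hK : ∀ n σ z, ∀ p ∈ S₀, ∀ b, |f n σ z p b| ≤ K)
    (hfT : ∀ n σ z z', (∀ k ∉ T n σ, z k = z' k) → f n σ z = f n σ z')
    (hsep : ∀ n, ∀ᵐ ω ∂P, PointwiseSeparable S₀ S (f n (split n ω) fun i => Z i ω))
    {C ν : ℝ} (hν : 0 < ν)
    (hcov : WithHighProb P fun n ω =>
      UniformCovering {g | ∃ p ∈ S₀, g = f n (split n ω) (fun i => Z i ω) p} C ν) :
    BoundedInProb P fun n B ω => ∀ π ∈ Rules, ∀ p ∈ S,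
      |deviation Q (T n (split n ω)) (fun i => Z i ω) (gated w φ π
        (h n (split n ω) fun i => Z i ω) (f n (split n ω) (fun i => Z i ω) p))|
        ≤ B * Real.sqrt n := by
  classical
  refine ⟨fun n ω K K' hKK' hE π hπ p hp => (hE π hπ p hp).trans (by gcongr), fun ε hε => ?_⟩
  have := hR₀.to_subtype
  have := hS₀.to_subtype
  set D := productEntropy v (max C 1) ν H K with hD
  set b : ℝ := max (H * K) 1 with hb
  have hb0 : 0 < b := lt_max_of_lt_right one_pos
  obtain ⟨L, hL0, hLb, hL8, hLε⟩ := exists_tail_constant D b hb0 (ε := ε / 8) (by positivity)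
  -- The concentration bound is applied to this countable family, for which suprema are measurable;
  -- separability then extends it to all rules and cutoffs.
  let G : (n : ℕ) → Split n → R₀ × S₀ → (Fin n → Agent 𝒳 𝓑) → Agent 𝒳 𝓑 → ℝ :=
    fun n σ i z => gated w φ i.1 (h n σ z) (f n σ z i.2)
  have hGm : ∀ n σ i, Measurable (Function.uncurry (G n σ i)) := by
    intro n σ i
    refine Measurable.mul (Measurable.ite ?_ measurable_const measurable_const)
      (Measurable.mul (hh n σ) ?_)
    · exact ((hRmeas _ i.1.2).comp (measurable_fst.comp measurable_snd)) (measurableSet_singleton w)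
    · exact (hf n σ i.2 i.2.2).comp (measurable_fst.prodMk (hφ.comp measurable_snd))
  have hGb : ∀ n σ i z a, |G n σ i z a| ≤ b := fun n σ i z a =>
    (abs_gated_le (hH n σ z) (hK n σ z _ i.2.2) a).trans (le_max_left _ _)
  have hGT : ∀ n σ i z z', (∀ k ∉ T n σ, z k = z' k) → G n σ i z = G n σ i z' := by
    intro n σ i z z' hz
    simp only [G, hhT n σ z z' hz, hfT n σ z z' hz]
  have hpack : ∀ n ω, UniformCovering {g | ∃ p ∈ S₀, g = f n (split n ω) (fun i => Z i ω) p} C ν →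
      SmallPacking (sampleValues (T n (split n ω)) (G n (split n ω)) fun i => Z i ω) n D := by
    intro n ω hc
    have := smallPacking_product hVC (hc.mono subset_rfl (le_max_left C 1)) (le_max_right C 1) hν
      (r := fun π : R₀ => (π : Policy 𝒳)) (fun π => hR₀R π.2)
      (f := fun p : S₀ => f n (split n ω) (fun i => Z i ω) p) (fun p => ⟨p, p.2, rfl⟩)
      hH0 (w := w) (T n (split n ω)) (fun i : Fin n => cov (Z i ω)) (fun i => φ (Z i ω))
      (wt := fun k => h n (split n ω) (fun i => Z i ω) (Z k ω)) (fun k _ => hH _ _ _ _)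
      (K := K) (fun i k _ => hK _ _ _ _ i.2 _) (N := n)
      (by exact_mod_cast (Finset.card_le_univ _).trans (by simp))
    exact this
  refine ⟨24 * L, by positivity, ?_⟩
  have hcov' : ∀ᶠ n in atTop, P {ω | ¬ UniformCovering
      {g | ∃ p ∈ S₀, g = f n (split n ω) (fun i => Z i ω) p} C ν} ≤ ENNReal.ofReal (ε / 8) :=
    (hcov.eventually_lt_const (by positivity)).mono fun n hn => hn.le
  filter_upwards [hcov', eventually_ge_atTop 1] with n hn hn1
  have hnpos : (0 : ℝ) < n := by exact_mod_cast hn1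
  have hmain := hsample.measure_le_of_pi n
    (A := fun σ => {z | ∃ i, 24 * L * Real.sqrt n < |centredSum Q (T n σ) (G n σ) z i|})
    (E := fun σ => {z | ¬ SmallPacking (sampleValues (T n σ) (G n σ) z) n D})
    (fun σ => by
      simp only [Set.ofPred_exists]
      exact MeasurableSet.iUnion fun i => measurableSet_lt measurable_const
        (measurable_centredSum (hGm n σ) i).abs)
    (fun σ => (measurableSet_smallPacking (hGm n σ) _ _).compl)
    (fun σ => centredSum_tail Q (hGm n σ) hb0 (hGb n σ) (T n σ) (hGT n σ) hnpos (by simp) hL0 hLb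
      hL8)
  have hbad : P {ω | ¬ ∀ π ∈ Rules, ∀ p ∈ S,
      |deviation Q (T n (split n ω)) (fun i => Z i ω) (gated w φ π
        (h n (split n ω) fun i => Z i ω) (f n (split n ω) (fun i => Z i ω) p))|
        ≤ 24 * L * Real.sqrt n} ≤ P {ω | (fun i : Fin n => Z i ω) ∈
          {z | ∃ i, 24 * L * Real.sqrt n
            < |centredSum Q (T n (split n ω)) (G n (split n ω)) z i|}} := by
    -- The event over the full classes need not be measurable, but up to a null set it lies inside
    -- the measurable event over the countable family.
    refine measure_mono_ae ?_
    filter_upwards [hsep n] with ω hω hbad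
    by_contra hcon
    refine hbad (deviation_le_of_separable hφ hRmeas hR
      ((hh n (split n ω)).comp (measurable_const.prodMk measurable_id))
      (fun p hp => (hf n (split n ω) p hp).comp (measurable_const.prodMk measurable_id))
      hω (hH _ _ _) (fun p hp => hK _ _ _ p hp) ?_)
    intro π hπ p hp
    by_contra! hlt
    exact hcon ⟨(⟨π, hπ⟩, ⟨p, hp⟩), hlt⟩
  refine hbad.trans (hmain.trans ?_)
  calc 4 * (P {ω | (fun i : Fin n => Z i ω) ∈
          {z | ¬ SmallPacking (sampleValues (T n (split n ω)) (G n (split n ω)) z) n D}} + _)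
      ≤ 4 * (ENNReal.ofReal (ε / 8) + ENNReal.ofReal (ε / 8)) := by
        refine mul_le_mul_right (add_le_add ((measure_mono ?_).trans hn)
          (ENNReal.ofReal_le_ofReal hLε)) 4
        exact fun ω hω hc => hω (hpack n ω hc)
    _ = ENNReal.ofReal ε := by
        rw [← ENNReal.ofReal_add (by positivity) (by positivity),
          show (4 : ℝ≥0∞) = ENNReal.ofReal 4 by simp,
          ← ENNReal.ofReal_mul (by norm_num)]
        congr 1; ring

end GatedDeviation

/-! ### Linear algebra and calculus -/

section Calculus

variable {J : ℕ}

theorem norm_le_of_abs_apply_le {v : Vec J} {B : ℝ} (hv : ∀ j, |v j| ≤ B) : ‖v‖ ≤ J * B := by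
  rcases Nat.eq_zero_or_pos J with rfl | hJ
  · simp [Subsingleton.elim v 0]
  have hB : 0 ≤ B := (abs_nonneg _).trans (hv ⟨0, hJ⟩)
  rw [EuclideanSpace.norm_eq]
  refine Real.sqrt_le_iff.2 ⟨by positivity, ?_⟩
  calc ∑ j, ‖v j‖ ^ 2 ≤ ∑ _j : Fin J, B ^ 2 :=
        Finset.sum_le_sum fun j _ => pow_le_pow_left₀ (norm_nonneg _) (hv j) 2
    _ = J * B ^ 2 := by simp
    _ ≤ (J * B) ^ 2 := by
        have : (1 : ℝ) ≤ J := by exact_mod_cast hJ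
        rw [mul_pow]
        gcongr
        nlinarith

theorem abs_apply_le_norm (v : Vec J) (j : Fin J) : |v j| ≤ ‖v‖ := PiLp.norm_apply_le v j

/-- In an orthonormal eigenbasis of T*T the squared norm of Tv is the sum of the squared coordinates
of v weighted by squared singular values. -/
theorem mul_norm_le_norm_of_singularValues (T : Vec J →ₗ[ℝ] Vec J) {c : ℝ} (hc : 0 ≤ c)
    (h : ∀ i < J, c ≤ T.singularValues i) (v : Vec J) : c * ‖v‖ ≤ ‖T v‖ := by
  have hn : Module.finrank ℝ (Vec J) = J := by simp
  set b := T.isSymmetric_adjoint_comp_self.eigenvectorBasis hn with hb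
  have h1 : ‖T v‖ ^ 2 = ∑ i : Fin J, T.singularValues i ^ 2 * (b.repr v i) ^ 2 := by
    rw [← real_inner_self_eq_norm_sq, ← LinearMap.adjoint_inner_left]
    have : (LinearMap.adjoint T) (T v) = (LinearMap.adjoint T ∘ₗ T) v := rfl
    rw [this, ← b.sum_inner_mul_inner]
    refine Finset.sum_congr rfl fun i _ => ?_
    have h2 := T.isSymmetric_adjoint_comp_self.eigenvectorBasis_apply_self_apply hn v i
    rw [← hb, b.repr_apply_apply] at h2
    rw [real_inner_comm, h2, T.sq_singularValues_fin hn, b.repr_apply_apply]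
    simp only [RCLike.ofReal_real_eq_id, id_eq]
    ring
  have h2 : (c * ‖v‖) ^ 2 ≤ ‖T v‖ ^ 2 := by
    have h3 : ‖v‖ ^ 2 = ∑ i : Fin J, (b.repr v i) ^ 2 := by
      rw [← b.repr.norm_map v, EuclideanSpace.norm_sq_eq]
      simp
    rw [h1, mul_pow, h3, Finset.mul_sum]
    exact Finset.sum_le_sum fun i _ => mul_le_mul_of_nonneg_right
      (pow_le_pow_left₀ hc (h i i.2) 2) (sq_nonneg _)
  exact le_of_sq_le_sq h2 (norm_nonneg _)

/-- A function with first and second derivatives bounded by `c` near the convex hull of `S`. -/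
structure SmoothNear (S U : Set (Vec J)) (F : Vec J → ℝ) (c : ℝ) : Prop where
  contDiff : ContDiffOn ℝ 2 F U
  first : ∀ p ∈ U, ‖iteratedFDeriv ℝ 1 F p‖ ≤ c
  second : ∀ p ∈ U, ‖iteratedFDeriv ℝ 2 F p‖ ≤ c

variable {S U : Set (Vec J)} {F : Vec J → ℝ} {c : ℝ}

theorem SmoothNear.abs_sub_le (hF : SmoothNear S U F c) (hU : IsOpen U)
    (hSU : convexHull ℝ S ⊆ U) {p q : Vec J} (hp : p ∈ S) (hq : q ∈ S) :
    |F p - F q| ≤ c * ‖p - q‖ := by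
  refine (convex_convexHull ℝ S).norm_image_sub_le_of_norm_fderiv_le (𝕜 := ℝ) (f := F) (C := c)
    (fun x hx => ?_) (fun x hx => ?_) (subset_convexHull ℝ S hq) (subset_convexHull ℝ S hp)
  · exact (hF.contDiff.contDiffAt (hU.mem_nhds (hSU hx))).differentiableAt (by norm_num)
  · rw [← norm_iteratedFDeriv_one]; exact hF.first x (hSU hx)

/-- The second-derivative bound makes the gradient Lipschitz on the convex hull, so along the
segment it stays within c‖p - q‖ of its value at q; the mean value inequality then gives the
quadratic remainder. The hull is needed because S itself need not be convex. -/
theorem SmoothNear.abs_sub_sub_fderiv_le (hF : SmoothNear S U F c) (hU : IsOpen U)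
    (hSU : convexHull ℝ S ⊆ U) (hc : 0 ≤ c) {p q : Vec J} (hp : p ∈ S) (hq : q ∈ S) :
    |F p - F q - fderiv ℝ F q (p - q)| ≤ c * ‖p - q‖ ^ 2 := by
  have hqS := subset_convexHull ℝ S hq
  have hpS := subset_convexHull ℝ S hp
  have hlip : ∀ x ∈ convexHull ℝ S, ‖fderiv ℝ F x - fderiv ℝ F q‖ ≤ c * ‖x - q‖ := by
    intro x hx
    refine (convex_convexHull ℝ S).norm_image_sub_le_of_norm_fderiv_le (𝕜 := ℝ)
      (f := fderiv ℝ F) (C := c) (fun y hy => ?_) (fun y hy => ?_) hqS hx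
    · exact ((hF.contDiff.contDiffAt (hU.mem_nhds (hSU hy))).fderiv_right (m := 1)
        (by norm_num)).differentiableAt (by norm_num)
    · rw [← norm_iteratedFDeriv_one, norm_iteratedFDeriv_fderiv]
      exact hF.second y (hSU hy)
  have hseg : segment ℝ q p ⊆ convexHull ℝ S := (convex_convexHull ℝ S).segment_subset hqS hpS
  have h := (convex_segment q p).norm_image_sub_le_of_norm_hasFDerivWithin_le' (𝕜 := ℝ) (f := F)
    (f' := fderiv ℝ F) (φ := fderiv ℝ F q) (C := c * ‖p - q‖)
    (fun x hx => ((hF.contDiff.contDiffAt (hU.mem_nhds (hSU (hseg hx)))).differentiableAt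
      (by norm_num)).hasFDerivAt.hasFDerivWithinAt)
    (fun x hx => (hlip x (hseg hx)).trans
      (mul_le_mul_of_nonneg_left (by simpa [norm_sub_rev] using norm_sub_le_of_mem_segment hx) hc))
    (left_mem_segment ℝ q p) (right_mem_segment ℝ q p)
  calc _ ≤ c * ‖p - q‖ * ‖p - q‖ := h
    _ = _ := by ring

/-- Comparison of two secants. -/
theorem SmoothNear.abs_secant_sub_le (hF : SmoothNear S U F c) (hU : IsOpen U)
    (hSU : convexHull ℝ S ⊆ U) (hc : 0 ≤ c) {p q : Vec J} (hp : p ∈ S) (hq : q ∈ S) {t : ℝ}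
    (ht : 0 < t) (hqt : q + t • (p - q) ∈ S) :
    |F p - F q - t⁻¹ * (F (q + t • (p - q)) - F q)| ≤ c * ‖p - q‖ ^ 2 * (1 + t) := by
  have h1 := hF.abs_sub_sub_fderiv_le hU hSU hc hp hq
  have h2 := hF.abs_sub_sub_fderiv_le hU hSU hc hqt hq
  rw [add_sub_cancel_left, map_smul, norm_smul, Real.norm_of_nonneg ht.le, smul_eq_mul] at h2
  have h3 : |t⁻¹ * (F (q + t • (p - q)) - F q - t * fderiv ℝ F q (p - q))|
      ≤ c * ‖p - q‖ ^ 2 * t := by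
    rw [abs_mul, abs_of_pos (inv_pos.2 ht)]
    calc _ ≤ t⁻¹ * (c * (t * ‖p - q‖) ^ 2) := by gcongr
      _ = _ := by field_simp
  have e : F p - F q - t⁻¹ * (F (q + t • (p - q)) - F q)
      = (F p - F q - fderiv ℝ F q (p - q))
        - t⁻¹ * (F (q + t • (p - q)) - F q - t * fderiv ℝ F q (p - q)) := by
    field_simp; ring
  rw [e]
  refine (abs_sub _ _).trans ?_
  linarith

/-- A map whose secants at a zero `q` are almost linear grows at least linearly near `q`, when its
derivative there has singular values bounded below. -/
theorem norm_ge_of_secants {z : Vec J → Vec J} {c c₁ c₃ : ℝ} (hJ : 0 < J) (hc : 0 < c)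
    (hc₁ : 0 < c₁)
    (hc₃ : 0 < c₃) {p q : Vec J} (hz : z q = 0)
    (hsing : ∀ i < J, c₃ ≤ (fderiv ℝ z q).toLinearMap.singularValues i)
    (hball : Metric.ball q c₁ ⊆ S)
    (hsec : ∀ t : ℝ, 0 < t → q + t • (p - q) ∈ S → ∀ j,
      |z p j - z q j - t⁻¹ * (z (q + t • (p - q)) j - z q j)| ≤ c * ‖p - q‖ ^ 2 * (1 + t))
    (hpq : ‖p - q‖ ≤ c₃ / (2 * J * c)) :
    c₃ / 2 * ‖p - q‖ ≤ ‖z p‖ := by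
  -- At a point of non-differentiability `fderiv` is zero by convention and so are its singular
  -- values. The positive lower bound therefore forces differentiability.
  have hdiff : DifferentiableAt ℝ z q := by
    by_contra hnd
    have h := hsing 0 hJ
    rw [fderiv_zero_of_not_differentiableAt hnd] at h
    simp only [ContinuousLinearMap.toLinearMap_zero, LinearMap.singularValues_zero,
      Finsupp.coe_zero, Pi.zero_apply] at h
    linarith
  have hmul := mul_norm_le_norm_of_singularValues _ hc₃.le hsing (p - q)
  -- Let t decrease to zero in the secant comparison; the points q + t(p - q) are eventually in S
  -- because S contains a ball about q.
  have hcoord : ∀ j, |(z p - fderiv ℝ z q (p - q)) j| ≤ c * ‖p - q‖ ^ 2 := by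
    intro j
    have hline : HasLineDerivAt ℝ z (fderiv ℝ z q (p - q)) q (p - q) :=
      hdiff.hasFDerivAt.hasLineDerivAt _
    have hlim : Tendsto (fun t : ℝ => t⁻¹ • (z (q + t • (p - q)) - z q)) (𝓝[>] 0)
        (𝓝 (fderiv ℝ z q (p - q))) :=
      hline.tendsto_slope_zero.mono_left (nhdsWithin_mono _ fun t ht => ne_of_gt ht)
    have hlimj : Tendsto (fun t : ℝ => t⁻¹ * (z (q + t • (p - q)) j - z q j)) (𝓝[>] 0)
        (𝓝 (fderiv ℝ z q (p - q) j)) :=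
      ((EuclideanSpace.proj (𝕜 := ℝ) j).continuous.tendsto _).comp hlim
    have hleft : Tendsto (fun t : ℝ => |z p j - z q j - t⁻¹ * (z (q + t • (p - q)) j - z q j)|)
        (𝓝[>] 0) (𝓝 |z p j - z q j - fderiv ℝ z q (p - q) j|) :=
      (hlimj.const_sub _).abs
    have hright : Tendsto (fun t : ℝ => c * ‖p - q‖ ^ 2 * (1 + t)) (𝓝[>] 0)
        (𝓝 (c * ‖p - q‖ ^ 2 * (1 + 0))) :=
      ((tendsto_id.mono_left nhdsWithin_le_nhds).const_add 1).const_mul _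
    have hmem : ∀ᶠ t : ℝ in 𝓝[>] 0, q + t • (p - q) ∈ S := by
      have : Tendsto (fun t : ℝ => q + t • (p - q)) (𝓝[>] 0) (𝓝 (q + (0 : ℝ) • (p - q))) :=
        ((tendsto_id.mono_left nhdsWithin_le_nhds).smul_const _).const_add q
      rw [zero_smul, add_zero] at this
      exact (this.eventually (Metric.ball_mem_nhds q hc₁)).mono fun t ht => hball ht
    have := le_of_tendsto_of_tendsto hleft hright (by
      filter_upwards [hmem, self_mem_nhdsWithin] with t ht ht0
      exact hsec t ht0 ht j)
    rw [hz] at this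
    simpa using this
  have hrem := norm_le_of_abs_apply_le hcoord
  have htri : ‖fderiv ℝ z q (p - q)‖ ≤ ‖z p‖ + ‖z p - fderiv ℝ z q (p - q)‖ := by
    have := norm_sub_le (z p) (z p - fderiv ℝ z q (p - q))
    rwa [sub_sub_cancel] at this
  have hJ' : (0 : ℝ) < J := by exact_mod_cast hJ
  -- The radius c₃/(2Jc) is the one at which the quadratic remainder takes half of the linear growth
  -- c₃‖p - q‖.
  have h5 : J * (c * ‖p - q‖ ^ 2) ≤ c₃ / 2 * ‖p - q‖ := by
    rw [le_div_iff₀ (by positivity)] at hpq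
    nlinarith [norm_nonneg (p - q)]
  have hmul' : c₃ * ‖p - q‖ ≤ ‖fderiv ℝ z q (p - q)‖ := hmul
  linarith

end Calculus

/-! ### Identification and the doubly-robust bias -/

section Identification

variable {𝒳 𝓑 : Type*} [MeasurableSpace 𝒳] [MeasurableSpace 𝓑]

theorem measurable_cov : Measurable (cov : Agent 𝒳 𝓑 → 𝒳) := measurable_fst

theorem measurable_treat : Measurable (treat : Agent 𝒳 𝓑 → Bool) :=
  measurable_snd.comp measurable_snd

theorem measurable_bid (w : Bool) : Measurable fun a : Agent 𝒳 𝓑 => bid a w :=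
  (measurable_pi_apply w).comp (measurable_fst.comp measurable_snd)

theorem measurable_obsBid : Measurable (obsBid : Agent 𝒳 𝓑 → 𝓑) := by
  have : (obsBid : Agent 𝒳 𝓑 → 𝓑) = fun a => if treat a = true then bid a true else bid a false := by
    funext a
    unfold obsBid
    cases treat a <;> rfl
  rw [this]
  exact Measurable.ite (measurable_treat (measurableSet_singleton true)) (measurable_bid true)
    (measurable_bid false)

theorem measurable_armProb (w : Bool) : Measurable fun e : ℝ => armProb e w := by
  cases w
  · exact measurable_const.sub measurable_id
  · exact measurable_id

theorem measurableSet_treat_eq (w : Bool) : MeasurableSet {a : Agent 𝒳 𝓑 | treat a = w} :=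
  measurable_treat (measurableSet_singleton w)

variable {Q : Measure (Agent 𝒳 𝓑)} [IsProbabilityMeasure Q]

theorem armProb_pos {e : ℝ} (h : 0 < e ∧ e < 1) (w : Bool) : 0 < armProb e w := by
  cases w <;> simp [armProb, bern, h.1, h.2]

theorem armProb_lt_one {e : ℝ} (h : 0 < e ∧ e < 1) (w : Bool) : armProb e w < 1 := by
  cases w <;> simp [armProb, bern, h.1, h.2]

variable [StandardBorelSpace 𝒳] [StandardBorelSpace 𝓑]

theorem Identification.condProb_treat {e : 𝒳 → ℝ} (h : Identification Q e) (w : Bool) :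
    Q[({a : Agent 𝒳 𝓑 | treat a = w}).indicator (fun _ => (1 : ℝ)) | covSigma 𝒳 𝓑]
      =ᵐ[Q] fun a => armProb (e (cov a)) w := by
  have e1 : ({a : Agent 𝒳 𝓑 | treat a = true}).indicator (fun _ => (1 : ℝ))
      = fun a => ind (treat a) := by
    funext a; by_cases ha : treat a = true <;> simp [ind, ha]
  cases w
  · have e2 : ({a : Agent 𝒳 𝓑 | treat a = false}).indicator (fun _ => (1 : ℝ))
        = (fun _ => (1 : ℝ)) - fun a => ind (treat a) := by
      funext a; cases ha : treat a <;> simp [ind, ha]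
    have hint : Integrable (fun a : Agent 𝒳 𝓑 => ind (treat a)) Q := by
      rw [← e1]
      exact (integrable_const (1 : ℝ)).indicator (measurableSet_treat_eq true)
    rw [e2]
    refine (condExp_sub (integrable_const 1) hint _).trans ?_
    rw [condExp_const (covSigma_le 𝒳 𝓑)]
    filter_upwards [h.propensity] with a ha
    simp [armProb, bern, ha]
  · rw [e1]
    exact h.propensity

/-- Given the covariates, the joint conditional probability of the treatment and the submissions
factorizes. The treatment factor is the propensity, which depends on the covariates only and can be
moved back under the conditional expectation. -/
theorem Identification.measure_rect {e : 𝒳 → ℝ} (h : Identification Q e) (w : Bool)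
    {s : Set 𝒳} (hs : MeasurableSet s) {t : Set (Bool → 𝓑)} (ht : MeasurableSet t) :
    Q.real ({a : Agent 𝒳 𝓑 | treat a = w} ∩ (cov ⁻¹' s ∩ (fun a : Agent 𝒳 𝓑 => a.2.1) ⁻¹' t))
      = ∫ a in cov ⁻¹' s ∩ (fun a : Agent 𝒳 𝓑 => a.2.1) ⁻¹' t, armProb (e (cov a)) w ∂Q := by
  set A := {a : Agent 𝒳 𝓑 | treat a = w} with hA
  set Bt := (fun a : Agent 𝒳 𝓑 => a.2.1) ⁻¹' t with hBt
  have hm21 : Measurable fun a : Agent 𝒳 𝓑 => a.2.1 := measurable_fst.comp measurable_snd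
  have hAm : MeasurableSet A := measurableSet_treat_eq w
  have hBm : MeasurableSet Bt := hm21 ht
  have hGm : MeasurableSet (cov ⁻¹' s : Set (Agent 𝒳 𝓑)) := measurable_cov hs
  have hG : MeasurableSet[covSigma 𝒳 𝓑] (cov ⁻¹' s : Set (Agent 𝒳 𝓑)) := ⟨s, hs, rfl⟩
  have hci := (condIndepFun_iff_condExp_inter_preimage_eq_mul hm21 measurable_treat).1
    h.unconfounded t {w} ht (measurableSet_singleton w)
  have he : StronglyMeasurable[covSigma 𝒳 𝓑] fun a : Agent 𝒳 𝓑 => armProb (e (cov a)) w := by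
    refine Measurable.stronglyMeasurable ?_
    exact ((measurable_armProb w).comp h.propensity_meas).comp (comap_measurable _)
  have hebd : ∀ a : Agent 𝒳 𝓑, ‖armProb (e (cov a)) w‖ ≤ 1 := fun a => by
    rw [Real.norm_eq_abs, abs_of_pos (armProb_pos (h.overlap _) w)]
    exact (armProb_lt_one (h.overlap _) w).le
  have hBint : Integrable (Bt.indicator fun _ => (1 : ℝ)) Q := (integrable_const _).indicator hBm
  have heint : Integrable (fun a : Agent 𝒳 𝓑 => armProb (e (cov a)) w) Q :=
    Integrable.of_bound (he.mono (covSigma_le 𝒳 𝓑)).aestronglyMeasurable 1 (ae_of_all _ hebd)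
  have hprod : Integrable ((Bt.indicator fun _ => (1 : ℝ))
      * fun a : Agent 𝒳 𝓑 => armProb (e (cov a)) w) Q := by
    have : ((Bt.indicator fun _ => (1 : ℝ)) * fun a : Agent 𝒳 𝓑 => armProb (e (cov a)) w)
        = Bt.indicator fun a => armProb (e (cov a)) w := by
      funext a; by_cases ha : a ∈ Bt <;> simp [ha]
    rw [this]
    exact heint.indicator hBm
  have hpull := condExp_mul_of_stronglyMeasurable_right he hprod hBint
  have h1 : Q.real (A ∩ (cov ⁻¹' s ∩ Bt))
      = ∫ a in cov ⁻¹' s, ((Bt ∩ A).indicator fun _ => (1 : ℝ)) a ∂Q := by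
    rw [integral_indicator (hBm.inter hAm), Measure.restrict_restrict (hBm.inter hAm)]
    simp only [integral_const, smul_eq_mul, mul_one]
    rw [measureReal_restrict_apply_univ]
    congr 1
    ext a; simp only [Set.mem_inter_iff]; tauto
  rw [h1, ← setIntegral_condExp (covSigma_le 𝒳 𝓑) ((integrable_const _).indicator (hBm.inter hAm)) hG]
  have h2 : ∫ a in cov ⁻¹' s ∩ Bt, armProb (e (cov a)) w ∂Q
      = ∫ a in cov ⁻¹' s, ((Bt.indicator fun _ => (1 : ℝ))
        * fun a : Agent 𝒳 𝓑 => armProb (e (cov a)) w) a ∂Q := by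
    rw [Set.inter_comm, ← Measure.restrict_restrict hBm, ← integral_indicator hBm]
    refine integral_congr_ae (ae_of_all _ fun a => ?_)
    by_cases ha : a ∈ Bt <;> simp [ha]
  rw [h2, ← setIntegral_condExp (covSigma_le 𝒳 𝓑) hprod hG]
  refine setIntegral_congr_ae hGm ?_
  filter_upwards [hci, hpull, h.condProb_treat w] with a h3 h4 h5 _
  have h3' : (Q[(Bt ∩ A).indicator (fun _ => (1 : ℝ)) | covSigma 𝒳 𝓑]) a
      = (Q[Bt.indicator (fun _ => (1 : ℝ)) | covSigma 𝒳 𝓑]) a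
        * (Q[A.indicator (fun _ => (1 : ℝ)) | covSigma 𝒳 𝓑]) a := h3
  rw [h4, h3', h5]
  rfl

/-- Inverse-propensity weighting: the treatment indicator may be replaced by the propensity. -/
theorem Identification.integral_treat {e : 𝒳 → ℝ} (h : Identification Q e) (w : Bool)
    {ψ : 𝒳 × (Bool → 𝓑) → ℝ} (hψ : Measurable ψ) :
    ∫ a, (if treat a = w then 1 else 0) * ψ (cov a, a.2.1) ∂Q
      = ∫ a, armProb (e (cov a)) w * ψ (cov a, a.2.1) ∂Q := by
  have hX : Measurable fun a : Agent 𝒳 𝓑 => (cov a, a.2.1) :=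
    measurable_cov.prodMk (measurable_fst.comp measurable_snd)
  have hem : Measurable fun a : Agent 𝒳 𝓑 => ENNReal.ofReal (armProb (e (cov a)) w) :=
    (((measurable_armProb w).comp h.propensity_meas).comp measurable_cov).ennreal_ofReal
  have heint : Integrable (fun a : Agent 𝒳 𝓑 => armProb (e (cov a)) w) Q := by
    refine Integrable.of_bound (((measurable_armProb w).comp h.propensity_meas).comp
      measurable_cov).aestronglyMeasurable 1 (ae_of_all _ fun a => ?_)
    rw [Real.norm_eq_abs, abs_of_pos (armProb_pos (h.overlap _) w)]
    exact (armProb_lt_one (h.overlap _) w).le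
  -- The restriction to the arm and the measure with density the propensity agree on rectangles,
  -- hence coincide as laws of the covariates and potential submissions.
  have hμ : (Q.restrict {a | treat a = w}).map (fun a : Agent 𝒳 𝓑 => (cov a, a.2.1))
      = (Q.withDensity fun a => ENNReal.ofReal (armProb (e (cov a)) w)).map
        (fun a : Agent 𝒳 𝓑 => (cov a, a.2.1)) := by
    refine Measure.ext_prod fun {s t} hs ht => ?_
    rw [Measure.map_apply hX (hs.prod ht), Measure.map_apply hX (hs.prod ht),
      Measure.restrict_apply (hX (hs.prod ht)), withDensity_apply _ (hX (hs.prod ht))]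
    have e1 : (fun a : Agent 𝒳 𝓑 => (cov a, a.2.1)) ⁻¹' s ×ˢ t
        = cov ⁻¹' s ∩ (fun a : Agent 𝒳 𝓑 => a.2.1) ⁻¹' t := rfl
    rw [e1, ← ofReal_integral_eq_lintegral_ofReal heint.integrableOn
      (ae_of_all _ fun a => (armProb_pos (h.overlap _) w).le), ← h.measure_rect w hs ht,
      Set.inter_comm, ofReal_measureReal]
  have h1 : ∫ q, ψ q ∂((Q.restrict {a | treat a = w}).map fun a : Agent 𝒳 𝓑 => (cov a, a.2.1))
      = ∫ q, ψ q ∂((Q.withDensity fun a => ENNReal.ofReal (armProb (e (cov a)) w)).map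
        fun a : Agent 𝒳 𝓑 => (cov a, a.2.1)) := by rw [hμ]
  rw [integral_map hX.aemeasurable hψ.aestronglyMeasurable,
    integral_map hX.aemeasurable hψ.aestronglyMeasurable,
    integral_withDensity_eq_integral_toReal_smul hem (ae_of_all _ fun a => ENNReal.ofReal_lt_top),
    ← integral_indicator (measurableSet_treat_eq w)] at h1
  calc ∫ a, (if treat a = w then 1 else 0) * ψ (cov a, a.2.1) ∂Q
      = ∫ a, ({a : Agent 𝒳 𝓑 | treat a = w}).indicator (fun a => ψ (cov a, a.2.1)) a ∂Q := by
        refine integral_congr_ae (ae_of_all _ fun a => ?_)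
        by_cases ha : treat a = w <;> simp [ha]
    _ = _ := h1
    _ = _ := by
        refine integral_congr_ae (ae_of_all _ fun a => ?_)
        simp only [smul_eq_mul]
        rw [ENNReal.toReal_ofReal (armProb_pos (h.overlap _) w).le]

omit [StandardBorelSpace 𝒳] [StandardBorelSpace 𝓑] in
/-- A conditional mean may replace the function under the integral. -/
theorem integral_mul_condMean {f : Agent 𝒳 𝓑 → ℝ} (hf : Integrable f Q) {m : 𝒳 → ℝ}
    (hm : Q[f | covSigma 𝒳 𝓑] =ᵐ[Q] fun a => m (cov a)) {φ : 𝒳 → ℝ} (hφ : Measurable φ) {b : ℝ}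
    (hb : ∀ x, |φ x| ≤ b) :
    ∫ a, φ (cov a) * f a ∂Q = ∫ a, φ (cov a) * m (cov a) ∂Q := by
  have hφm : StronglyMeasurable[covSigma 𝒳 𝓑] fun a : Agent 𝒳 𝓑 => φ (cov a) :=
    (hφ.comp (comap_measurable _)).stronglyMeasurable
  have hint : Integrable ((fun a : Agent 𝒳 𝓑 => φ (cov a)) * f) Q :=
    hf.bdd_mul (c := b) (hφ.comp measurable_cov).aestronglyMeasurable (ae_of_all _ fun a => hb _)
  have h1 := condExp_mul_of_stronglyMeasurable_left hφm hint hf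
  have h2 := integral_condExp (μ := Q) (f := (fun a : Agent 𝒳 𝓑 => φ (cov a)) * f)
    (covSigma_le 𝒳 𝓑)
  calc ∫ a, φ (cov a) * f a ∂Q = ∫ a, ((fun a : Agent 𝒳 𝓑 => φ (cov a)) * f) a ∂Q := rfl
    _ = _ := h2.symm
    _ = _ := integral_congr_ae (by
        filter_upwards [h1, hm] with a h3 h4
        rw [h3, Pi.mul_apply, h4])

omit [StandardBorelSpace 𝒳] [StandardBorelSpace 𝓑] [IsProbabilityMeasure Q] in
theorem condMean_abs_le {f : Agent 𝒳 𝓑 → ℝ} {m : 𝒳 → ℝ}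
    (hm : Q[f | covSigma 𝒳 𝓑] =ᵐ[Q] fun a => m (cov a)) {K : ℝ}
    (hK : ∀ a, |f a| ≤ K) : ∀ᵐ a ∂Q, |m (cov a)| ≤ K := by
  have := ae_bdd_abs_condExp_of_ae_bdd_abs (m := covSigma 𝒳 𝓑) (μ := Q) (f := f) (R := K)
    (ae_of_all _ hK)
  filter_upwards [this, hm] with a h1 h2
  rw [← h2]; exact h1

omit [StandardBorelSpace 𝒳] [StandardBorelSpace 𝓑] [IsProbabilityMeasure Q] in
theorem integral_mul_le_sqrt_mul_sqrt {f g : Agent 𝒳 𝓑 → ℝ} (hf0 : ∀ a, 0 ≤ f a)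
    (hg0 : ∀ a, 0 ≤ g a) (hf : MemLp f 2 Q) (hg : MemLp g 2 Q) :
    ∫ a, f a * g a ∂Q ≤ Real.sqrt (∫ a, f a ^ 2 ∂Q) * Real.sqrt (∫ a, g a ^ 2 ∂Q) := by
  have h := integral_mul_le_Lp_mul_Lq_of_nonneg (μ := Q) (p := 2) (q := 2)
    Real.HolderConjugate.two_two (ae_of_all _ hf0) (ae_of_all _ hg0) (by simpa using hf)
    (by simpa using hg)
  simpa [Real.sqrt_eq_rpow] using h

end Identification

section Bias

variable {𝒳 𝓑 : Type*} [MeasurableSpace 𝒳] [MeasurableSpace 𝓑]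
  {Q : Measure (Agent 𝒳 𝓑)} [IsProbabilityMeasure Q]

theorem le_armProb {κ e : ℝ} (h : e ∈ Set.Icc κ (1 - κ)) (w : Bool) : κ ≤ armProb e w := by
  cases w
  · simp only [armProb, bern, Bool.false_eq_true, if_false]; linarith [h.2]
  · simpa [armProb, bern] using h.1

theorem abs_armProb_sub (e e' : ℝ) (w : Bool) : |armProb e w - armProb e' w| = |e - e'| := by
  cases w
  · simp only [armProb, bern, Bool.false_eq_true, if_false]
    rw [abs_sub_comm]; congr 1; ring
  · simp [armProb, bern]

theorem abs_ipw_le {κ e : ℝ} (hκ : 0 < κ) (h : e ∈ Set.Icc κ (1 - κ)) (w W : Bool) :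
    |ipw w W e| ≤ κ⁻¹ := by
  have h1 := le_armProb h w
  have h2 : 0 < armProb e w := hκ.trans_le h1
  unfold ipw
  split_ifs
  · rw [abs_of_pos (by positivity), one_div]
    exact inv_anti₀ hκ h1
  · rw [zero_div, abs_zero]; positivity

omit [IsProbabilityMeasure Q] in
theorem abs_one_sub_div_le {κ a a' : ℝ} (hκ : 0 < κ) (ha' : κ ≤ a') :
    |1 - a / a'| ≤ κ⁻¹ * |a' - a| := by
  have h : 0 < a' := hκ.trans_le ha'
  have e : 1 - a / a' = (a' - a) / a' := by field_simp
  rw [e, abs_div, abs_of_pos h, div_eq_inv_mul]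
  exact mul_le_mul_of_nonneg_right (inv_anti₀ hκ ha') (abs_nonneg _)

variable [StandardBorelSpace 𝒳] [StandardBorelSpace 𝓑]

/-- The bias of the doubly-robust score is the product of the errors of the two nuisances. -/
theorem doublyRobust_bias {e : 𝒳 → ℝ} (hident : Identification Q e) (w : Bool) {π : Policy 𝒳}
    (hπ : Measurable π) {eHat mHat m m₀ : 𝒳 → ℝ} (heHat : Measurable eHat)
    (hmHat : Measurable mHat) (hm : Measurable m) (hm₀ : Measurable m₀) {κ K Δ ρe ρμ : ℝ}
    (hκ : 0 < κ) (hcl : ∀ x, eHat x ∈ Set.Icc κ (1 - κ)) (hmK : ∀ x, |mHat x| ≤ K)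
    {f : 𝓑 → ℝ} (hf : Measurable f) (hfK : ∀ b, |f b| ≤ K)
    (hcond : Q[fun a => f (bid a w) | covSigma 𝒳 𝓑] =ᵐ[Q] fun a => m (cov a))
    (hΔ : ∀ x, |m x - m₀ x| ≤ Δ)
    (hρμ : Real.sqrt (∫ a, (mHat (cov a) - m₀ (cov a)) ^ 2 ∂Q) ≤ ρμ)
    (hρe : Real.sqrt (∫ a, (eHat (cov a) - e (cov a)) ^ 2 ∂Q) ≤ ρe) :
    |∫ a, gated w cov π (fun a => 1 - ipw w (treat a) (eHat (cov a))) mHat a ∂Q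
      + ∫ a, gated w obsBid π (fun a => ipw w (treat a) (eHat (cov a))) f a ∂Q
      - ∫ a, gated w (fun a => bid a w) π (fun _ => 1) f a ∂Q|
      ≤ κ⁻¹ * (ρe * (Δ + ρμ)) := by
  have hem := hident.propensity_meas
  set g : 𝒳 → ℝ := fun x => if π x = w then 1 else 0 with hg
  have hgm : Measurable g :=
    Measurable.ite (hπ (measurableSet_singleton w)) measurable_const measurable_const
  have hg01 : ∀ x, 0 ≤ g x ∧ g x ≤ 1 := fun x => by simp only [hg]; split_ifs <;> norm_num
  set r : 𝒳 → ℝ := fun x => armProb (e x) w / armProb (eHat x) w with hr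
  have hrm : Measurable r :=
    ((measurable_armProb w).comp hem).div ((measurable_armProb w).comp heHat)
  have hat : ∀ x, κ ≤ armProb (eHat x) w := fun x => le_armProb (hcl x) w
  have hat0 : ∀ x, 0 < armProb (eHat x) w := fun x => hκ.trans_le (hat x)
  have hrb : ∀ x, |r x| ≤ κ⁻¹ := by
    intro x
    have h1 := armProb_pos (hident.overlap x) w
    have h2 := armProb_lt_one (hident.overlap x) w
    rw [hr, abs_of_nonneg (div_nonneg h1.le (hat0 x).le), div_le_iff₀ (hat0 x)]
    have := mul_le_mul_of_nonneg_left (hat x) (inv_pos.2 hκ).le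
    rw [inv_mul_cancel₀ hκ.ne'] at this
    linarith
  have hmae := condMean_abs_le hcond (fun a => hfK _)
  have hfint : Integrable (fun a : Agent 𝒳 𝓑 => f (bid a w)) Q :=
    Integrable.of_bound (hf.comp (measurable_bid w)).aestronglyMeasurable K
      (ae_of_all _ fun a => hfK _)
  have hmHint : Integrable (fun a : Agent 𝒳 𝓑 => mHat (cov a)) Q :=
    Integrable.of_bound (hmHat.comp measurable_cov).aestronglyMeasurable K
      (ae_of_all _ fun a => hmK _)
  have hmint : Integrable (fun a : Agent 𝒳 𝓑 => m (cov a)) Q :=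
    Integrable.of_bound (hm.comp measurable_cov).aestronglyMeasurable K hmae
  have hgint : ∀ {u : Agent 𝒳 𝓑 → ℝ}, Integrable u Q → Integrable (fun a => g (cov a) * u a) Q :=
    fun hu => hu.bdd_mul (c := 1) (hgm.comp measurable_cov).aestronglyMeasurable
      (ae_of_all _ fun a => by rw [Real.norm_eq_abs, abs_of_nonneg (hg01 _).1]; exact (hg01 _).2)
  have hrint : ∀ {u : Agent 𝒳 𝓑 → ℝ}, Integrable u Q → Integrable (fun a => r (cov a) * u a) Q :=
    fun hu => hu.bdd_mul (c := κ⁻¹) (hrm.comp measurable_cov).aestronglyMeasurable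
      (ae_of_all _ fun a => hrb _)
  have hmeasB : Measurable fun q : 𝒳 × (Bool → 𝓑) => f (q.2 w) :=
    hf.comp ((measurable_pi_apply w).comp measurable_snd)
  have hW : ∀ a : Agent 𝒳 𝓑, |(if treat a = w then 1 else 0 : ℝ)| ≤ 1 := fun a => by
    split_ifs <;> simp
  have hmW : Measurable fun a : Agent 𝒳 𝓑 => (if treat a = w then 1 else 0 : ℝ) :=
    Measurable.ite (measurableSet_treat_eq w) measurable_const measurable_const
  have hinvm : Measurable fun x => (armProb (eHat x) w)⁻¹ := ((measurable_armProb w).comp heHat).inv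
  have hinvb : ∀ x, |(armProb (eHat x) w)⁻¹| ≤ κ⁻¹ := fun x => by
    rw [abs_of_pos (inv_pos.2 (hat0 x))]; exact inv_anti₀ hκ (hat x)
  have hIW : Integrable (fun a : Agent 𝒳 𝓑 => (if treat a = w then 1 else 0 : ℝ)
      * ((armProb (eHat (cov a)) w)⁻¹ * (g (cov a) * mHat (cov a)))) Q := by
    refine Integrable.bdd_mul (c := 1) ?_ hmW.aestronglyMeasurable (ae_of_all _ hW)
    exact (hgint hmHint).bdd_mul (c := κ⁻¹) (hinvm.comp measurable_cov).aestronglyMeasurable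
      (ae_of_all _ fun a => hinvb _)
  have i1 : ∫ a, gated w cov π (fun a => 1 - ipw w (treat a) (eHat (cov a))) mHat a ∂Q
      = ∫ a, g (cov a) * mHat (cov a) ∂Q - ∫ a, r (cov a) * (g (cov a) * mHat (cov a)) ∂Q := by
    have h1 := hident.integral_treat w
      (ψ := fun q => (armProb (eHat q.1) w)⁻¹ * (g q.1 * mHat q.1))
      ((hinvm.comp measurable_fst).mul ((hgm.comp measurable_fst).mul (hmHat.comp measurable_fst)))
    have h2 : ∫ a, r (cov a) * (g (cov a) * mHat (cov a)) ∂Q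
        = ∫ a, armProb (e (cov a)) w
          * ((armProb (eHat (cov a)) w)⁻¹ * (g (cov a) * mHat (cov a))) ∂Q :=
      integral_congr_ae (ae_of_all _ fun a => by simp only [hr]; ring)
    rw [h2, ← h1, ← integral_sub (hgint hmHint) hIW]
    refine integral_congr_ae (ae_of_all _ fun a => ?_)
    simp only [gated, ipw, hg]
    ring
  have i2 : ∫ a, gated w obsBid π (fun a => ipw w (treat a) (eHat (cov a))) f a ∂Q
      = ∫ a, r (cov a) * (g (cov a) * m (cov a)) ∂Q := by
    have h1 := hident.integral_treat w
      (ψ := fun q => (armProb (eHat q.1) w)⁻¹ * (g q.1 * f (q.2 w)))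
      ((hinvm.comp measurable_fst).mul ((hgm.comp measurable_fst).mul hmeasB))
    have h2 := integral_mul_condMean hfint hcond (φ := fun x => r x * g x) (hrm.mul hgm)
      (b := κ⁻¹) (fun x => by
        rw [abs_mul, abs_of_nonneg (hg01 x).1]
        exact (mul_le_of_le_one_right (abs_nonneg _) (hg01 x).2).trans (hrb x))
    calc _ = ∫ a, (if treat a = w then 1 else 0)
          * ((armProb (eHat (cov a)) w)⁻¹ * (g (cov a) * f (a.2.1 w))) ∂Q := by
          refine integral_congr_ae (ae_of_all _ fun a => ?_)
          simp only [gated, ipw, hg]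
          by_cases ha : treat a = w
          · simp only [ha, if_true, obsBid, bid]; ring
          · simp only [ha, if_false]; ring
      _ = _ := h1
      _ = ∫ a, r (cov a) * g (cov a) * f (bid a w) ∂Q :=
          integral_congr_ae (ae_of_all _ fun a => by simp only [hr, bid]; ring)
      _ = _ := h2
      _ = _ := integral_congr_ae (ae_of_all _ fun a => by simp only; ring)
  have i3 : ∫ a, gated w (fun a => bid a w) π (fun _ => 1) f a ∂Q
      = ∫ a, g (cov a) * m (cov a) ∂Q := by
    rw [← integral_mul_condMean hfint hcond hgm (b := 1) (fun x => by
      rw [abs_of_nonneg (hg01 x).1]; exact (hg01 x).2)]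
    exact integral_congr_ae (ae_of_all _ fun a => by simp only [gated, hg, one_mul])
  -- With r the ratio of true to estimated arm probability, the bias is the mean of g(1 - r)(mHat -
  -- m): it vanishes as soon as either nuisance is exact.
  have hsum : ∫ a, gated w cov π (fun a => 1 - ipw w (treat a) (eHat (cov a))) mHat a ∂Q
      + ∫ a, gated w obsBid π (fun a => ipw w (treat a) (eHat (cov a))) f a ∂Q
      - ∫ a, gated w (fun a => bid a w) π (fun _ => 1) f a ∂Q
      = ∫ a, g (cov a) * ((1 - r (cov a)) * (mHat (cov a) - m (cov a))) ∂Q := by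
    have j1 := hgint hmHint
    have j2 := hrint j1
    have j3 := hrint (hgint hmint)
    have j4 := hgint hmint
    have j12 : Integrable (fun a : Agent 𝒳 𝓑 => g (cov a) * mHat (cov a)
        - r (cov a) * (g (cov a) * mHat (cov a))) Q := j1.sub j2
    have j34 : Integrable (fun a : Agent 𝒳 𝓑 => r (cov a) * (g (cov a) * m (cov a))
        - g (cov a) * m (cov a)) Q := j3.sub j4
    rw [i1, i2, i3, add_sub_assoc, ← integral_sub j1 j2, ← integral_sub j3 j4,
      ← integral_add j12 j34]
    exact integral_congr_ae (ae_of_all _ fun a => by simp only; ring)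
  rw [hsum]
  have heb : ∀ x, |eHat x - e x| ≤ 1 := fun x => by
    have h1 := hident.overlap x
    have h2 := hcl x
    rw [abs_le]; constructor <;> linarith [h1.1, h1.2, h2.1, h2.2]
  have heL2 : MemLp (fun a : Agent 𝒳 𝓑 => |eHat (cov a) - e (cov a)|) 2 Q :=
    MemLp.of_bound (((heHat.sub hem).comp measurable_cov).abs).aestronglyMeasurable 1
      (ae_of_all _ fun a => by rw [Real.norm_eq_abs, abs_abs]; exact heb _)
  have hm0b : ∀ᵐ a ∂Q, ‖|mHat (cov a) - m₀ (cov a)|‖ ≤ K + (K + Δ) := by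
    filter_upwards [hmae] with a ha
    rw [Real.norm_eq_abs, abs_abs]
    have h1 := hmK (cov a)
    have h2 := hΔ (cov a)
    rw [abs_le] at *
    constructor <;> linarith [h1.1, h1.2, h2.1, h2.2, ha.1, ha.2]
  have hmL2 : MemLp (fun a : Agent 𝒳 𝓑 => |mHat (cov a) - m₀ (cov a)|) 2 Q :=
    MemLp.of_bound (((hmHat.sub hm₀).comp measurable_cov).abs).aestronglyMeasurable _ hm0b
  have hone : MemLp (fun _ : Agent 𝒳 𝓑 => (1 : ℝ)) 2 Q := memLp_const 1
  have hΔ0 : 0 ≤ Δ := by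
    obtain ⟨a⟩ : Nonempty (Agent 𝒳 𝓑) := nonempty_of_isProbabilityMeasure Q
    exact (abs_nonneg _).trans (hΔ (cov a))
  have hCS1 := integral_mul_le_sqrt_mul_sqrt (fun _ => abs_nonneg _) (fun _ => abs_nonneg _)
    heL2 hmL2
  have hCS2 := integral_mul_le_sqrt_mul_sqrt (fun _ => abs_nonneg _) (fun _ => zero_le_one)
    heL2 hone
  simp only [sq_abs, mul_one, one_pow, integral_const, probReal_univ, smul_eq_mul,
    Real.sqrt_one] at hCS1 hCS2
  have hb1 : Integrable (fun a : Agent 𝒳 𝓑 => |eHat (cov a) - e (cov a)|) Q :=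
    heL2.integrable (by norm_num)
  have hb2 : Integrable (fun a : Agent 𝒳 𝓑 =>
      |eHat (cov a) - e (cov a)| * |mHat (cov a) - m₀ (cov a)|) Q :=
    heL2.integrable_mul hmL2
  have hρe0 := (Real.sqrt_nonneg _).trans hρe
  have hρμ0 := (Real.sqrt_nonneg _).trans hρμ
  -- Here |1 - r| ≤ κ⁻¹|eHat - e|, and mHat - m is split at `m₀`, the mean targeted by the
  -- regression. Cauchy–Schwarz against |mHat - m₀| and against the constant one finishes.
  calc |∫ a, g (cov a) * ((1 - r (cov a)) * (mHat (cov a) - m (cov a))) ∂Q|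
      ≤ ∫ a, κ⁻¹ * (|eHat (cov a) - e (cov a)| * Δ
          + |eHat (cov a) - e (cov a)| * |mHat (cov a) - m₀ (cov a)|) ∂Q := by
        refine abs_integral_le_integral_abs.trans (integral_mono_of_nonneg
          (ae_of_all _ fun a => abs_nonneg _) (((hb1.mul_const Δ).add hb2).const_mul _)
          (ae_of_all _ fun a => ?_))
        simp only
        rw [abs_mul, abs_of_nonneg (hg01 _).1]
        refine (mul_le_of_le_one_left (abs_nonneg _) (hg01 _).2).trans ?_
        rw [abs_mul, ← mul_add, ← mul_assoc]
        refine mul_le_mul ?_ ?_ (abs_nonneg _) (by positivity)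
        · have := abs_one_sub_div_le (a := armProb (e (cov a)) w) hκ (hat (cov a))
          rwa [abs_armProb_sub] at this
        · have h1 := abs_sub_le (mHat (cov a)) (m₀ (cov a)) (m (cov a))
          have h2 := hΔ (cov a)
          rw [abs_sub_comm] at h2
          linarith
    _ = κ⁻¹ * ((∫ a, |eHat (cov a) - e (cov a)| ∂Q) * Δ
          + ∫ a, |eHat (cov a) - e (cov a)| * |mHat (cov a) - m₀ (cov a)| ∂Q) := by
        rw [integral_const_mul, integral_add (hb1.mul_const Δ) hb2, integral_mul_const]
    _ ≤ κ⁻¹ * (ρe * Δ + ρe * ρμ) := by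
        gcongr
        · exact hCS2.trans hρe
        · exact hCS1.trans (mul_le_mul hρe hρμ (Real.sqrt_nonneg _) hρe0)
    _ = _ := by ring

end Bias

/-! ### Scalar outcomes -/

section Scalar

variable {J : ℕ} {𝒳 𝓑 : Type*} [MeasurableSpace 𝒳] [MeasurableSpace 𝓑]
  {Q : Measure (Agent 𝒳 𝓑)} [IsProbabilityMeasure Q]

/-- `𝔼[f(B(π(X)), p)]`. -/
def scalarMean (Q : Measure (Agent 𝒳 𝓑)) (f : 𝓑 → Vec J → ℝ) (π : Policy 𝒳) (p : Vec J) : ℝ :=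
  ∫ a, f (bid a (π (cov a))) p ∂Q

/-- A bounded outcome that depends on the cutoffs and has conditional means that are smooth in
them. -/
structure ScalarOutcome (Q : Measure (Agent 𝒳 𝓑)) (S U : Set (Vec J)) (f : 𝓑 → Vec J → ℝ)
    (m : Bool → 𝒳 → Vec J → ℝ) (K c : ℝ) : Prop where
  meas : ∀ p ∈ S, Measurable fun b => f b p
  bdd : ∀ p ∈ S, ∀ b, |f b p| ≤ K
  meas_mean : ∀ w, ∀ p ∈ S, Measurable fun x => m w x p
  condMean : ∀ w, ∀ p ∈ S,
    Q[fun a => f (bid a w) p | covSigma 𝒳 𝓑] =ᵐ[Q] fun a => m w (cov a) p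
  isOpen : IsOpen U
  hull : convexHull ℝ S ⊆ U
  smooth : ∀ w x, SmoothNear S U (m w x) c

variable {S U : Set (Vec J)} {f : 𝓑 → Vec J → ℝ} {m : Bool → 𝒳 → Vec J → ℝ} {K c : ℝ}

-- Summing over arms makes the rule enter only through an indicator, which gives the product form
-- needed for the entropy bound.
omit [MeasurableSpace 𝒳] [MeasurableSpace 𝓑] in
theorem sum_gated_bid (π : Policy 𝒳) (g : 𝓑 → ℝ) (a : Agent 𝒳 𝓑) :
    ∑ w, gated w (fun a => bid a w) π (fun _ => 1) g a = g (bid a (π (cov a))) := by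
  rw [Fintype.sum_bool]
  cases h : π (cov a) <;> simp [gated, h]

omit [IsProbabilityMeasure Q] in
theorem meanOutcome_eq (M : Mechanism J 𝓑) (π : Policy 𝒳) (p : Vec J) :
    meanOutcome M Q π p = scalarMean Q M.y π p := by
  unfold meanOutcome scalarMean
  congr 1
  funext a
  cases h : π (cov a) <;> simp [ind]

omit [IsProbabilityMeasure Q] in
theorem integrable_mean (hf : ScalarOutcome Q S U f m K c) [IsFiniteMeasure Q] {π : Policy 𝒳}
    (hπ : Measurable π) {p : Vec J} (hp : p ∈ S) :
    Integrable (fun a => m (π (cov a)) (cov a) p) Q := by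
  refine Integrable.of_bound (C := K) ?_ ?_
  · have : (fun a : Agent 𝒳 𝓑 => m (π (cov a)) (cov a) p)
        = fun a => if π (cov a) = true then m true (cov a) p else m false (cov a) p := by
      funext a; cases π (cov a) <;> rfl
    rw [this]
    exact (Measurable.ite ((hπ.comp measurable_cov) (measurableSet_singleton true))
      ((hf.meas_mean true p hp).comp measurable_cov)
      ((hf.meas_mean false p hp).comp measurable_cov)).aestronglyMeasurable
  · filter_upwards [condMean_abs_le (m := fun x => m true x p) (hf.condMean true p hp)
        fun a => hf.bdd p hp _,
      condMean_abs_le (m := fun x => m false x p) (hf.condMean false p hp)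
        fun a => hf.bdd p hp _] with a h1 h2
    cases π (cov a)
    · exact h2
    · exact h1

theorem integrable_gated_bid (hf : ScalarOutcome Q S U f m K c) {π : Policy 𝒳} (hπ : Measurable π)
    {p : Vec J} (hp : p ∈ S) (w : Bool) :
    Integrable (gated w (fun a => bid a w) π (fun _ => 1) fun b => f b p) Q :=
  Integrable.of_bound (measurable_gated (measurable_bid w) hπ measurable_const
    (hf.meas p hp)).aestronglyMeasurable _
    (ae_of_all _ fun a => abs_gated_le (H := 1) (fun _ => by simp) (hf.bdd p hp) a)

theorem scalarMean_eq_sum (hf : ScalarOutcome Q S U f m K c) {π : Policy 𝒳} (hπ : Measurable π)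
    {p : Vec J} (hp : p ∈ S) :
    scalarMean Q f π p
      = ∑ w, ∫ a, gated w (fun a => bid a w) π (fun _ => 1) (fun b => f b p) a ∂Q := by
  rw [← integral_finsetSum _ fun w _ => integrable_gated_bid hf hπ hp w]
  exact integral_congr_ae (ae_of_all _ fun a => (sum_gated_bid π (fun b => f b p) a).symm)

/-- Outcomes may jump in p; conditioning on the covariates replaces them by means that are smooth in
p. -/
theorem scalarMean_eq_integral_mean (hf : ScalarOutcome Q S U f m K c) {π : Policy 𝒳}
    (hπ : Measurable π) {p : Vec J} (hp : p ∈ S) :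
    scalarMean Q f π p = ∫ a, m (π (cov a)) (cov a) p ∂Q := by
  have h1 : ∀ w, ∫ a, gated w (fun a => bid a w) π (fun _ => 1) (fun b => f b p) a ∂Q
      = ∫ a, (if π (cov a) = w then 1 else 0) * m w (cov a) p ∂Q := by
    intro w
    have hfint : Integrable (fun a : Agent 𝒳 𝓑 => f (bid a w) p) Q :=
      Integrable.of_bound ((hf.meas p hp).comp (measurable_bid w)).aestronglyMeasurable K
        (ae_of_all _ fun a => hf.bdd p hp _)
    have h2 := integral_mul_condMean (m := fun x => m w x p) hfint (hf.condMean w p hp)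
      (φ := fun x => if π x = w then 1 else 0)
      (Measurable.ite (hπ (measurableSet_singleton w)) measurable_const measurable_const)
      (b := 1) (fun x => by split_ifs <;> simp)
    rw [← h2]
    exact integral_congr_ae (ae_of_all _ fun a => by simp only [gated, one_mul])
  have h3 : ∀ w, Integrable (fun a => (if π (cov a) = w then 1 else 0) * m w (cov a) p) Q := by
    intro w
    have hmint : Integrable (fun a : Agent 𝒳 𝓑 => m w (cov a) p) Q :=
      integrable_mean hf (π := fun _ => w) measurable_const hp
    refine hmint.bdd_mul (c := 1) (Measurable.ite
      ((hπ.comp measurable_cov) (measurableSet_singleton w)) measurable_const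
      measurable_const).aestronglyMeasurable (ae_of_all _ fun a => by split_ifs <;> simp)
  rw [scalarMean_eq_sum hf hπ hp, Finset.sum_congr rfl fun w _ => h1 w,
    ← integral_finsetSum _ fun w _ => h3 w]
  refine integral_congr_ae (ae_of_all _ fun a => ?_)
  simp only [Fintype.sum_bool]
  cases h : π (cov a) <;> simp

theorem abs_scalarMean_sub_le (hf : ScalarOutcome Q S U f m K c) {π : Policy 𝒳}
    (hπ : Measurable π) {p q : Vec J} (hp : p ∈ S) (hq : q ∈ S) :
    |scalarMean Q f π p - scalarMean Q f π q| ≤ c * ‖p - q‖ := by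
  rw [scalarMean_eq_integral_mean hf hπ hp, scalarMean_eq_integral_mean hf hπ hq,
    ← integral_sub (integrable_mean hf hπ hp) (integrable_mean hf hπ hq)]
  have := norm_integral_le_of_norm_le_const (μ := Q)
    (f := fun a => m (π (cov a)) (cov a) p - m (π (cov a)) (cov a) q) (C := c * ‖p - q‖)
    (ae_of_all _ fun a => (hf.smooth _ _).abs_sub_le hf.isOpen hf.hull hp hq)
  simpa using this

/-- Secant inequalities pass under the integral directly, so excess demand is linearized without
differentiating under the integral sign. -/
theorem abs_scalarMean_secant_le (hf : ScalarOutcome Q S U f m K c) (hc : 0 ≤ c) {π : Policy 𝒳}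
    (hπ : Measurable π) {p q : Vec J} (hp : p ∈ S) (hq : q ∈ S) {t : ℝ} (ht : 0 < t)
    (hqt : q + t • (p - q) ∈ S) :
    |scalarMean Q f π p - scalarMean Q f π q
      - t⁻¹ * (scalarMean Q f π (q + t • (p - q)) - scalarMean Q f π q)|
      ≤ c * ‖p - q‖ ^ 2 * (1 + t) := by
  have i1 := integrable_mean hf hπ hp
  have i2 := integrable_mean hf hπ hq
  have i3 := integrable_mean hf hπ hqt
  have i12 : Integrable (fun a => m (π (cov a)) (cov a) p - m (π (cov a)) (cov a) q) Q := i1.sub i2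
  have i32 : Integrable (fun a => t⁻¹ * (m (π (cov a)) (cov a) (q + t • (p - q))
    - m (π (cov a)) (cov a) q)) Q := (i3.sub i2).const_mul _
  rw [scalarMean_eq_integral_mean hf hπ hp, scalarMean_eq_integral_mean hf hπ hq,
    scalarMean_eq_integral_mean hf hπ hqt, ← integral_sub i1 i2, ← integral_sub i3 i2,
    ← integral_const_mul, ← integral_sub i12 i32]
  have := norm_integral_le_of_norm_le_const (μ := Q)
    (f := fun a => m (π (cov a)) (cov a) p - m (π (cov a)) (cov a) q
      - t⁻¹ * (m (π (cov a)) (cov a) (q + t • (p - q)) - m (π (cov a)) (cov a) q))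
    (C := c * ‖p - q‖ ^ 2 * (1 + t))
    (ae_of_all _ fun a => (hf.smooth _ _).abs_secant_sub_le hf.isOpen hf.hull hc hp hq ht hqt)
  simpa using this

/-! ### Sample averages -/

theorem one_div_mul_sqrt {x : ℝ} (hx : 0 < x) : 1 / x * Real.sqrt x = 1 / Real.sqrt x := by
  have hs : 0 < Real.sqrt x := Real.sqrt_pos.2 hx
  rw [div_mul_eq_mul_div, one_mul, div_eq_div_iff hx.ne' hs.ne', Real.mul_self_sqrt hx.le, one_mul]

/-- The sample average of an outcome under a rule, in terms of centred sums. -/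
theorem abs_sampleMean_sub_le (hf : ScalarOutcome Q S U f m K c) {π : Policy 𝒳}
    (hπ : Measurable π) {p : Vec J} (hp : p ∈ S) {n : ℕ} (hn : 0 < n) (z : Fin n → Agent 𝒳 𝓑) {B : ℝ}
    (hdev : ∀ w, |deviation Q Finset.univ z
      (gated w (fun a => bid a w) π (fun _ => 1) fun b => f b p)| ≤ B * Real.sqrt n) :
    |(1 / (n : ℝ)) * ∑ i, f (bid (z i) (π (cov (z i)))) p - scalarMean Q f π p|
      ≤ 2 * B * (1 / Real.sqrt n) := by
  have hn' : (0 : ℝ) < n := by exact_mod_cast hn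
  have e : (1 / (n : ℝ)) * ∑ i, f (bid (z i) (π (cov (z i)))) p - scalarMean Q f π p
      = (1 / (n : ℝ)) * ∑ w, deviation Q Finset.univ z
        (gated w (fun a => bid a w) π (fun _ => 1) fun b => f b p) := by
    rw [scalarMean_eq_sum hf hπ hp]
    simp only [deviation, Finset.sum_sub_distrib, Finset.sum_const, Finset.card_univ,
      Fintype.card_fin, nsmul_eq_mul]
    rw [Finset.sum_comm, ← Finset.mul_sum]
    simp only [sum_gated_bid]
    field_simp
  rw [e, abs_mul, abs_of_pos (by positivity : 0 < 1 / (n : ℝ)), Fintype.sum_bool]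
  have h1 := (abs_add_le _ _).trans (add_le_add (hdev true) (hdev false))
  calc 1 / (n : ℝ) * _ ≤ 1 / n * (B * Real.sqrt n + B * Real.sqrt n) := by gcongr
    _ = 2 * B * (1 / n * Real.sqrt n) := by ring
    _ = 2 * B * (1 / Real.sqrt n) := by rw [one_div_mul_sqrt hn']

/-- The observations in fold `k`. -/
def fold {n : ℕ} (σ : Split n) (k : Fin 3) : Finset (Fin n) := Finset.univ.filter fun i => σ.1 i = k

/-- The average doubly-robust score of an outcome under a rule, given the cross-fitted nuisances. -/
def scoreMean {n : ℕ} (σ : Split n) (z : Fin n → Agent 𝒳 𝓑) (eh : Fin 3 → 𝒳 → ℝ)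
    (mh : Fin 3 → Bool → 𝒳 → ℝ) (g : 𝓑 → ℝ) (π : Policy 𝒳) : ℝ :=
  (1 / (n : ℝ)) * ∑ i, (mh (σ.1 i) (π (cov (z i))) (cov (z i))
    + ipw (π (cov (z i))) (treat (z i)) (eh (σ.1 i) (cov (z i)))
      * (g (obsBid (z i)) - mh (σ.1 i) (π (cov (z i))) (cov (z i))))

/-- The regression part of the score. -/
def scoreReg (w : Bool) (π : Policy 𝒳) (e μ : 𝒳 → ℝ) : Agent 𝒳 𝓑 → ℝ :=
  gated w cov π (fun a => 1 - ipw w (treat a) (e (cov a))) μ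

/-- The inverse-propensity part of the score. -/
def scoreIpw (w : Bool) (π : Policy 𝒳) (e : 𝒳 → ℝ) (g : 𝓑 → ℝ) : Agent 𝒳 𝓑 → ℝ :=
  gated w obsBid π (fun a => ipw w (treat a) (e (cov a))) g

/-- The score equals (1 - r)μ̂ + r g, with r the inverse-propensity factor. Three folds, two arms
and two parts give twelve centred sums. The biases are averaged with the fold frequencies, which add
to one, and only the two arms remain. -/
theorem abs_scoreMean_sub_le (hf : ScalarOutcome Q S U f m K c) {π : Policy 𝒳}
    (hπ : Measurable π) {p : Vec J} (hp : p ∈ S) {n : ℕ} (hn : 0 < n) (σ : Split n)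
    (z : Fin n → Agent 𝒳 𝓑) {eh : Fin 3 → 𝒳 → ℝ} {mh : Fin 3 → Bool → 𝒳 → ℝ} {B β : ℝ}
    (hreg : ∀ k w, |deviation Q (fold σ k) z (scoreReg w π (eh k) (mh k w))| ≤ B * Real.sqrt n)
    (hipw : ∀ k w, |deviation Q (fold σ k) z (scoreIpw w π (eh k) fun b => f b p)|
      ≤ B * Real.sqrt n)
    (hbias : ∀ k w, |∫ a, scoreReg w π (eh k) (mh k w) a ∂Q
      + ∫ a, scoreIpw w π (eh k) (fun b => f b p) a ∂Q
      - ∫ a, gated w (fun a => bid a w) π (fun _ => 1) (fun b => f b p) a ∂Q| ≤ β) :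
    |scoreMean σ z eh mh (fun b => f b p) π - scalarMean Q f π p|
      ≤ 12 * B * (1 / Real.sqrt n) + 2 * β := by
  have hn' : (0 : ℝ) < n := by exact_mod_cast hn
  set g : 𝓑 → ℝ := fun b => f b p with hg
  let dr : Fin 3 → Bool → ℝ := fun k w => deviation Q (fold σ k) z (scoreReg w π (eh k) (mh k w))
  let di : Fin 3 → Bool → ℝ := fun k w => deviation Q (fold σ k) z (scoreIpw w π (eh k) g)
  let bi : Fin 3 → Bool → ℝ := fun k w => ∫ a, scoreReg w π (eh k) (mh k w) a ∂Q
      + ∫ a, scoreIpw w π (eh k) g a ∂Q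
      - ∫ a, gated w (fun a => bid a w) π (fun _ => 1) g a ∂Q
  have hcard : ∑ k, ((fold σ k).card : ℝ) = n := by
    have := Finset.card_eq_sum_card_fiberwise (s := (Finset.univ : Finset (Fin n)))
      (t := (Finset.univ : Finset (Fin 3))) (f := σ.1) (fun _ _ => Finset.mem_univ _)
    rw [Finset.card_univ, Fintype.card_fin] at this
    exact_mod_cast this.symm
  have hsplit : ∀ i, mh (σ.1 i) (π (cov (z i))) (cov (z i))
      + ipw (π (cov (z i))) (treat (z i)) (eh (σ.1 i) (cov (z i)))
        * (g (obsBid (z i)) - mh (σ.1 i) (π (cov (z i))) (cov (z i)))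
      = ∑ w, (scoreReg w π (eh (σ.1 i)) (mh (σ.1 i) w) (z i)
        + scoreIpw w π (eh (σ.1 i)) g (z i)) := by
    intro i
    rw [Fintype.sum_bool]
    cases h : π (cov (z i)) <;> simp only [scoreReg, scoreIpw, gated, h] <;> simp <;> ring
  have hfold : ∀ k, ∑ i ∈ fold σ k, ∑ w, (scoreReg w π (eh (σ.1 i)) (mh (σ.1 i) w) (z i)
        + scoreIpw w π (eh (σ.1 i)) g (z i))
      = ∑ w, (dr k w + di k w) + (fold σ k).card * (scalarMean Q f π p + ∑ w, bi k w) := by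
    intro k
    have h1 : ∑ i ∈ fold σ k, ∑ w, (scoreReg w π (eh (σ.1 i)) (mh (σ.1 i) w) (z i)
        + scoreIpw w π (eh (σ.1 i)) g (z i))
        = ∑ i ∈ fold σ k, ∑ w, (scoreReg w π (eh k) (mh k w) (z i)
        + scoreIpw w π (eh k) g (z i)) :=
      Finset.sum_congr rfl fun i hi => by rw [(Finset.mem_filter.1 hi).2]
    rw [h1, scalarMean_eq_sum hf hπ hp]
    simp only [dr, di, bi, deviation, Fintype.sum_bool, Finset.sum_sub_distrib, Finset.sum_const,
      nsmul_eq_mul, Finset.sum_add_distrib, ← hg]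
    ring
  have hmain : scoreMean σ z eh mh g π - scalarMean Q f π p
      = (1 / (n : ℝ)) * (∑ k, ∑ w, (dr k w + di k w) + ∑ k, (fold σ k).card * ∑ w, bi k w) := by
    have h2 : ∑ i, (mh (σ.1 i) (π (cov (z i))) (cov (z i))
        + ipw (π (cov (z i))) (treat (z i)) (eh (σ.1 i) (cov (z i)))
          * (g (obsBid (z i)) - mh (σ.1 i) (π (cov (z i))) (cov (z i))))
        = ∑ k, (∑ w, (dr k w + di k w)
          + (fold σ k).card * (scalarMean Q f π p + ∑ w, bi k w)) := by
      rw [Finset.sum_congr rfl fun i _ => hsplit i,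
        ← Finset.sum_fiberwise_of_maps_to (g := σ.1) (t := Finset.univ)
          (fun i _ => Finset.mem_univ _)]
      exact Finset.sum_congr rfl fun k _ => hfold k
    rw [scoreMean, h2]
    simp only [Finset.sum_add_distrib, mul_add]
    rw [← Finset.sum_mul, hcard]
    field_simp
    ring
  rw [hmain]
  have hb : ∀ k, |∑ w, bi k w| ≤ 2 * β := fun k => by
    rw [Fintype.sum_bool]
    have := (abs_add_le _ _).trans (add_le_add (hbias k true) (hbias k false))
    linarith
  have hd : ∀ k, |∑ w, (dr k w + di k w)| ≤ 4 * (B * Real.sqrt n) := fun k => by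
    rw [Fintype.sum_bool]
    have h1 := (abs_add_le _ _).trans (add_le_add (hreg k true) (hipw k true))
    have h2 := (abs_add_le _ _).trans (add_le_add (hreg k false) (hipw k false))
    have := (abs_add_le (dr k true + di k true) (dr k false + di k false)).trans (add_le_add h1 h2)
    linarith
  have h3 : |∑ k, ∑ w, (dr k w + di k w)| ≤ 12 * (B * Real.sqrt n) := by
    refine (Finset.abs_sum_le_sum_abs _ _).trans ((Finset.sum_le_sum fun k _ => hd k).trans ?_)
    simp; linarith
  have h4 : |∑ k, (fold σ k).card * ∑ w, bi k w| ≤ n * (2 * β) := by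
    rw [← hcard, Finset.sum_mul]
    refine (Finset.abs_sum_le_sum_abs _ _).trans (Finset.sum_le_sum fun k _ => ?_)
    rw [abs_mul, Nat.abs_cast]
    exact mul_le_mul_of_nonneg_left (hb k) (Nat.cast_nonneg _)
  rw [abs_mul, abs_of_pos (by positivity : 0 < 1 / (n : ℝ))]
  calc 1 / (n : ℝ) * _ ≤ 1 / n * (12 * (B * Real.sqrt n) + n * (2 * β)) := by
        gcongr
        exact (abs_add_le _ _).trans (add_le_add h3 h4)
    _ = _ := by
        have := one_div_mul_sqrt hn'
        have h5 : 1 / (n : ℝ) * n = 1 := by field_simp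
        linear_combination (12 * B) * this + (2 * β) * h5

end Scalar

/-! ### Cross-fitted nuisance estimates -/

section Held

variable {𝒳 𝓑 Ω : Type*} [MeasurableSpace 𝒳] [MeasurableSpace 𝓑] [MeasurableSpace Ω]

/-- A null event for a fresh observation is a null event for a held-out observation. -/
theorem pi_heldOut_null {ι α : Type*} [Fintype ι] [MeasurableSpace α] (Q : Measure α)
    [IsProbabilityMeasure Q] {bad : Set ((ι → α) × α)} (hbad : MeasurableSet bad) (i : ι)
    (hdep : ∀ z z' a, (∀ k, k ≠ i → z k = z' k) → ((z, a) ∈ bad ↔ (z', a) ∈ bad))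
    (hnull : (Measure.pi fun _ : ι => Q) {z | Q {a | (z, a) ∈ bad} ≠ 0} = 0) :
    (Measure.pi fun _ : ι => Q) {z | (z, z i) ∈ bad} = 0 := by
  classical
  set μ := Measure.pi fun _ : ι => Q with hμ
  have hm1 : MeasurableSet {z : ι → α | (z, z i) ∈ bad} :=
    (measurable_id.prodMk (measurable_pi_apply i)) hbad
  -- Only coordinate i is exchanged with a fresh copy. The event depends on the sample through the
  -- other coordinates, so afterwards it concerns a fresh point and Fubini applies.
  let τ : ι → Bool := fun k => if k = i then false else true
  have h1 : μ {z | (z, z i) ∈ bad} = (μ.prod μ) ({z | (z, z i) ∈ bad} ×ˢ Set.univ) := by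
    rw [Measure.prod_prod, measure_univ, mul_one]
  have hm2 : MeasurableSet {p : (ι → α) × (ι → α) | (p.1, p.2 i) ∈ bad} :=
    (measurable_fst.prodMk ((measurable_pi_apply i).comp measurable_snd)) hbad
  have h2 : swapSample τ ⁻¹' ({z | (z, z i) ∈ bad} ×ˢ Set.univ)
      = {p : (ι → α) × (ι → α) | (p.1, p.2 i) ∈ bad} := by
    ext p
    have e : (swapSample τ p).1 i = p.2 i := by simp [swapSample, τ]
    simp only [Set.mem_preimage, Set.mem_prod, Set.mem_ofPred_eq, Set.mem_univ, and_true, e]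
    exact hdep _ _ _ fun k hk => by simp [swapSample, τ, hk]
  rw [h1, ← (measurePreserving_swapSample Q τ).measure_preimage
    (hm1.prod MeasurableSet.univ).nullMeasurableSet, h2, Measure.prod_apply hm2,
    lintegral_eq_zero_iff (measurable_measure_prodMk_left hm2)]
  filter_upwards [measure_eq_zero_iff_ae_notMem.1 hnull] with z hz
  have h3 := (measurePreserving_eval (fun _ : ι => Q) i).measure_preimage (s := {a | (z, a) ∈ bad})
    ((measurable_const.prodMk measurable_id) hbad : MeasurableSet {a | (z, a) ∈ bad}).nullMeasurableSet
  exact h3.trans (not_not.1 hz)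

/-- Each split either has probability zero or inherits the null event for a fresh point; in the
latter case finitely many held-out indices are united. -/
theorem ae_heldOut {P : Measure Ω} [IsProbabilityMeasure P] {Q : Measure (Agent 𝒳 𝓑)}
    [IsProbabilityMeasure Q] {Z : ℕ → Ω → Agent 𝒳 𝓑} {split : (n : ℕ) → Ω → Split n}
    (hsample : Sampling P Q Z split) (n : ℕ) (T : Split n → Finset (Fin n))
    {bad : Split n → Set ((Fin n → Agent 𝒳 𝓑) × Agent 𝒳 𝓑)} (hbad : ∀ σ, MeasurableSet (bad σ))
    (hdep : ∀ σ z z' a, (∀ k ∉ T σ, z k = z' k) → ((z, a) ∈ bad σ ↔ (z', a) ∈ bad σ))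
    (h : ∀ᵐ ω ∂P, ∀ᵐ a ∂Q, ((fun i : Fin n => Z i ω), a) ∉ bad (split n ω)) :
    ∀ᵐ ω ∂P, ∀ i ∈ T (split n ω), ((fun i : Fin n => Z i ω), Z i ω) ∉ bad (split n ω) := by
  have hNm : ∀ σ, MeasurableSet {z : Fin n → Agent 𝒳 𝓑 | Q {a | (z, a) ∈ bad σ} ≠ 0} := fun σ =>
    ((measurable_measure_prodMk_left (hbad σ)) (measurableSet_singleton 0)).compl
  have hAm : ∀ σ, MeasurableSet {z : Fin n → Agent 𝒳 𝓑 | ∃ i ∈ T σ, (z, z i) ∈ bad σ} := by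
    intro σ
    simp only [Set.ofPred_exists]
    refine MeasurableSet.iUnion fun i => ?_
    by_cases hi : i ∈ T σ
    · have h : {z : Fin n → Agent 𝒳 𝓑 | i ∈ T σ ∧ (z, z i) ∈ bad σ} = {z | (z, z i) ∈ bad σ} := by
        ext; simp [hi]
      rw [h]
      exact (measurable_id.prodMk (measurable_pi_apply i)) (hbad σ)
    · simp [hi]
  have h1 := hsample.measure_split_sample n hNm
  have h0 : P {ω | (fun i : Fin n => Z i ω)
      ∈ {z : Fin n → Agent 𝒳 𝓑 | Q {a | (z, a) ∈ bad (split n ω)} ≠ 0}} = 0 := by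
    rw [measure_eq_zero_iff_ae_notMem]
    filter_upwards [h] with ω hω hcon
    exact hcon (measure_eq_zero_iff_ae_notMem.2 hω)
  rw [h0] at h1
  have h2 := hsample.measure_split_sample n hAm
  have h3 : ∑ σ, P (split n ⁻¹' {σ})
      * (Measure.pi fun _ : Fin n => Q) {z | ∃ i ∈ T σ, (z, z i) ∈ bad σ} = 0 := by
    refine Finset.sum_eq_zero fun σ hσ => ?_
    rcases mul_eq_zero.1 (Finset.sum_eq_zero_iff.1 h1.symm σ hσ) with h4 | h4
    · rw [h4, zero_mul]
    · have h5 : {z : Fin n → Agent 𝒳 𝓑 | ∃ i ∈ T σ, (z, z i) ∈ bad σ}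
          = ⋃ i ∈ T σ, {z | (z, z i) ∈ bad σ} := by ext; simp
      have h6 : (Measure.pi fun _ : Fin n => Q) (⋃ i ∈ T σ, {z | (z, z i) ∈ bad σ}) = 0 := by
        refine measure_iUnion_null fun i => measure_iUnion_null fun hi => ?_
        refine pi_heldOut_null Q (hbad σ) i (fun z z' a hz => hdep σ z z' a fun k hk => hz k ?_) h4
        rintro rfl
        exact hk hi
      rw [h5, h6, mul_zero]
  rw [h3] at h2
  filter_upwards [measure_eq_zero_iff_ae_notMem.1 h2] with ω hω i hi hcon
  exact hω ⟨i, hi, hcon⟩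

end Held

/-! ### Truncation of nuisance estimates to their almost sure ranges -/

section Clip

/-- Truncation to an interval. -/
def clip (lo hi x : ℝ) : ℝ := max lo (min hi x)

theorem clip_mem {lo hi : ℝ} (h : lo ≤ hi) (x : ℝ) : clip lo hi x ∈ Set.Icc lo hi :=
  ⟨le_max_left _ _, max_le h (min_le_left _ _)⟩

theorem clip_eq {lo hi x : ℝ} (h : x ∈ Set.Icc lo hi) : clip lo hi x = x := by
  rw [clip, min_eq_right h.2, max_eq_right h.1]

theorem abs_clip_sub_le (lo hi s t : ℝ) : |clip lo hi s - clip lo hi t| ≤ |s - t| := by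
  rw [clip, clip, max_comm lo, max_comm lo, min_comm hi, min_comm hi]
  refine (abs_max_sub_max_le_abs (min s hi) (min t hi) lo).trans ?_
  have h := abs_min_sub_min_le_max s hi t hi
  rwa [sub_self, abs_zero, max_eq_left (abs_nonneg _)] at h

theorem continuous_clip (lo hi : ℝ) : Continuous (clip lo hi) :=
  continuous_const.max (continuous_const.min continuous_id)

theorem abs_clip_le {K : ℝ} (hK : 0 ≤ K) (x : ℝ) : |clip (-K) K x| ≤ K :=
  abs_le.2 (clip_mem (by linarith) x)

end Clip

/-! ### Deviations of cross-fitted scores over held-out folds -/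

section CrossFit

variable {J : ℕ} {𝒳 𝓑 Ω : Type*} [MeasurableSpace 𝒳] [MeasurableSpace 𝓑] [MeasurableSpace Ω]

omit [MeasurableSpace 𝒳] [MeasurableSpace 𝓑] in
theorem subsample_congr {n : ℕ} {α : Type*} {s : Finset (Fin n)} {f g : Fin n → α}
    (h : ∀ i ∈ s, f i = g i) : subsample s f = subsample s g := by
  funext a
  exact h _ (Finset.orderEmbOfFin_mem s rfl a)

theorem notMem_fold_of_mem_halfG {n : ℕ} {σ : Split n} {k : Fin 3} {i : Fin n}
    (hi : i ∈ halfG σ k) : i ∉ fold σ k := fun h =>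
  (Finset.mem_filter.1 hi).2.1 (Finset.mem_filter.1 h).2

theorem measurable_subsample {n : ℕ} {α β : Type*} [MeasurableSpace α] [MeasurableSpace β]
    (s : Finset (Fin n)) {f : α → β} (hf : Measurable f) :
    Measurable fun z : Fin n → α => subsample s fun i => f (z i) :=
  measurable_pi_iff.2 fun a => hf.comp (measurable_pi_apply (s.orderEmbOfFin rfl a))

/-- The class of rules, with a countable pointwise dense subclass. -/
structure RuleClass (Rules R₀ : Set (Policy 𝒳)) (v : ℕ) : Prop where
  vc : ∀ s : Finset 𝒳, Shatters Rules s → s.card ≤ v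
  countable : R₀.Countable
  subset : R₀ ⊆ Rules
  meas : ∀ π ∈ Rules, Measurable π
  sep : PointwiseSeparable R₀ Rules fun π x => π x

/-- A cross-fitted estimate of the propensity score. -/
structure PropEstimate (P : Measure Ω) (Q : Measure (Agent 𝒳 𝓑)) (Z : ℕ → Ω → Agent 𝒳 𝓑)
    (split : (n : ℕ) → Ω → Split n)
    (E : (n : ℕ) → Split n → (Fin n → Agent 𝒳 𝓑) → Fin 3 → 𝒳 → ℝ) (κ : ℝ) : Prop where
  meas : ∀ n σ k, Measurable fun q : (Fin n → Agent 𝒳 𝓑) × 𝒳 => E n σ q.1 k q.2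
  dep : ∀ n σ k z z', (∀ i ∉ fold σ k, z i = z' i) → E n σ z k = E n σ z' k
  overlap : ∀ n k, ∀ᵐ ω ∂P, ∀ᵐ a ∂Q,
    E n (split n ω) (fun i => Z i ω) k (cov a) ∈ Set.Ioo κ (1 - κ)

/-- A cross-fitted regression estimate. -/
structure RegEstimate (P : Measure Ω) (Z : ℕ → Ω → Agent 𝒳 𝓑)
    (split : (n : ℕ) → Ω → Split n) (S₀ S : Set (Vec J))
    (R : (n : ℕ) → Split n → (Fin n → Agent 𝒳 𝓑) → Fin 3 → Bool → Vec J → 𝒳 → ℝ)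
    (C ν K : ℝ) : Prop where
  meas : ∀ n σ k w, ∀ p ∈ S, Measurable fun q : (Fin n → Agent 𝒳 𝓑) × 𝒳 => R n σ q.1 k w p q.2
  dep : ∀ n σ k z z', (∀ i ∉ fold σ k, z i = z' i) → R n σ z k = R n σ z' k
  bdd : ∀ n k, ∀ᵐ ω ∂P, ∀ w x, ∀ p ∈ S, |R n (split n ω) (fun i => Z i ω) k w p x| ≤ K
  sep : ∀ n k w, ∀ᵐ ω ∂P, PointwiseSeparable S₀ S (R n (split n ω) (fun i => Z i ω) k w)
  cover : WithHighProb P fun n ω => ∀ k w,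
    UniformCovering {g | ∃ p ∈ S, g = R n (split n ω) (fun i => Z i ω) k w p} C ν

variable {P : Measure Ω} [IsProbabilityMeasure P] {Q : Measure (Agent 𝒳 𝓑)}
  [IsProbabilityMeasure Q] {Z : ℕ → Ω → Agent 𝒳 𝓑} {split : (n : ℕ) → Ω → Split n}
  {Rules R₀ : Set (Policy 𝒳)} {v : ℕ} {S₀ S : Set (Vec J)}
  {E : (n : ℕ) → Split n → (Fin n → Agent 𝒳 𝓑) → Fin 3 → 𝒳 → ℝ}
  {R : (n : ℕ) → Split n → (Fin n → Agent 𝒳 𝓑) → Fin 3 → Bool → Vec J → 𝒳 → ℝ} {κ C ν K : ℝ}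

omit [IsProbabilityMeasure P] [IsProbabilityMeasure Q] in
theorem measurable_ipw_estimate (hE : PropEstimate P Q Z split E κ) (n : ℕ) (σ : Split n)
    (k : Fin 3) (w : Bool) :
    Measurable fun q : (Fin n → Agent 𝒳 𝓑) × Agent 𝒳 𝓑 =>
      ipw w (treat q.2) (clip κ (1 - κ) (E n σ q.1 k (cov q.2))) := by
  unfold ipw
  refine Measurable.div (Measurable.ite ?_ measurable_const measurable_const)
    ((measurable_armProb w).comp ((continuous_clip _ _).measurable.comp
      ((hE.meas n σ k).comp (measurable_fst.prodMk (measurable_cov.comp measurable_snd)))))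
  exact (measurable_treat.comp measurable_snd) (measurableSet_singleton w)

/-- The deviation bound requires bounds valid for every sample, while the estimates are bounded
almost surely only; hence the truncated versions. The cutoff p ranges over all of S, so first-step
cutoffs computed from the data may be inserted later. -/
theorem boundedInProb_scoreReg (hsample : Sampling P Q Z split) (hR : RuleClass Rules R₀ v)
    (hS₀ : S₀.Countable) (hSS : S₀ ⊆ S) (hκ : 0 < κ) (hκ1 : κ ≤ 1 - κ) (hK : 0 ≤ K) (hν : 0 < ν)
    (hE : PropEstimate P Q Z split E κ) (hreg : RegEstimate P Z split S₀ S R C ν K) :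
    BoundedInProb P fun n B ω => ∀ k w, ∀ π ∈ Rules, ∀ p ∈ S,
      |deviation Q (fold (split n ω) k) (fun i => Z i ω) (scoreReg w π
        (fun x => clip κ (1 - κ) (E n (split n ω) (fun i => Z i ω) k x))
        fun x => clip (-K) K (R n (split n ω) (fun i => Z i ω) k w p x))| ≤ B * Real.sqrt n := by
  refine BoundedInProb.forall_finite fun k => BoundedInProb.forall_finite fun w => ?_
  refine boundedInProb_deviation hsample hR.vc hR.countable hR.subset
    (fun π hπ => hR.meas π (hR.subset hπ)) hR.sep hS₀ w measurable_cov
    (T := fun n σ => fold σ k)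
    (h := fun n σ z a => 1 - ipw w (treat a) (clip κ (1 - κ) (E n σ z k (cov a))))
    (fun n σ => (measurable_ipw_estimate hE n σ k w).const_sub 1) (H := 1 + κ⁻¹) (by positivity)
    (fun n σ z a => ?_) (fun n σ z z' hz => ?_)
    (f := fun n σ z p x => clip (-K) K (R n σ z k w p x))
    (fun n σ p hp => (continuous_clip _ _).measurable.comp (hreg.meas n σ k w p (hSS hp)))
    (fun n σ z p hp x => abs_clip_le hK _) (fun n σ z z' hz => ?_) (fun n => ?_) hν ?_ (C := C)
  · refine (abs_sub _ _).trans ?_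
    rw [abs_one]
    exact add_le_add_right (abs_ipw_le hκ (clip_mem hκ1 _) _ _) 1
  · rw [hE.dep n σ k z z' hz]
  · rw [hreg.dep n σ k z z' hz]
  · filter_upwards [hreg.sep n k w] with ω hω p hp
    obtain ⟨u, hu, hl⟩ := hω p hp
    exact ⟨u, hu, fun x => ((continuous_clip _ _).tendsto _).comp (hl x)⟩
  · refine hreg.cover.mono fun n ω h => ?_
    refine ((h k w).comp_lipschitz (abs_clip_sub_le (-K) K)).mono ?_ le_rfl
    rintro _ ⟨p, hp, rfl⟩
    exact ⟨_, ⟨p, hSS hp, rfl⟩, rfl⟩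

theorem boundedInProb_scoreIpw (hsample : Sampling P Q Z split) (hR : RuleClass Rules R₀ v)
    (hS₀ : S₀.Countable) (hSS : S₀ ⊆ S) (hκ : 0 < κ) (hκ1 : κ ≤ 1 - κ) (hν : 0 < ν)
    (hE : PropEstimate P Q Z split E κ) {f : 𝓑 → Vec J → ℝ}
    (hf : ∀ p ∈ S, Measurable fun b => f b p) (hfK : ∀ p ∈ S, ∀ b, |f b p| ≤ K)
    (hsep : PointwiseSeparable S₀ S fun p b => f b p)
    (hcov : UniformCovering {g | ∃ p ∈ S, g = fun b => f b p} C ν) :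
    BoundedInProb P fun n B ω => ∀ k w, ∀ π ∈ Rules, ∀ p ∈ S,
      |deviation Q (fold (split n ω) k) (fun i => Z i ω) (scoreIpw w π
        (fun x => clip κ (1 - κ) (E n (split n ω) (fun i => Z i ω) k x)) fun b => f b p)|
        ≤ B * Real.sqrt n := by
  refine BoundedInProb.forall_finite fun k => BoundedInProb.forall_finite fun w => ?_
  refine boundedInProb_deviation hsample hR.vc hR.countable hR.subset
    (fun π hπ => hR.meas π (hR.subset hπ)) hR.sep hS₀ w measurable_obsBid
    (T := fun n σ => fold σ k)
    (h := fun n σ z a => ipw w (treat a) (clip κ (1 - κ) (E n σ z k (cov a))))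
    (fun n σ => measurable_ipw_estimate hE n σ k w) (H := κ⁻¹) (by positivity)
    (fun n σ z a => abs_ipw_le hκ (clip_mem hκ1 _) _ _) (fun n σ z z' hz => ?_)
    (f := fun n σ z p b => f b p)
    (fun n σ p hp => (hf p (hSS hp)).comp measurable_snd)
    (fun n σ z p hp x => hfK p (hSS hp) x) (fun n σ z z' hz => rfl)
    (fun n => ae_of_all _ fun ω => hsep) hν (WithHighProb.of_ae fun n => ae_of_all _ fun ω => ?_)
    (C := C)
  · rw [hE.dep n σ k z z' hz]
  · exact hcov.mono (fun g ⟨p, hp, h⟩ => ⟨p, hSS hp, h⟩) le_rfl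

theorem boundedInProb_population (hsample : Sampling P Q Z split) (hR : RuleClass Rules R₀ v)
    (hS₀ : S₀.Countable) (hSS : S₀ ⊆ S) (hν : 0 < ν) {f : 𝓑 → Vec J → ℝ}
    (hf : ∀ p ∈ S, Measurable fun b => f b p) (hfK : ∀ p ∈ S, ∀ b, |f b p| ≤ K)
    (hsep : PointwiseSeparable S₀ S fun p b => f b p)
    (hcov : UniformCovering {g | ∃ p ∈ S, g = fun b => f b p} C ν) :
    BoundedInProb P fun n B ω => ∀ w, ∀ π ∈ Rules, ∀ p ∈ S,
      |deviation Q Finset.univ (fun i : Fin n => Z i ω)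
        (gated w (fun a => bid a w) π (fun _ => 1) fun b => f b p)| ≤ B * Real.sqrt n := by
  refine BoundedInProb.forall_finite fun w => ?_
  exact boundedInProb_deviation hsample hR.vc hR.countable hR.subset
    (fun π hπ => hR.meas π (hR.subset hπ)) hR.sep hS₀ w (measurable_bid w)
    (T := fun n σ => Finset.univ) (h := fun n σ z a => 1)
    (fun n σ => measurable_const) (H := 1) zero_le_one (fun n σ z a => by simp)
    (fun n σ z z' hz => rfl) (f := fun n σ z p b => f b p)
    (fun n σ p hp => (hf p (hSS hp)).comp measurable_snd)
    (fun n σ z p hp x => hfK p (hSS hp) x) (fun n σ z z' hz => rfl)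
    (fun n => ae_of_all _ fun ω => hsep) hν
    (WithHighProb.of_ae fun n => ae_of_all _ fun ω =>
      hcov.mono (fun g ⟨p, hp, h⟩ => ⟨p, hSS hp, h⟩) le_rfl) (C := C)

/-- The propensity estimates satisfy overlap at the held-out observations. -/
theorem PropEstimate.ae_overlap (hE : PropEstimate P Q Z split E κ)
    (hsample : Sampling P Q Z split) (n : ℕ) :
    ∀ᵐ ω ∂P, ∀ i : Fin n, E n (split n ω) (fun i => Z i ω) ((split n ω).1 i) (cov (Z i ω))
      ∈ Set.Icc κ (1 - κ) := by
  have h : ∀ k : Fin 3, ∀ᵐ ω ∂P, ∀ i ∈ fold (split n ω) k,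
      ((fun i : Fin n => Z i ω), Z i ω) ∉ (fun σ : Split n => {q : (Fin n → Agent 𝒳 𝓑) × Agent 𝒳 𝓑 |
        E n σ q.1 k (cov q.2) ∉ Set.Ioo κ (1 - κ)}) (split n ω) := by
    intro k
    refine ae_heldOut hsample n (fun σ => fold σ k) (bad := fun σ : Split n =>
      {q : (Fin n → Agent 𝒳 𝓑) × Agent 𝒳 𝓑 | E n σ q.1 k (cov q.2) ∉ Set.Ioo κ (1 - κ)})
      (fun σ => ?_) (fun σ z z' a hz => ?_) ?_
    · exact (((hE.meas n σ k).comp (measurable_fst.prodMk (measurable_cov.comp measurable_snd)))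
        measurableSet_Ioo).compl
    · simp only [Set.mem_ofPred_eq, hE.dep n σ k z z' hz]
    · filter_upwards [hE.overlap n k] with ω hω
      filter_upwards [hω] with a ha hcon
      exact hcon ha
  filter_upwards [ae_all_iff.2 h] with ω hω i
  have := hω ((split n ω).1 i) i (Finset.mem_filter.2 ⟨Finset.mem_univ _, rfl⟩)
  simp only [not_not] at this
  exact Set.Ioo_subset_Icc_self this

end CrossFit

/-! ### Uniform error of the doubly-robust scores -/

section Score

variable {J : ℕ} {𝒳 𝓑 Ω : Type*} [MeasurableSpace 𝒳] [StandardBorelSpace 𝒳] [MeasurableSpace 𝓑]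
  [StandardBorelSpace 𝓑] [MeasurableSpace Ω]
  {P : Measure Ω} [IsProbabilityMeasure P] {Q : Measure (Agent 𝒳 𝓑)}
  [IsProbabilityMeasure Q] {Z : ℕ → Ω → Agent 𝒳 𝓑} {split : (n : ℕ) → Ω → Split n}
  {Rules R₀ : Set (Policy 𝒳)} {v : ℕ} {S₀ S U : Set (Vec J)}
  {E : (n : ℕ) → Split n → (Fin n → Agent 𝒳 𝓑) → Fin 3 → 𝒳 → ℝ}
  {R : (n : ℕ) → Split n → (Fin n → Agent 𝒳 𝓑) → Fin 3 → Bool → Vec J → 𝒳 → ℝ} {κ C ν K c : ℝ}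
  {f : 𝓑 → Vec J → ℝ} {m : Bool → 𝒳 → Vec J → ℝ} {e : 𝒳 → ℝ}

/-- The error of the average doubly-robust score at any cutoffs, with the regressions localized at
any other cutoffs, in terms of the errors of the nuisance estimates. -/
theorem boundedInProb_score (hsample : Sampling P Q Z split) (hR : RuleClass Rules R₀ v)
    (hS₀ : S₀.Countable) (hSS : S₀ ⊆ S) (hκ : 0 < κ) (hκ1 : κ ≤ 1 - κ) (hK : 0 ≤ K) (hν : 0 < ν)
    (hident : Identification Q e) (hE : PropEstimate P Q Z split E κ)
    (hreg : RegEstimate P Z split S₀ S R C ν K) (hf : ScalarOutcome Q S U f m K c)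
    (hsep : PointwiseSeparable S₀ S fun p b => f b p)
    (hcov : UniformCovering {g | ∃ p ∈ S, g = fun b => f b p} C ν) :
    BoundedInProb P fun n B ω => ∀ π ∈ Rules, ∀ p ∈ S, ∀ pt : Fin 3 → Vec J, (∀ k, pt k ∈ S) →
      ∀ ρμ ρe Δ : ℝ,
      (∀ k w, Real.sqrt (∫ a, (R n (split n ω) (fun i => Z i ω) k w (pt k) (cov a)
        - m w (cov a) (pt k)) ^ 2 ∂Q) ≤ ρμ) →
      (∀ k, Real.sqrt (∫ a, (E n (split n ω) (fun i => Z i ω) k (cov a) - e (cov a)) ^ 2 ∂Q)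
        ≤ ρe) →
      (∀ k w x, |m w x p - m w x (pt k)| ≤ Δ) →
      |scoreMean (split n ω) (fun i => Z i ω) (E n (split n ω) fun i => Z i ω)
          (fun k w => R n (split n ω) (fun i => Z i ω) k w (pt k)) (fun b => f b p) π
        - scalarMean Q f π p| ≤ B * (1 / Real.sqrt n) + 2 * (κ⁻¹ * (ρe * (Δ + ρμ))) := by
  have hgood : WithHighProb P fun n ω =>
      (∀ k, ∀ᵐ a ∂Q, E n (split n ω) (fun i => Z i ω) k (cov a) ∈ Set.Ioo κ (1 - κ)) ∧
      (∀ k w x, ∀ p ∈ S, |R n (split n ω) (fun i => Z i ω) k w p x| ≤ K) ∧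
      ∀ i : Fin n, E n (split n ω) (fun i => Z i ω) ((split n ω).1 i) (cov (Z i ω))
        ∈ Set.Icc κ (1 - κ) :=
    WithHighProb.of_ae fun n => by
      filter_upwards [ae_all_iff.2 (hE.overlap n), ae_all_iff.2 (hreg.bdd n),
        hE.ae_overlap hsample n] with ω h1 h2 h3
      exact ⟨h1, h2, h3⟩
  refine ((boundedInProb_scoreReg hsample hR hS₀ hSS hκ hκ1 hK hν hE hreg).and
    (boundedInProb_scoreIpw hsample hR hS₀ hSS hκ hκ1 hν hE hf.meas hf.bdd hsep hcov)).mono_high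
    hgood (fun n B B' hBB ω h π hπ p hp pt hpt ρμ ρe Δ h1 h2 h3 => ?_) fun B hB => ?_
  · exact (h π hπ p hp pt hpt ρμ ρe Δ h1 h2 h3).trans (by gcongr)
  refine ⟨12 * B, by positivity, ?_⟩
  filter_upwards [eventually_gt_atTop 0] with n hn ω ⟨hr, hi⟩ ⟨g1, g2, g3⟩ π hπ p hp pt hpt ρμ ρe Δ
    h1 h2 h3
  set z : Fin n → Agent 𝒳 𝓑 := fun i => Z i ω with hz
  set σ := split n ω with hσ
  -- On the good event truncation is inactive: for the regressions at every cutoff in S, for the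
  -- propensities at the held-out sample points and Q-almost everywhere. The score and the L₂ errors
  -- are thus those of the original estimates.
  have hmc : ∀ k w, (fun x => clip (-K) K (R n σ z k w (pt k) x)) = R n σ z k w (pt k) :=
    fun k w => funext fun x => clip_eq (abs_le.1 (g2 k w x _ (hpt k)))
  have hmr : ∀ k w, Measurable (R n σ z k w (pt k)) := fun k w =>
    (hreg.meas n σ k w _ (hpt k)).comp measurable_prodMk_left
  have hme : ∀ k, Measurable (E n σ z k) := fun k => (hE.meas n σ k).comp measurable_prodMk_left
  have hscore : scoreMean σ z (E n σ z) (fun k w => R n σ z k w (pt k)) (fun b => f b p) π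
      = scoreMean σ z (fun k x => clip κ (1 - κ) (E n σ z k x))
        (fun k w => R n σ z k w (pt k)) (fun b => f b p) π := by
    unfold scoreMean
    congr 1
    refine Finset.sum_congr rfl fun i _ => ?_
    change _ = _ + ipw _ _ (clip κ (1 - κ) (E n σ z (σ.1 i) (cov (Z i ω)))) * _
    rw [clip_eq (g3 i)]
  rw [hscore]
  have hdm : ∀ w, ∀ q ∈ S, Measurable fun x => m w x q := fun w => hf.meas_mean w
  refine abs_scoreMean_sub_le hf (hR.meas π hπ) hp hn σ z (B := B) (fun k w => ?_)
    (fun k w => hi k w π hπ p hp) fun k w => ?_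
  · have := hr k w π hπ (pt k) (hpt k)
    rwa [hmc] at this
  · refine doublyRobust_bias hident w (hR.meas π hπ) (m := fun x => m w x p)
      (m₀ := fun x => m w x (pt k)) ((continuous_clip _ _).measurable.comp (hme k)) (hmr k w)
      (hdm w p hp) (hdm w _ (hpt k)) hκ (fun x => clip_mem hκ1 _) (fun x => g2 k w x _ (hpt k))
      (hf.meas p hp) (hf.bdd p hp) (hf.condMean w p hp) (h3 k w) (h1 k w) ?_
    refine le_of_eq_of_le ?_ (h2 k)
    congr 1
    refine integral_congr_ae ?_
    filter_upwards [g1 k] with a ha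
    simp only [Function.comp]
    rw [clip_eq (Set.Ioo_subset_Icc_self ha)]

end Score

/-! ### The outcomes and the nuisance estimates of the market -/

section Instances

variable {J : ℕ} {𝒳 𝓑 Ω : Type*} [MeasurableSpace 𝒳] [MeasurableSpace 𝓑] [MeasurableSpace Ω]
  {P : Measure Ω} {Q : Measure (Agent 𝒳 𝓑)}
  {Z : ℕ → Ω → Agent 𝒳 𝓑} {split : (n : ℕ) → Ω → Split n} {M : Mechanism J 𝓑}
  {A : Estimators J 𝒳} {η : Nuisance J 𝒳} {c : Constants} {Rules : Set (Policy 𝒳)}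
  {pstar : Policy 𝒳 → Vec J} {κ K : ℝ}

theorem propEstimate_propHat (hmeas : Measurability P Z split M A η Rules)
    (hκ : ∀ n k, ∀ᵐ ω ∂P, ∀ᵐ a ∂Q,
      propHat A (split n ω) (fun i => Z i ω) k (cov a) ∈ Set.Ioo κ (1 - κ)) :
    PropEstimate P Q Z split (fun _ σ z k => propHat A σ z k) κ where
  meas n σ k := (hmeas.meas_prop _).comp
    (((measurable_subsample (halfG σ k) (measurable_cov.prodMk measurable_treat)).comp
      measurable_fst).prodMk measurable_snd)
  dep n σ k z z' h := by
    unfold propHat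
    rw [subsample_congr fun i hi => by rw [h i (notMem_fold_of_mem_halfG hi)]]
  overlap := hκ

theorem regEstimate_muYHat (hmeas : Measurability P Z split M A η Rules)
    (hcomp : NuisanceComplexity P Z split M A c) {S₀ : Set (Vec J)}
    (hsep : ∀ n k w, ∀ᵐ ω ∂P, PointwiseSeparable S₀ M.S
      (fun p x => muYHat M A (split n ω) (fun i => Z i ω) k w p x))
    (hK : ∀ n k, ∀ᵐ ω ∂P, ∀ w x, ∀ p ∈ M.S,
      |muYHat M A (split n ω) (fun i => Z i ω) k w p x| ≤ K) :
    RegEstimate P Z split S₀ M.S (fun _ σ z k w p => muYHat M A σ z k w p) c.C c.hy K where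
  meas n σ k w p hp := (hmeas.meas_regY _ w).comp
    (((measurable_subsample (halfG σ k) ((measurable_cov.prodMk measurable_treat).prodMk
      ((hmeas.meas_y p hp).comp measurable_obsBid))).comp measurable_fst).prodMk measurable_snd)
  dep n σ k z z' h := by
    funext w p
    unfold muYHat
    rw [subsample_congr fun i hi => by rw [h i (notMem_fold_of_mem_halfG hi)]]
  bdd := hK
  sep := hsep
  cover := hcomp.mono fun n ω h k w => (h k w).1

theorem regEstimate_muDHat (hmeas : Measurability P Z split M A η Rules)
    (hcomp : NuisanceComplexity P Z split M A c) {S₀ : Set (Vec J)} (j : Fin J)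
    (hsep : ∀ n k w, ∀ᵐ ω ∂P, PointwiseSeparable S₀ M.S
      (fun p x => muDHat M A (split n ω) (fun i => Z i ω) k w p x j))
    (hK : ∀ n k, ∀ᵐ ω ∂P, ∀ w x, ∀ p ∈ M.S,
      |muDHat M A (split n ω) (fun i => Z i ω) k w p x j| ≤ K) :
    RegEstimate P Z split S₀ M.S (fun _ σ z k w p x => muDHat M A σ z k w p x j) c.C c.hd K where
  meas n σ k w p hp := (EuclideanSpace.proj (𝕜 := ℝ) j).measurable.comp
    ((hmeas.meas_regD _ w).comp
    (((measurable_subsample (halfG σ k) ((measurable_cov.prodMk measurable_treat).prodMk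
      ((hmeas.meas_d p hp).comp measurable_obsBid))).comp measurable_fst).prodMk measurable_snd))
  dep n σ k z z' h := by
    funext w p x
    unfold muDHat
    rw [subsample_congr fun i hi => by rw [h i (notMem_fold_of_mem_halfG hi)]]
  bdd := hK
  sep := hsep
  cover := hcomp.mono fun n ω h k w => (h k w).2 j

variable [IsProbabilityMeasure Q]

theorem RegularOutcomes.exists_scalarOutcome (hmeas : Measurability P Z split M A η Rules)
    (hout : RegularOutcomes Q M η c pstar Rules)
    (hK : ∀ b, ∀ p ∈ M.S, |M.y b p| ≤ K ∧ ‖M.d b p‖ ≤ K) :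
    ∃ U, ScalarOutcome Q M.S U M.y η.muY K c.cDeriv ∧
      ∀ j, ScalarOutcome Q M.S U (fun b p => M.d b p j) (fun w x p => η.muD w x p j) K c.cDeriv := by
  obtain ⟨U, hU, hSU, hs⟩ := hout.smooth
  refine ⟨U, ⟨hmeas.meas_y, fun p hp b => (hK b p hp).1, hmeas.meas_muY, hout.condMean_y, hU, hSU,
    fun w x => ⟨(hs w x).1.1, fun p hp => ((hs w x).1.2 p hp).1,
      fun p hp => ((hs w x).1.2 p hp).2⟩⟩, fun j => ⟨fun p hp =>
      (EuclideanSpace.proj (𝕜 := ℝ) j).measurable.comp (hmeas.meas_d p hp), fun p hp b =>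
      (abs_apply_le_norm _ _).trans (hK b p hp).2, fun w p hp =>
      (EuclideanSpace.proj (𝕜 := ℝ) j).measurable.comp (hmeas.meas_muD w p hp), fun w p hp => ?_,
      hU, hSU, fun w x => ⟨((hs w x).2 j).1, fun p hp => (((hs w x).2 j).2 p hp).1,
        fun p hp => (((hs w x).2 j).2 p hp).2⟩⟩⟩
  have hint : Integrable (fun a : Agent 𝒳 𝓑 => M.d (bid a w) p) Q :=
    Integrable.of_bound ((hmeas.meas_d p hp).comp (measurable_bid w)).aestronglyMeasurable K
      (ae_of_all _ fun a => (hK _ p hp).2)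
  have h1 := (EuclideanSpace.proj (𝕜 := ℝ) j : Vec J →L[ℝ] ℝ).comp_condExp_comm hint
    (m := covSigma 𝒳 𝓑)
  refine h1.symm.trans ?_
  filter_upwards [hout.condMean_d w p hp] with a ha
  simp only [Function.comp]
  rw [ha]
  rfl

theorem excessDemand_apply (hmeas : Measurability P Z split M A η Rules)
    (hK : ∀ b, ∀ p ∈ M.S, |M.y b p| ≤ K ∧ ‖M.d b p‖ ≤ K) {π : Policy 𝒳} (hπ : Measurable π)
    {p : Vec J} (hp : p ∈ M.S) (j : Fin J) :
    excessDemand M Q π p j = scalarMean Q (fun b p => M.d b p j) π p - M.capacity j := by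
  have e : (fun a : Agent 𝒳 𝓑 => ind (π (cov a)) • M.d (bid a true) p
      + (1 - ind (π (cov a))) • M.d (bid a false) p) = fun a => M.d (bid a (π (cov a))) p := by
    funext a
    cases h : π (cov a) <;> simp [ind]
  have e2 : (fun a : Agent 𝒳 𝓑 => M.d (bid a (π (cov a))) p)
      = fun a => if π (cov a) = true then M.d (bid a true) p else M.d (bid a false) p := by
    funext a; cases π (cov a) <;> rfl
  have hint : Integrable (fun a : Agent 𝒳 𝓑 => M.d (bid a (π (cov a))) p) Q := by
    refine Integrable.of_bound (C := K) ?_ (ae_of_all _ fun a => (hK _ p hp).2)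
    rw [e2]
    exact (Measurable.ite ((hπ.comp measurable_cov) (measurableSet_singleton true))
      ((hmeas.meas_d p hp).comp (measurable_bid true))
      ((hmeas.meas_d p hp).comp (measurable_bid false))).aestronglyMeasurable
  have h := (EuclideanSpace.proj (𝕜 := ℝ) j : Vec J →L[ℝ] ℝ).integral_comp_comm hint
  rw [excessDemand, e, PiLp.sub_apply]
  exact congrArg (· - M.capacity j) h.symm

/-- Near-zeros of the excess demand are close to the continuum cutoffs. -/
theorem norm_sub_le_excessDemand (hc : c.Positive) (hmeas : Measurability P Z split M A η Rules)
    (hout : RegularOutcomes Q M η c pstar Rules) (heq : RegularEquilibrium Q M c pstar Rules)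
    {π : Policy 𝒳} (hπ : π ∈ Rules) {p : Vec J} (hp : p ∈ M.S)
    (hz : 2 * ‖excessDemand M Q π p‖ < c.c2) :
    c.c3 / 2 * ‖p - pstar π‖ ≤ ‖excessDemand M Q π p‖ := by
  obtain ⟨K, hK⟩ := hout.bounded
  obtain ⟨U, -, hd⟩ := hout.exists_scalarOutcome hmeas hK
  -- For J = 0 the radius c₃/(2Jc') is zero by the division convention, but the cutoff space is a
  -- single point.
  rcases Nat.eq_zero_or_pos J with rfl | hJ
  · rw [Subsingleton.elim p (pstar π), sub_self, norm_zero, mul_zero]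
    exact norm_nonneg _
  -- Separation places p inside exactly the radius where the linear growth bound is valid.
  have hlt : ‖p - pstar π‖ < c.c3 / (2 * J * c.cDeriv) := by
    by_contra hcon
    exact absurd (heq.separated π hπ p hp (not_lt.1 hcon)) (not_le.2 hz)
  have hq : pstar π ∈ M.S := heq.ball_subset π hπ (Metric.mem_ball_self hc.c1)
  have hm := hmeas.meas_rule π hπ
  refine norm_ge_of_secants hJ hc.cDeriv hc.c1 hc.c3 (heq.clears π hπ)
    (fun i hi => (hout.jacobian π hπ i hi).1) (heq.ball_subset π hπ) (fun t ht htS j => ?_) hlt.le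
  have := abs_scalarMean_secant_le (hd j) hc.cDeriv.le hm hp hq ht htS
  rw [excessDemand_apply hmeas hK hm hp, excessDemand_apply hmeas hK hm hq,
    excessDemand_apply hmeas hK hm htS, sub_sub_sub_cancel_right, sub_sub_sub_cancel_right]
  exact this

end Instances

/-! ### The estimators as doubly-robust scores -/

section Identities

variable {J : ℕ} {𝒳 𝓑 : Type*} (M : Mechanism J 𝓑) (A : Estimators J 𝒳) {n : ℕ} (σ : Split n)
  (z : Fin n → Agent 𝒳 𝓑) (π : Policy 𝒳)

theorem valueHat_eq : valueHat M A σ z π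
    = scoreMean σ z (propHat A σ z) (fun k w => muYHat M A σ z k w (cutoffTilde M A σ z k π))
      (fun b => M.y b (cutoffHat M A σ z π)) π := by
  unfold valueHat scoreMean
  congr 1
  refine Finset.sum_congr rfl fun i _ => ?_
  cases h : π (cov (z i)) <;> simp [ind, scoreY, muYAt, propAt]

theorem excessDemandHat_apply (p : Vec J) (j : Fin J) : excessDemandHat M A σ z π p j
    = scoreMean σ z (propHat A σ z)
      (fun k w x => muDHat M A σ z k w (cutoffTilde M A σ z k π) x j) (fun b => M.d b p j) π
      - M.capacity j := by
  simp only [excessDemandHat, scoreMean, PiLp.sub_apply, PiLp.smul_apply, WithLp.ofLp_sum,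
    Finset.sum_apply, smul_eq_mul]
  congr 2
  refine Finset.sum_congr rfl fun i _ => ?_
  cases h : π (cov (z i)) <;> simp [ind, scoreD, muDAt, propAt]

/-- A deterministic rule generates one treatment vector. -/
theorem policyExpectation_eq (f : (Fin n → Bool) → ℝ) :
    policyExpectation π z f = f fun i => π (cov (z i)) := by
  have h : ∀ b w, bern (ind b) w = if w = b then 1 else 0 := by
    intro b w; cases b <;> cases w <;> simp [bern, ind]
  rw [policyExpectation, Finset.sum_eq_single fun i => π (cov (z i))]
  · simp [h]
  · intro w _ hw
    obtain ⟨i, hi⟩ := Function.ne_iff.1 hw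
    rw [Finset.prod_eq_zero (Finset.mem_univ i) (by rw [h, if_neg hi]), zero_mul]
  · simp

end Identities

/-! ### Uniform rates for cutoffs and values -/

section Rates

variable {J : ℕ} {𝒳 𝓑 Ω : Type*} [MeasurableSpace 𝒳] [MeasurableSpace 𝓑] [MeasurableSpace Ω]
  {P : Measure Ω} {Q : Measure (Agent 𝒳 𝓑)}
  {Z : ℕ → Ω → Agent 𝒳 𝓑} {split : (n : ℕ) → Ω → Split n} {M : Mechanism J 𝓑}
  {A : Estimators J 𝒳} {η : Nuisance J 𝒳} {c : Constants} {Rules : Set (Policy 𝒳)} {v : ℕ}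
  {pstar : Policy 𝒳 → Vec J}

theorem tendsto_one_div_sqrt : Tendsto (fun n : ℕ => 1 / Real.sqrt n) atTop (𝓝 0) :=
  tendsto_const_nhds.div_atTop (Real.tendsto_sqrt_atTop.comp tendsto_natCast_atTop_atTop)

theorem eventually_le_one_div_sqrt {a : ℕ → ℝ}
    (h : Tendsto (fun n : ℕ => Real.sqrt n * a n) atTop (𝓝 0)) :
    ∀ᶠ n : ℕ in atTop, a n ≤ 1 / Real.sqrt n := by
  filter_upwards [h.eventually (eventually_le_nhds zero_lt_one), eventually_gt_atTop 0] with n h hn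
  rw [le_div_iff₀ (Real.sqrt_pos.2 (by exact_mod_cast hn)), mul_comm]
  exact h

theorem HasVCDim.ruleClass (hVC : HasVCDim Rules v) (hmeas : Measurability P Z split M A η Rules) :
    ∃ R₀, RuleClass Rules R₀ v := by
  obtain ⟨R₀, h1, h2, h3⟩ := hmeas.separable_rules
  exact ⟨R₀, fun s hs => hVC.2 ⟨s, rfl, hs⟩, h1, h2, hmeas.meas_rule, h3⟩

variable [IsProbabilityMeasure P] [IsProbabilityMeasure Q]

/-- The mechanism clears empirical demand up to o(1/√n), and empirical demand is uniformly within
O(1/√n) of its mean, so z_π is O(1/√n) at the market cutoffs. The distance to p*_π follows from the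
growth of z_π, and the value error is a sampling error plus the Lipschitz constant times this
distance. -/
theorem boundedInProb_finiteMarket (hc : c.Positive) (hsample : Sampling P Q Z split)
    (hmeas : Measurability P Z split M A η Rules) (hclear : ClearsFiniteMarkets P Z M Rules)
    (hout : RegularOutcomes Q M η c pstar Rules) (heq : RegularEquilibrium Q M c pstar Rules)
    (hVC : HasVCDim Rules v) :
    BoundedInProb P fun n B ω => ∀ π ∈ Rules,
      ‖finiteCutoff M (fun i : Fin n => Z i ω) (fun i => π (cov (Z i ω))) - pstar π‖
        ≤ B * (1 / Real.sqrt n) ∧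
      |finiteValue M (fun i : Fin n => Z i ω) π - contValue M Q pstar π|
        ≤ B * (1 / Real.sqrt n) := by
  obtain ⟨R₀, hR⟩ := hVC.ruleClass hmeas
  obtain ⟨S₀, hS₀, hSS, hsy, hsd, -⟩ := hmeas.separable_cutoffs
  obtain ⟨K, hK⟩ := hout.bounded
  obtain ⟨U, hy, hd⟩ := hout.exists_scalarOutcome hmeas hK
  obtain ⟨a, ha, hne, hsel⟩ := hclear.clears
  have c3 := hc.c3
  have cD := hc.cDeriv
  refine ((boundedInProb_population hsample hR hS₀ hSS hc.hy hy.meas hy.bdd hsy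
    hout.covering_y).and (BoundedInProb.forall_finite fun j =>
      boundedInProb_population hsample hR hS₀ hSS hc.hd (hd j).meas (hd j).bdd (hsd j)
        (hout.covering_d j))).mono_high hne (fun n B B' hB ω h π hπ => ?_) fun B hB => ?_
  · obtain ⟨h1, h2⟩ := h π hπ
    exact ⟨h1.trans (by gcongr), h2.trans (by gcongr)⟩
  -- The bound (1 + 2JB)/√n on excess demand, divided by its growth rate c₃/2.
  set K₁ : ℝ := 2 / c.c3 * (1 + J * (2 * B)) with hK₁
  have hK₁0 : 0 < K₁ := by positivity
  refine ⟨K₁ + (2 * B + c.cDeriv * K₁), by positivity, ?_⟩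
  have hlim : Tendsto (fun n : ℕ => 2 * ((1 + J * (2 * B)) * (1 / Real.sqrt n))) atTop (𝓝 0) := by
    simpa using (tendsto_one_div_sqrt.const_mul (1 + J * (2 * B))).const_mul 2
  filter_upwards [eventually_gt_atTop 0, eventually_le_one_div_sqrt (a := a) (by simpa [mul_comm] using ha),
    hlim.eventually (eventually_lt_nhds hc.c2)] with n hn han hsmall ω ⟨hdy, hdd⟩ hne π hπ
  set z : Fin n → Agent 𝒳 𝓑 := fun i => Z i ω with hz
  set w : Fin n → Bool := fun i => π (cov (Z i ω)) with hw
  set p := finiteCutoff M z w with hp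
  set s := 1 / Real.sqrt n with hs
  have hs0 : 0 ≤ s := by positivity
  have hpS : p ∈ M.S := hclear.cutoff_mem _ _ _ _
  have hqS : pstar π ∈ M.S := heq.ball_subset π hπ (Metric.mem_ball_self hc.c1)
  have hm := hmeas.meas_rule π hπ
  have hcl : ‖(1 / (n : ℝ)) • ∑ i, M.d (bid (z i) (w i)) p - M.capacity‖ ≤ a n :=
    hsel n ω w (hne π hπ)
  have hdiff : ‖excessDemand M Q π p - ((1 / (n : ℝ)) • ∑ i, M.d (bid (z i) (w i)) p - M.capacity)‖
      ≤ J * (2 * B * s) := by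
    refine norm_le_of_abs_apply_le fun j => ?_
    have h := abs_sampleMean_sub_le (hd j) hm hpS hn z fun w => hdd j w π hπ p hpS
    rw [abs_sub_comm] at h
    rw [PiLp.sub_apply, excessDemand_apply hmeas hK hm hpS, PiLp.sub_apply, sub_sub_sub_cancel_right,
      PiLp.smul_apply, WithLp.ofLp_sum, Finset.sum_apply, smul_eq_mul]
    exact h
  have hzn : ‖excessDemand M Q π p‖ ≤ (1 + J * (2 * B)) * s := by
    have := norm_add_le (excessDemand M Q π p
      - ((1 / (n : ℝ)) • ∑ i, M.d (bid (z i) (w i)) p - M.capacity))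
      ((1 / (n : ℝ)) • ∑ i, M.d (bid (z i) (w i)) p - M.capacity)
    rw [sub_add_cancel] at this
    linarith
  have hr : ‖p - pstar π‖ ≤ K₁ * s := by
    have h1 := norm_sub_le_excessDemand hc hmeas hout heq hπ hpS (by linarith)
    have h2 : c.c3 / 2 * (K₁ * s) = (1 + J * (2 * B)) * s := by rw [hK₁]; field_simp
    refine le_of_mul_le_mul_left (a := c.c3 / 2) ?_ (by positivity)
    linarith
  have hB2 : 0 ≤ (2 * B + c.cDeriv * K₁) * s := by positivity
  refine ⟨by linarith, ?_⟩
  have h1 := abs_sampleMean_sub_le hy hm hpS hn z fun w => hdy w π hπ p hpS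
  have h2 := abs_scalarMean_sub_le hy hm hpS hqS
  have h3 : finiteValue M z π = (1 / (n : ℝ)) * ∑ i, M.y (bid (z i) (π (cov (z i)))) p := by
    rw [finiteValue, policyExpectation_eq]
    rfl
  have h4 : c.cDeriv * ‖p - pstar π‖ ≤ c.cDeriv * (K₁ * s) := by gcongr
  have h5 : 0 ≤ K₁ * s := by positivity
  rw [h3, contValue, meanOutcome_eq]
  refine (abs_sub_le _ (scalarMean Q M.y π p) _).trans ?_
  linarith

theorem sqrt_integral_sq_le {α : Type*} [MeasurableSpace α] {μ : Measure α} {u g : α → ℝ}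
    (hg : Integrable g μ) (h : ∀ x, u x ^ 2 ≤ g x) :
    Real.sqrt (∫ a, u a ^ 2 ∂μ) ≤ Real.sqrt (∫ a, g a ∂μ) :=
  Real.sqrt_le_sqrt (integral_mono_of_nonneg (ae_of_all _ fun _ => sq_nonneg _) hg
    (ae_of_all _ h))

/-- The stacked regression error is integrable. -/
theorem integrable_stacked {S U : Set (Vec J)} {f : 𝓑 → Vec J → ℝ} {m : Bool → 𝒳 → Vec J → ℝ}
    {D : 𝓑 → Vec J → Vec J} {mD : Bool → 𝒳 → Vec J → Vec J} {K b : ℝ}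
    (hy : ScalarOutcome Q S U f m K b)
    (hd : ∀ j, ScalarOutcome Q S U (fun b p => D b p j) (fun w x p => mD w x p j) K b)
    {p : Vec J} (hp : p ∈ S) (w : Bool) {g : 𝒳 → ℝ} {G : 𝒳 → Vec J} (hg : Measurable g)
    (hG : ∀ j, Measurable fun x => G x j) (hgK : ∀ x, |g x| ≤ K) (hGK : ∀ x j, |G x j| ≤ K) :
    Integrable (fun a : Agent 𝒳 𝓑 => (g (cov a) - m w (cov a) p) ^ 2
      + ‖G (cov a) - mD w (cov a) p‖ ^ 2) Q := by
  have hGm : ∀ j, Measurable fun a : Agent 𝒳 𝓑 => (G (cov a) - mD w (cov a) p) j := fun j =>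
    ((hG j).comp measurable_cov).sub (((hd j).meas_mean w p hp).comp measurable_cov)
  have hsq : ∀ a : Agent 𝒳 𝓑, ‖G (cov a) - mD w (cov a) p‖ ^ 2
      = ∑ j, ((G (cov a) - mD w (cov a) p) j) ^ 2 := fun a => EuclideanSpace.real_norm_sq_eq _
  simp only [hsq]
  have aux : ∀ {u : Agent 𝒳 𝓑 → ℝ}, Measurable u → (∀ᵐ a ∂Q, |u a| ≤ 2 * K) →
      Integrable (fun a => u a ^ 2) Q := by
    intro u hu hb
    refine Integrable.of_bound (C := (2 * K) ^ 2) (hu.pow_const 2).aestronglyMeasurable ?_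
    filter_upwards [hb] with a ha
    rw [Real.norm_eq_abs, abs_pow]
    exact pow_le_pow_left₀ (abs_nonneg _) ha 2
  refine Integrable.add (aux ((hg.comp measurable_cov).sub
    ((hy.meas_mean w p hp).comp measurable_cov)) ?_)
    (integrable_finsetSum _ fun j _ => aux (hGm j) ?_)
  · filter_upwards [condMean_abs_le (m := fun x => m w x p) (hy.condMean w p hp)
      fun a => hy.bdd p hp _] with a ha
    have := (abs_sub (g (cov a)) (m w (cov a) p)).trans (add_le_add (hgK _) ha)
    linarith
  · filter_upwards [condMean_abs_le (m := fun x => mD w x p j) ((hd j).condMean w p hp)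
      fun a => (hd j).bdd p hp _] with a ha
    have := (abs_sub (G (cov a) j) (mD w (cov a) p j)).trans (add_le_add (hGK _ j) ha)
    rw [PiLp.sub_apply]
    linarith

variable [StandardBorelSpace 𝒳] [StandardBorelSpace 𝓑]

/-- The finite-market argument with doubly-robust scores, made in two passes because the bias
contains the unknown distance r from P̂ to p*. First r is bounded by the diameter of S, which with
ρ_e → 0 makes z_π small enough for the growth bound to apply; then the term in ρ_e r is absorbed
into that bound. -/
theorem boundedInProb_estimators (hc : c.Positive) (hsample : Sampling P Q Z split)
    (hmeas : Measurability P Z split M A η Rules) (hident : Identification Q η.e)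
    (hclear : ClearsFiniteMarkets P Z M Rules)
    (hout : RegularOutcomes Q M η c pstar Rules) (heq : RegularEquilibrium Q M c pstar Rules)
    (hnuis : NuisanceRates P Q Z split M A η pstar Rules)
    (hcomp : NuisanceComplexity P Z split M A c) (hVC : HasVCDim Rules v) :
    BoundedInProb P fun n B ω => ∀ π ∈ Rules,
      ‖cutoffHat M A (split n ω) (fun i : Fin n => Z i ω) π - pstar π‖ ≤ B * (1 / Real.sqrt n) ∧
      |valueHat M A (split n ω) (fun i : Fin n => Z i ω) π - contValue M Q pstar π|
        ≤ B * (1 / Real.sqrt n) := by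
  obtain ⟨R₀, hR⟩ := hVC.ruleClass hmeas
  obtain ⟨S₀, hS₀, hSS, hsy, hsd, hsep⟩ := hmeas.separable_cutoffs
  obtain ⟨K₀, hK₀⟩ := hout.bounded
  obtain ⟨K₂, hK₂⟩ := hnuis.bounded
  obtain ⟨κ, hκ, hover⟩ := hnuis.overlap
  obtain ⟨ρμ, ρe, ρθ, hρe, -, hρ0, hρμ, hρθ, hrates⟩ := hnuis.rates
  obtain ⟨ρg, hρg, hclearing⟩ := hnuis.clearing
  obtain ⟨D, hD⟩ := Metric.isBounded_iff.1 heq.compact.isBounded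
  set K := max 0 (max K₀ K₂)
  have hK0 : 0 ≤ K := le_max_left _ _
  have hK : ∀ b, ∀ p ∈ M.S, |M.y b p| ≤ K ∧ ‖M.d b p‖ ≤ K := fun b p hp =>
    ⟨(hK₀ b p hp).1.trans ((le_max_left _ _).trans (le_max_right _ _)),
      (hK₀ b p hp).2.trans ((le_max_left _ _).trans (le_max_right _ _))⟩
  have hK2 : ∀ n k, ∀ᵐ ω ∂P, ∀ w x, ∀ p ∈ M.S,
      |muYHat M A (split n ω) (fun i => Z i ω) k w p x| ≤ K ∧
      ∀ j, |muDHat M A (split n ω) (fun i => Z i ω) k w p x j| ≤ K := fun n k => by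
    filter_upwards [hK₂ n k] with ω h w x p hp
    exact ⟨(h w x p hp).1.trans ((le_max_right _ _).trans (le_max_right _ _)),
      fun j => ((h w x p hp).2 j).trans ((le_max_right _ _).trans (le_max_right _ _))⟩
  have hκ1 : κ ≤ 1 - κ := by
    obtain ⟨ω, hω⟩ := (hover 0 0).exists
    obtain ⟨a, ha⟩ := hω.exists
    exact (ha.1.trans ha.2).le
  obtain ⟨U, hy, hd⟩ := hout.exists_scalarOutcome hmeas hK
  have hE := propEstimate_propHat hmeas hover
  have hregY : RegEstimate P Z split S₀ M.S (fun _ σ z k w p => muYHat M A σ z k w p) c.C c.hy K :=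
    regEstimate_muYHat hmeas hcomp (fun n k w => (hsep n k w).mono fun ω h => h.1)
      fun n k => (hK2 n k).mono fun ω h w x p hp => (h w x p hp).1
  have hregD : ∀ j, RegEstimate P Z split S₀ M.S
      (fun _ σ z k w p x => muDHat M A σ z k w p x j) c.C c.hd K := fun j =>
    regEstimate_muDHat hmeas hcomp j (fun n k w => (hsep n k w).mono fun ω h => h.2 j)
      fun n k => (hK2 n k).mono fun ω h w x p hp => (h w x p hp).2 j
  have hgood := (hrates.and hclearing).and
    (WithHighProb.of_ae fun n => ae_all_iff.2 (hK2 n))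
  have c3 := hc.c3
  have cD := hc.cDeriv
  have hκi : 0 < κ⁻¹ := inv_pos.2 hκ
  refine ((boundedInProb_score hsample hR hS₀ hSS hκ hκ1 hK0 hc.hy hident hE hregY hy hsy
    hout.covering_y).and (BoundedInProb.forall_finite fun j => boundedInProb_score hsample hR hS₀
      hSS hκ hκ1 hK0 hc.hd hident hE (hregD j) (hd j) (hsd j) (hout.covering_d j))).mono_high hgood
    (fun n B B' hB ω h π hπ => ?_) fun B hB => ?_
  · obtain ⟨h1, h2⟩ := h π hπ
    exact ⟨h1.trans (by gcongr), h2.trans (by gcongr)⟩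
  -- The growth rate is c₃/2; absorbing the bias term in ρ_e r costs half of it, which leaves c₃/4.
  set K₁ : ℝ := 4 / c.c3 * (1 + J * (B + 2 * (κ⁻¹ * (c.cDeriv + 1)))) with hK₁
  have hK₁0 : 0 < K₁ := by positivity
  set K₃ : ℝ := B + 2 * (κ⁻¹ * (c.cDeriv * K₁ + c.cDeriv + 1)) + c.cDeriv * K₁ with hK₃
  have hK₃0 : 0 < K₃ := by positivity
  refine ⟨K₁ + K₃, by positivity, ?_⟩
  have hlim : Tendsto (fun n : ℕ => 2 * (1 / Real.sqrt n + J * (B * (1 / Real.sqrt n)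
      + 2 * (κ⁻¹ * (c.cDeriv * (ρe n * D + 1 / Real.sqrt n) + 1 / Real.sqrt n))))) atTop (𝓝 0) := by
    have h := tendsto_one_div_sqrt
    have := (h.add (((h.const_mul B).add (((((((hρe.mul_const D).add h).const_mul
      c.cDeriv).add h).const_mul κ⁻¹).const_mul 2))).const_mul (J : ℝ))).const_mul 2
    simpa using this
  have hlim2 : Tendsto (fun n : ℕ => J * (2 * (κ⁻¹ * (c.cDeriv * ρe n)))) atTop (𝓝 0) := by
    simpa using (((hρe.const_mul c.cDeriv).const_mul κ⁻¹).const_mul 2).const_mul (J : ℝ)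
  filter_upwards [eventually_gt_atTop 0, eventually_le_one_div_sqrt hρμ,
    eventually_le_one_div_sqrt hρθ, eventually_le_one_div_sqrt hρg,
    hlim.eventually (eventually_lt_nhds hc.c2),
    hlim2.eventually (eventually_le_nhds (by positivity : 0 < c.c3 / 4)),
    hρe.eventually (eventually_le_nhds zero_lt_one)]
    with n hn hμn hθn hgn hsmall hsmall2 he1 ω ⟨hsY, hsD⟩ ⟨⟨hrate, hclr⟩, hbd⟩ π hπ
  set z : Fin n → Agent 𝒳 𝓑 := fun i => Z i ω with hz
  set σ := split n ω with hσ
  set p := cutoffHat M A σ z π with hp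
  set pt : Fin 3 → Vec J := fun k => cutoffTilde M A σ z k π with hpt
  set s := 1 / Real.sqrt n with hs
  set r := ‖p - pstar π‖ with hr
  have hs0 : 0 ≤ s := by positivity
  have hr0 : 0 ≤ r := norm_nonneg _
  have hpS : p ∈ M.S := hclear.cutoff_mem _ _ _ _
  have hptS : ∀ k, pt k ∈ M.S := fun k => hclear.cutoff_mem _ _ _ _
  have hqS : pstar π ∈ M.S := heq.ball_subset π hπ (Metric.mem_ball_self hc.c1)
  have hm := hmeas.meas_rule π hπ
  obtain ⟨-, he0, hθ0⟩ := hρ0 n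
  have hdist : ∀ k, ‖p - pt k‖ ≤ r + ρθ n := fun k => by
    have h1 := norm_sub_le_norm_sub_add_norm_sub p (pstar π) (pt k)
    have h2 := (hrate k π hπ).2.2
    rw [norm_sub_rev] at h2
    exact h1.trans (add_le_add_right h2 r)
  -- Needed to bound each component's error by the stacked one: without integrability the stacked
  -- integral would be zero by convention.
  have hint : ∀ k w, Integrable (fun a : Agent 𝒳 𝓑 =>
      (muYHat M A σ z k w (pt k) (cov a) - η.muY w (cov a) (pt k)) ^ 2
      + ‖muDHat M A σ z k w (pt k) (cov a) - η.muD w (cov a) (pt k)‖ ^ 2) Q := fun k w =>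
    integrable_stacked hy hd (hptS k) w
      ((hregY.meas n σ k w _ (hptS k)).comp measurable_prodMk_left)
      (fun j => ((hregD j).meas n σ k w _ (hptS k)).comp measurable_prodMk_left)
      (fun x => (hbd k w x _ (hptS k)).1) fun x => (hbd k w x _ (hptS k)).2
  -- The bias of the two arms, with the Lipschitz bound at distance r + ρ_θ between P̂ and the
  -- localization cutoffs in place of Δ.
  set β := 2 * (κ⁻¹ * (ρe n * (c.cDeriv * (r + ρθ n) + ρμ n))) with hβ
  have hY : |valueHat M A σ z π - scalarMean Q M.y π p| ≤ B * s + β := by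
    rw [valueHat_eq]
    refine hsY π hπ p hpS pt hptS (ρμ n) (ρe n) (c.cDeriv * (r + ρθ n)) (fun k w => ?_)
      (fun k => (hrate k π hπ).2.1) fun k w x => ?_
    · exact (sqrt_integral_sq_le (hint k w) fun _ =>
        le_add_of_nonneg_right (sq_nonneg _)).trans ((hrate k π hπ).1 w)
    · exact ((hy.smooth w x).abs_sub_le hy.isOpen hy.hull hpS (hptS k)).trans
        (by gcongr; exact hdist k)
  have hDj : ‖excessDemand M Q π p - excessDemandHat M A σ z π p‖ ≤ J * (B * s + β) := by
    refine norm_le_of_abs_apply_le fun j => ?_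
    rw [PiLp.sub_apply, excessDemand_apply hmeas hK hm hpS, excessDemandHat_apply,
      sub_sub_sub_cancel_right, abs_sub_comm]
    refine hsD j π hπ p hpS pt hptS (ρμ n) (ρe n) (c.cDeriv * (r + ρθ n)) (fun k w => ?_)
      (fun k => (hrate k π hπ).2.1) fun k w x => ?_
    · refine (sqrt_integral_sq_le (hint k w) fun a => ?_).trans ((hrate k π hπ).1 w)
      refine le_add_of_nonneg_of_le (sq_nonneg _) ?_
      have := abs_apply_le_norm
        (muDHat M A σ z k w (pt k) (cov a) - η.muD w (cov a) (pt k)) j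
      rw [PiLp.sub_apply] at this
      rw [← sq_abs]
      exact pow_le_pow_left₀ (abs_nonneg _) this 2
    · exact (((hd j).smooth w x).abs_sub_le hy.isOpen hy.hull hpS (hptS k)).trans
        (by gcongr; exact hdist k)
  have hβs : β ≤ 2 * (κ⁻¹ * (c.cDeriv * (ρe n * r + s) + s)) := by
    rw [hβ]
    have : ρe n * (c.cDeriv * (r + ρθ n) + ρμ n)
        = c.cDeriv * (ρe n * r + ρe n * ρθ n) + ρe n * ρμ n := by ring
    rw [this]
    gcongr
  have hzn : ‖excessDemand M Q π p‖
      ≤ s + J * (B * s + 2 * (κ⁻¹ * (c.cDeriv * (ρe n * r + s) + s))) := by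
    have h1 := norm_add_le (excessDemand M Q π p - excessDemandHat M A σ z π p)
      (excessDemandHat M A σ z π p)
    rw [sub_add_cancel] at h1
    have h2 := (hclr π hπ).trans hgn
    have h3 : J * (B * s + β)
        ≤ J * (B * s + 2 * (κ⁻¹ * (c.cDeriv * (ρe n * r + s) + s))) := by gcongr
    linarith
  have hrD : r ≤ D := by rw [hr, ← dist_eq_norm]; exact hD hpS hqS
  -- The crude bound r ≤ D is enough here, since it only has to beat a fixed constant.
  have hzs : 2 * ‖excessDemand M Q π p‖ < c.c2 := by
    refine lt_of_le_of_lt ?_ hsmall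
    refine mul_le_mul_of_nonneg_left (hzn.trans ?_) zero_le_two
    gcongr
  -- The coefficient of r on the right is at most c₃/4 by `hsmall2` and is subtracted from c₃/2 on
  -- the left.
  have hrs : r ≤ K₁ * s := by
    have h1 := norm_sub_le_excessDemand hc hmeas hout heq hπ hpS hzs
    have h2 : c.c3 / 4 * (K₁ * s) = (1 + J * (B + 2 * (κ⁻¹ * (c.cDeriv + 1)))) * s := by
      rw [hK₁]; field_simp
    have h3 := mul_le_mul_of_nonneg_right hsmall2 hr0
    refine le_of_mul_le_mul_left (a := c.c3 / 4) ?_ (by positivity)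
    rw [h2]
    linear_combination h1 + hzn + h3
  have h1 : 0 ≤ K₃ * s := by positivity
  have h2 : 0 ≤ K₁ * s := by positivity
  refine ⟨by linarith, ?_⟩
  rw [contValue, meanOutcome_eq]
  have h3 := abs_scalarMean_sub_le hy hm hpS hqS
  have h4 : c.cDeriv * r ≤ c.cDeriv * (K₁ * s) := by gcongr
  have h5 : ρe n * r ≤ K₁ * s := by
    calc ρe n * r ≤ 1 * r := by gcongr
      _ ≤ K₁ * s := by linarith
  have h6 : 2 * (κ⁻¹ * (c.cDeriv * (ρe n * r + s) + s))
      ≤ 2 * (κ⁻¹ * (c.cDeriv * (K₁ * s + s) + s)) := by gcongr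
  have h7 : (K₁ + K₃) * s = K₁ * s + (B * s + 2 * (κ⁻¹ * (c.cDeriv * (K₁ * s + s) + s))
      + c.cDeriv * (K₁ * s)) := by rw [hK₃]; ring
  refine (abs_sub_le _ (scalarMean Q M.y π p) _).trans ?_
  rw [h7]
  linarith

end Rates

/-! ### Regret -/

section Regret

theorem BoundedInProb.isBigOP {Ω : Type*} [MeasurableSpace Ω] {P : Measure Ω}
    {E : ℕ → ℝ → Ω → Prop} (hE : BoundedInProb P E) {R : ℕ → Ω → ℝ} {r : ℕ → ℝ} {a : ℝ}
    (ha : 0 < a) (h : ∀ n B ω, 0 < B → E n B ω → |R n ω| ≤ a * (B * r n)) : IsBigOP P R r := by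
  intro ε hε
  obtain ⟨B, hB, hev⟩ := hE.2 ε hε
  refine ⟨a * B, by positivity, hev.mono fun n hn => le_trans (measure_mono fun ω hω => ?_) hn⟩
  intro hcon
  have h1 := h n B ω hB hcon
  rw [← mul_assoc] at h1
  exact absurd hω (not_lt.2 h1)

/-- The regret of an approximate maximizer. -/
theorem abs_sub_iSup_le {α : Type*} {s : Set α} {f : α → ℝ} {a : α} (ha : a ∈ s) {δ : ℝ}
    (h : ∀ b ∈ s, f b ≤ f a + δ) : |f a - ⨆ b : s, f b| ≤ δ := by
  have : Nonempty s := ⟨⟨a, ha⟩⟩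
  have h1 : ⨆ b : s, f b ≤ f a + δ := ciSup_le fun b => h b b.2
  have h2 : f a ≤ ⨆ b : s, f b := le_ciSup (f := fun b : s => f b)
    ⟨f a + δ, by rintro _ ⟨b, rfl⟩; exact h b b.2⟩ ⟨a, ha⟩
  have h3 := h a ha
  rw [abs_le]
  constructor <;> linarith

/-- The supremum of a uniformly bounded family of non-negative numbers. -/
theorem abs_iSup_le {α : Type*} {s : Set α} {f : α → ℝ} {δ : ℝ} (hδ : 0 ≤ δ)
    (h0 : ∀ b ∈ s, 0 ≤ f b) (h : ∀ b ∈ s, f b ≤ δ) : |⨆ b : s, f b| ≤ δ := by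
  rw [abs_of_nonneg (Real.iSup_nonneg fun b : s => h0 b b.2)]
  exact Real.iSup_le (fun b : s => h b b.2) hδ

end Regret

end CutoffMarket

end

/-! ### Regret and cutoff rates from the uniform bounds -/

theorem mainTheorem5 {J : ℕ} {𝒳 𝓑 Ω : Type*}
    [MeasurableSpace 𝒳] [StandardBorelSpace 𝒳] [MeasurableSpace 𝓑] [StandardBorelSpace 𝓑]
    [MeasurableSpace Ω] (P : Measure Ω) [IsProbabilityMeasure P]
    (Q : Measure (CutoffMarket.Agent 𝒳 𝓑)) [IsProbabilityMeasure Q]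
    (Z : ℕ → Ω → CutoffMarket.Agent 𝒳 𝓑) (split : (n : ℕ) → Ω → CutoffMarket.Split n)
    (M : CutoffMarket.Mechanism J 𝓑) (A : CutoffMarket.Estimators J 𝒳)
    (η : CutoffMarket.Nuisance J 𝒳) (c : CutoffMarket.Constants) (hc : c.Positive)
    (Rules : Set (CutoffMarket.Policy 𝒳)) (v : ℕ)
    (pstar : CutoffMarket.Policy 𝒳 → CutoffMarket.Vec J)
    (hsample : CutoffMarket.Sampling P Q Z split)
    (hmeas : CutoffMarket.Measurability P Z split M A η Rules)
    (hident : CutoffMarket.Identification Q η.e)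
    (hclear : CutoffMarket.ClearsFiniteMarkets P Z M Rules)
    (hout : CutoffMarket.RegularOutcomes Q M η c pstar Rules)
    (heq : CutoffMarket.RegularEquilibrium Q M c pstar Rules)
    (hnuis : CutoffMarket.NuisanceRates P Q Z split M A η pstar Rules)
    (hcomp : CutoffMarket.NuisanceComplexity P Z split M A c)
    (hVC : CutoffMarket.HasVCDim Rules v)
    (piHat : ℕ → Ω → CutoffMarket.Policy 𝒳)
    (hmem : ∀ n ω, piHat n ω ∈ Rules)
    (hmax : ∀ n ω, IsMaxOn
      (CutoffMarket.valueHat M A (split n ω) (fun i : Fin n => Z i ω)) Rules (piHat n ω)) :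
    -- regret in the continuum market
    CutoffMarket.IsBigOP P
      (fun n ω => CutoffMarket.contValue M Q pstar (piHat n ω)
        - ⨆ π : Rules, CutoffMarket.contValue M Q pstar π)
      (fun n => 1 / Real.sqrt n) ∧
    -- regret in the finite market
    CutoffMarket.IsBigOP P
      (fun n ω => CutoffMarket.finiteValue M (fun i : Fin n => Z i ω) (piHat n ω)
        - ⨆ π : Rules, CutoffMarket.finiteValue M (fun i : Fin n => Z i ω) π)
      (fun n => 1 / Real.sqrt n) ∧
    -- uniform convergence of the estimated cutoffs
    CutoffMarket.IsBigOP P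
      (fun n ω => ⨆ π : Rules,
        ‖CutoffMarket.cutoffHat M A (split n ω) (fun i : Fin n => Z i ω) π - pstar π‖)
      (fun n => 1 / Real.sqrt n) ∧
    -- uniform convergence of the finite-market cutoffs
    CutoffMarket.IsBigOP P
      (fun n ω => ⨆ π : Rules,
        CutoffMarket.policyExpectation (π : CutoffMarket.Policy 𝒳) (fun i : Fin n => Z i ω)
          (fun w => ‖CutoffMarket.finiteCutoff M (fun i : Fin n => Z i ω) w - pstar π‖))
      (fun n => 1 / Real.sqrt n) := by
  have hE := CutoffMarket.boundedInProb_estimators hc hsample hmeas hident hclear hout heq hnuis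
    hcomp hVC
  have hF := CutoffMarket.boundedInProb_finiteMarket hc hsample hmeas hclear hout heq hVC
  -- Continuum regret uses the estimation error at the chosen rule and at a competitor, hence 2.
  -- Finite-market regret adds the error between finite and continuum values at both rules, hence 4.
  refine ⟨hE.isBigOP (a := 2) two_pos fun n B ω hB h => ?_,
    (hE.and hF).isBigOP (a := 4) (by norm_num) fun n B ω hB h => ?_,
    hE.isBigOP one_pos fun n B ω hB h => ?_, hF.isBigOP one_pos fun n B ω hB h => ?_⟩
  · refine CutoffMarket.abs_sub_iSup_le (hmem n ω) fun π hπ => ?_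
    have h1 := abs_le.1 (h π hπ).2
    have h2 := abs_le.1 (h _ (hmem n ω)).2
    have h3 := hmax n ω hπ
    simp only [Set.mem_ofPred_eq] at h3
    linarith [h1.1, h2.2]
  · refine CutoffMarket.abs_sub_iSup_le (hmem n ω) fun π hπ => ?_
    have h1 := abs_le.1 (h.1 π hπ).2
    have h2 := abs_le.1 (h.1 _ (hmem n ω)).2
    have h3 := hmax n ω hπ
    have h4 := abs_le.1 (h.2 π hπ).2
    have h5 := abs_le.1 (h.2 _ (hmem n ω)).2
    simp only [Set.mem_ofPred_eq] at h3
    linarith [h1.1, h2.2, h4.2, h5.1]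
  · rw [one_mul]
    exact CutoffMarket.abs_iSup_le (by positivity) (fun π _ => norm_nonneg _)
      fun π hπ => (h π hπ).1
  · rw [one_mul]
    simp only [CutoffMarket.policyExpectation_eq]
    exact CutoffMarket.abs_iSup_le
      (f := fun π => ‖CutoffMarket.finiteCutoff M (fun i : Fin n => Z i ω)
        (fun i => π (CutoffMarket.cov (Z i ω))) - pstar π‖)
      (by positivity) (fun π _ => norm_nonneg _) fun π hπ => (h π hπ).1
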